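/- Let $N\ge 1$, let $P,Q$ be endomorphisms of $V=\mathbb{C}^N$, where $Q$ is a non-zero multiple of a rank one idempotent, and write $Q(x)=\phi(x)v$ with $v\in V$, $\phi\in V^*$. For an endomorphism $A$ of $V$ with eigenvalues $\alpha_1,\dots,\alpha_N$, consider the following conditions: the $\alpha_i$ are distinct and no two of them differ by a positive integer, and $A$ is in general position with respect to $Q$, i.e. if $x_1,\dots,x_N$ are corresponding eigenvectors of $A$, then $\phi(x_i)\neq 0$ for all $i$ and $v=\sum_i d_i x_i$ with $d_i\ne 0$ for all $i$; the eigenvectors are then normalised by $\phi(x_i)=1$. Assume that $P$ and $R=Q-P$ both satisfy these conditions, with eigenvalues $\lambda_i$ and normalised eigenvectors $\xi_i$ for $P$, and eigenvalues $-\mu_j$ and normalised eigenvectors $\zeta_j$ for $R$ (so that the $\mu_j$ are the eigenvalues of $P-Q$). Consider the differential equation $$\frac{df}{dz}=\frac{Pf}{z}+\frac{Qf}{1-z}\qquad (1)$$ on $\mathbb{C}\setminus[0,\infty)$, where powers are defined by $z^a=e^{a\log z}$ with $0<\operatorname{Im}\log z<2\pi$. Then there are holomorphic solutions $f_i$ and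 $h_j$ ($1\le i,j\le N$) of (1) on $\mathbb{C}\setminus[0,\infty)$ with convergent expansions $$f_i(z)=\sum_{n\ge0}\xi_{i,n}z^{\lambda_i+n}\quad(|z|<1),\qquad h_j(z)=\sum_{n\ge 0}\zeta_{j,n}z^{\mu_j-n}\quad(|z|>1),$$ where $\xi_{i,0}=\xi_i$ and $\zeta_{j,0}=\zeta_j$. For any such solutions there is exactly one matrix $(c_{ij})$ (the transport matrix) with $f_i(z)=\sum_j c_{ij}h_j(z)$ for all $i$ and all $z\in\mathbb{C}\setminus[0,\infty)$, and it is given by $$c_{ij}=e^{i\pi(\lambda_i-\mu_j)}\,\frac{\prod_{k\ne i}\Gamma(\lambda_i-\lambda_k+1)\,\prod_{\ell\neq j}\Gamma(\mu_j-\mu_\ell)}{\prod_{\ell\ne j}\Gamma(\lambda_i-\mu_\ell+1)\,\prod_{k\neq i}\Gamma(\mu_j-\lambda_k)},$$ where $1/\Gamma$ is taken to be $0$ at the poles of $\Gamma$, and the $i$ in $e^{i\pi(\lambda_i-\mu_j)}$ is the imaginary unit. -/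

import Mathlib

namespace BasicODE

noncomputable section

/-- The space `ℂ^N` in which the differential equation takes its values. -/
abbrev V (N : ℕ) : Type := Fin N → ℂ

/-- `Q` is a non-zero multiple of a rank one idempotent. -/
def IsMultipleOfRankOneIdempotent {N : ℕ} (Q : Module.End ℂ (V N)) : Prop :=
  ∃ (δ : ℂ) (E : Module.End ℂ (V N)),
    δ ≠ 0 ∧ IsIdempotentElem E ∧ Module.finrank ℂ (LinearMap.range E) = 1 ∧ Q = δ • E

/-- The conditions on an operator `A` relative to the rank one operator `x ↦ φ x • v`: the `N`
eigenvalues `α i` of `A` are distinct, no two of them differ by a positive integer, and `A` is in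
general position, that is `φ` is non-zero on the eigenvectors and all the coefficients of `v` in
terms of the eigenvectors are non-zero. The `x i` are the eigenvectors normalised by
`φ (x i) = 1`. -/
structure IsNormalizedEigensystem {N : ℕ} (φ : V N →ₗ[ℂ] ℂ) (v : V N)
    (A : Module.End ℂ (V N)) (α : Fin N → ℂ) (x : Fin N → V N) : Prop where
  apply_eq : ∀ i, A (x i) = α i • x i
  distinct : Function.Injective α
  nonresonant : ∀ i k, ∀ n : ℕ, 0 < n → α i - α k ≠ (n : ℂ)
  normalized : ∀ i, φ (x i) = 1
  generalPosition : ∃ d : Fin N → ℂ, (∀ i, d i ≠ 0) ∧ v = ∑ i, d i • x i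

/-- The cut plane `ℂ ∖ [0, ∞)`. -/
def cutPlane : Set ℂ := ((fun x : ℝ => (x : ℂ)) '' Set.Ici 0)ᶜ

/-- The power `z ^ a` on `ℂ ∖ [0, ∞)`, for the branch of the logarithm whose imaginary part lies
in `(0, 2π)`. -/
def cutPow (z a : ℂ) : ℂ := Complex.exp (a * (Complex.log (-z) + Real.pi * Complex.I))

/-- `f` solves `df/dz = P f / z + Q f / (1 - z)` on `ℂ ∖ [0, ∞)`. -/
def IsSolution {N : ℕ} (P Q : Module.End ℂ (V N)) (f : ℂ → V N) : Prop :=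
  ∀ z ∈ cutPlane, HasDerivAt f (z⁻¹ • P (f z) + (1 - z)⁻¹ • Q (f z)) z

/-- `f` is the solution on `ℂ ∖ [0, ∞)` that is given for `|z| < 1` by a convergent expansion
`∑ ξₙ z ^ (lam + n)` with `ξ₀ = ξ`. -/
def IsSolutionAtZero {N : ℕ} (P Q : Module.End ℂ (V N)) (lam : ℂ) (ξ : V N)
    (f : ℂ → V N) : Prop :=
  IsSolution P Q f ∧
    ∃ a : ℕ → V N, a 0 = ξ ∧
      ∀ z ∈ cutPlane, ‖z‖ < 1 → HasSum (fun n : ℕ => cutPow z (lam + n) • a n) (f z)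

/-- `h` is the solution on `ℂ ∖ [0, ∞)` that is given for `|z| > 1` by a convergent expansion
`∑ ζₙ z ^ (mu - n)` with `ζ₀ = ζ`. -/
def IsSolutionAtInfty {N : ℕ} (P Q : Module.End ℂ (V N)) (mu : ℂ) (ζ : V N)
    (h : ℂ → V N) : Prop :=
  IsSolution P Q h ∧
    ∃ b : ℕ → V N, b 0 = ζ ∧
      ∀ z ∈ cutPlane, 1 < ‖z‖ → HasSum (fun n : ℕ => cutPow z (mu - n) • b n) (h z)

/-- `c` is a transport matrix from the `f i` to the `h j`. -/
def IsTransportMatrix {N : ℕ} (f h : Fin N → ℂ → V N) (c : Fin N → Fin N → ℂ) : Prop :=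
  ∀ i, ∀ z ∈ cutPlane, f i z = ∑ j, c i j • h j z

end

end BasicODE

/-! Put z = -e^w, so that the cut plane becomes the strip |Im w| < π, and let F(w) = f(-e^w).
Equation (1) becomes F' = P F - g v with the scalar function g = e^w/(1+e^w) φ(F), and φ(F) = g +
e^{-w} g. Write v = Σ d_k ξ_k and let Y(s) be the Mellin transform ∫ e^{-sw} g(w) dw. The transform
M_k of the k-th coordinate of F satisfies (s-λ_k) M_k = -d_k Y(s), and Σ M_k = Y(s) + Y(s+1). Since
1 + Σ d_k/(s-λ_k) = ∏(s-μ_j)/∏(s-λ_k) (`prod_sub_eq`), the whole system collapses to one scalar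
difference equation, Y(s+1) ∏(s-λ_k) = -Y(s) ∏(s-μ_j) (`exists_mellin_data`).

The integral need not converge, so `regMellin` replaces its two tails by termwise primitives of the
expansions of g. The result is meromorphic with at most simple poles: λ_i+n contributes the residue
-α_n, and μ_j-n contributes c_j β_{j,n}, where α and β_j are the expansion coefficients of g for f_i
and for h_j. Thus c_ij is read off from the residue at μ_j. Moving the line of integration to Im w =
±2 shows that Y decays exponentially on vertical strips.

The product of Y with ∏ Γ(s-λ_k)/Γ(s-μ_k) is antiperiodic, and on a right half-plane its only poles
are simple ones at λ_i+n. After subtraction of κ/sin π(s-λ_i), for a suitable constant κ, it is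
holomorphic there and still decays, so it vanishes by the maximum principle
(`eq_zero_of_antiperiodic`). This determines Y up to κ. The residue at λ_i+1 gives κ, the residue at
μ_j then gives c_ij (`mul_residue_eq`). If μ_j-λ_i is a positive integer, both κ and Y vanish, and
the cancellation of the two contributions at μ_j gives c_ij through the recursion for α
(`coeff_eq_choose`).

The local solutions are built on the whole cut plane at once by a Frobenius series in t, where z =
4t/(1+t)^2 maps the unit disc onto ℂ ∖ [1, ∞); those at infinity come from z ↦ 1/z, which turns P
into Q-P. The formula is proved for a solution with leading coefficient τ ξ_i; the zero solution
with τ = 0 then shows that the h_j are linearly independent, hence that a transport matrix exists.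
-/

namespace BasicODE

open Filter Topology

/-! ### Power series on the unit disc -/

section PowerSeries

variable {E : Type*} [NormedAddCommGroup E]

/-- The power series with coefficients `c` converges absolutely on the open unit disc. -/
def SummableInDisc (c : ℕ → E) : Prop :=
  ∀ r : ℝ, 0 ≤ r → r < 1 → Summable fun n => ‖c n‖ * r ^ n

theorem SummableInDisc.of_norm_le {F : Type*} [NormedAddCommGroup F] {c : ℕ → E} {b : ℕ → F}
    (hc : SummableInDisc c) (C : ℝ) (h : ∀ n, ‖b n‖ ≤ C * ‖c n‖) : SummableInDisc b := by
  intro r hr0 hr1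
  refine Summable.of_nonneg_of_le (fun n => by positivity) (fun n => ?_)
    ((hc r hr0 hr1).mul_left C)
  rw [← mul_assoc]
  exact mul_le_mul_of_nonneg_right (h n) (by positivity)

variable [NormedSpace ℂ E]

/-- Convergence at one ρ in (r, 1) bounds the terms there, and a geometric series in r/ρ dominates.
-/
theorem SummableInDisc.of_hasSum {c : ℕ → E} {y : ℝ → E}
    (h : ∀ x : ℝ, 0 < x → x < 1 → HasSum (fun n => (x : ℂ) ^ n • c n) (y x)) :
    SummableInDisc c := by
  intro r hr0 hr1
  obtain ⟨ρ, hρ1, hρ2⟩ := exists_between hr1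
  have hρ0 : 0 < ρ := hr0.trans_lt hρ1
  have ht := (h ρ hρ0 hρ2).summable.tendsto_atTop_zero.norm
  obtain ⟨B, hB⟩ := ht.bddAbove_range
  have hg : Summable fun n : ℕ => B * (r / ρ) ^ n :=
    (summable_geometric_of_lt_one (by positivity) ((div_lt_one hρ0).2 hρ1)).mul_left B
  refine Summable.of_nonneg_of_le (fun n => by positivity) (fun n => ?_) hg
  have h1 : ‖(ρ : ℂ) ^ n • c n‖ ≤ B := hB ⟨n, rfl⟩
  rw [norm_smul, norm_pow, Complex.norm_real, Real.norm_of_nonneg hρ0.le] at h1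
  calc ‖c n‖ * r ^ n = (ρ ^ n * ‖c n‖) * (r / ρ) ^ n := by
        rw [div_pow]; field_simp
    _ ≤ _ := mul_le_mul_of_nonneg_right h1 (by positivity)

/-- The sum of the power series with coefficients `c`. -/
noncomputable def psum (c : ℕ → E) (x : ℂ) : E := ∑' n, x ^ n • c n

variable [CompleteSpace E]

theorem SummableInDisc.hasSum {c : ℕ → E} (hc : SummableInDisc c) {x : ℂ} (hx : ‖x‖ < 1) :
    HasSum (fun n => x ^ n • c n) (psum c x) := by
  refine Summable.hasSum (Summable.of_norm ?_)
  refine (hc ‖x‖ (norm_nonneg _) hx).congr fun n => ?_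
  rw [norm_smul, norm_pow, mul_comm]

theorem SummableInDisc.exists_hasDerivAt {c : ℕ → E} (hc : SummableInDisc c) {x : ℂ}
    (hx : ‖x‖ < 1) :
    ∃ d, HasDerivAt (psum c) d x ∧ HasSum (fun n : ℕ => ((n : ℂ) * x ^ n) • c n) (x • d) := by
  obtain ⟨ρ, hρ1, hρ2⟩ := exists_between hx
  have hρ0 : 0 ≤ ρ := (norm_nonneg x).trans hρ1.le
  have hb : ∀ n : ℕ, ∀ w ∈ Metric.ball (0 : ℂ) ρ, ‖w ^ n • c n‖ ≤ ‖c n‖ * ρ ^ n := by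
    intro n w hw
    rw [norm_smul, norm_pow, mul_comm]
    rw [mem_ball_zero_iff] at hw
    gcongr
  have hd : ∀ n : ℕ, DifferentiableOn ℂ (fun w : ℂ => w ^ n • c n) (Metric.ball 0 ρ) :=
    fun n => by fun_prop
  have hxm : x ∈ Metric.ball (0 : ℂ) ρ := by simpa using hρ1
  have h1 := Complex.differentiableOn_tsum_of_summable_norm (hc ρ hρ0 hρ2) hd Metric.isOpen_ball hb
  have h2 := Complex.hasSum_deriv_of_summable_norm (hc ρ hρ0 hρ2) hd Metric.isOpen_ball hb hxm
  refine ⟨_, (h1.differentiableAt (Metric.isOpen_ball.mem_nhds hxm)).hasDerivAt, ?_⟩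
  refine (h2.const_smul x).congr_fun fun n => ?_
  have h3 : HasDerivAt (fun w : ℂ => w ^ n • c n) (((n : ℂ) * x ^ (n - 1)) • c n) x :=
    (hasDerivAt_pow n x).smul_const (c n)
  rw [h3.deriv, smul_smul]
  rcases n with _ | n
  · simp
  · congr 1; simp [pow_succ]; ring

/-- Once the earlier coefficients vanish, dividing by x^n and letting x tend to 0 from the right
isolates the n-th one. -/
theorem SummableInDisc.eq_zero {c : ℕ → E} (hc : SummableInDisc c)
    (h : ∀ x : ℝ, 0 < x → x < 1 → psum c x = 0) : ∀ n, c n = 0 := by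
  intro n
  induction n using Nat.strong_induction_on with
  | _ n ih =>
    have hs : SummableInDisc fun k => c (k + n) := by
      intro r hr0 hr1
      rcases hr0.eq_or_lt with rfl | hr0
      · refine summable_of_ne_finset_zero (s := {0}) fun k hk => ?_
        rw [Finset.mem_singleton] at hk
        simp [hk]
      · have := ((summable_nat_add_iff n).2 (hc r hr0.le hr1)).mul_left ((r ^ n)⁻¹)
        refine this.congr fun k => ?_
        rw [pow_add]
        field_simp
    have hz : ∀ x : ℝ, 0 < x → x < 1 → psum (fun k => c (k + n)) x = 0 := by
      intro x hx0 hx1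
      have hx : ‖(x : ℂ)‖ < 1 := by rwa [Complex.norm_real, Real.norm_of_nonneg hx0.le]
      have h1 := hc.hasSum hx
      rw [h x hx0 hx1, ← hasSum_nat_add_iff' n, Finset.sum_eq_zero fun k hk => by
        rw [ih k (Finset.mem_range.1 hk), smul_zero], sub_zero] at h1
      have h2 := (hs.hasSum hx).const_smul ((x : ℂ) ^ n)
      have h3 := h2.unique (h1.congr_fun fun k => by rw [smul_smul, ← pow_add, add_comm])
      exact (smul_eq_zero.1 h3).resolve_left (pow_ne_zero _ (by exact_mod_cast hx0.ne'))
    obtain ⟨d, hd, -⟩ := hs.exists_hasDerivAt (x := 0) (by simp)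
    have h0 : psum (fun k => c (k + n)) 0 = c n := by
      have := hs.hasSum (x := 0) (by simp)
      refine this.unique ?_
      convert hasSum_single (f := fun k : ℕ => (0 : ℂ) ^ k • c (k + n)) 0 ?_ using 1
      · simp
      · intro b hb; simp [hb]
    have h1 : Tendsto (fun x : ℝ => (x : ℂ)) (𝓝[>] 0) (𝓝 0) := by
      have : Tendsto (fun x : ℝ => (x : ℂ)) (𝓝 0) (𝓝 ((0 : ℝ) : ℂ)) :=
        Complex.continuous_ofReal.tendsto 0
      simpa using this.mono_left nhdsWithin_le_nhds
    have h2 := hd.continuousAt.tendsto.comp h1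
    rw [h0] at h2
    refine tendsto_nhds_unique h2 (tendsto_const_nhds.congr' ?_)
    filter_upwards [Ioo_mem_nhdsGT (zero_lt_one' ℝ)] with x hx
    exact (hz x hx.1 hx.2).symm

theorem SummableInDisc.congr_of_psum {c b : ℕ → E} (hc : SummableInDisc c)
    (hb : SummableInDisc b) (h : ∀ x : ℝ, 0 < x → x < 1 → psum c x = psum b x) (n : ℕ) :
    c n = b n := by
  have hs : SummableInDisc fun n => c n - b n := by
    intro r h0 h1
    refine Summable.of_nonneg_of_le (fun n => by positivity) (fun n => ?_)
      ((hc r h0 h1).add (hb r h0 h1))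
    rw [← add_mul]
    exact mul_le_mul_of_nonneg_right (norm_sub_le _ _) (by positivity)
  refine sub_eq_zero.1 (hs.eq_zero (fun x h0 h1 => ?_) n)
  have hx : ‖(x : ℂ)‖ < 1 := by rwa [Complex.norm_real, Real.norm_of_nonneg h0.le]
  have h2 := (hc.hasSum hx).sub (hb.hasSum hx)
  rw [h x h0 h1, sub_self] at h2
  exact (hs.hasSum hx).unique (h2.congr_fun fun k => by rw [smul_sub])

end PowerSeries

/-! ### Frobenius series in the Koebe coordinate -/

section Frobenius

variable {E : Type*} [NormedAddCommGroup E] [NormedSpace ℂ E]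

/-- With C = 4Q - 2T this is the coefficient form of t(1-t^2) G' = (1-t)^2 T G + 4t Q G; index 1 is
separate because it has no second predecessor. -/
theorem exists_threeTerm (T C : E →L[ℂ] E)
    (hT : ∀ n : ℕ, 0 < n → Function.Surjective fun x => (n : ℂ) • x - T x) (ξ : E) :
    ∃ g : ℕ → E, g 0 = ξ ∧ g 1 - T (g 1) = C (g 0) ∧
      ∀ n : ℕ, ((n + 2 : ℕ) : ℂ) • g (n + 2) - T (g (n + 2))
        = ((n : ℂ) • g n + T (g n)) + C (g (n + 1)) := by
  choose inv hinv using hT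
  let step : ℕ → E × E → E × E := fun n p =>
    (p.2, inv (n + 2) (by omega) (((n : ℂ) • p.1 + T p.1) + C p.2))
  let s : ℕ → E × E := fun n =>
    Nat.rec (ξ, inv 1 one_pos (C ξ)) (fun n p => step n p) n
  have hs : ∀ n, s (n + 1) = step n (s n) := fun n => rfl
  have h1 : ∀ n, (s (n + 1)).1 = (s n).2 := fun n => by rw [hs]
  refine ⟨fun n => (s n).1, rfl, ?_, fun n => ?_⟩
  · have := hinv 1 one_pos (C ξ)
    simpa [h1, s] using this
  · have h2 : (s (n + 2)).1 =
        inv (n + 2) (by omega) (((n : ℂ) • (s n).1 + T (s n).1) + C (s n).2) := by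
      exact (h1 (n + 1)).trans (by rw [hs])
    have h3 := hinv (n + 2) (by omega) (((n : ℂ) • (s n).1 + T (s n).1) + C (s n).2)
    simp only [h2, h1]
    exact h3

/-- The factors n+2 and n on the two sides have ratio tending to 1, so for ρ < 1 the gain ρ^2
eventually absorbs the bounded operators T and C, and ‖g n‖ ρ^n stays below the maximum of its first
values. -/
theorem summableInDisc_of_threeTerm (T C : E →L[ℂ] E) (g : ℕ → E)
    (h : ∀ n : ℕ, ((n + 2 : ℕ) : ℂ) • g (n + 2) - T (g (n + 2))
        = ((n : ℂ) • g n + T (g n)) + C (g (n + 1))) : SummableInDisc g := by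
  have key : ∀ ρ : ℝ, 0 < ρ → ρ < 1 → ∃ B, ∀ n, ‖g n‖ * ρ ^ n ≤ B := by
    intro ρ h0 h1
    have hρ : 0 < 1 - ρ ^ 2 := by nlinarith
    -- Beyond n₀ one has (n+‖T‖) ρ^2 + ‖C‖ ρ ≤ n + 2 - ‖T‖, with the right side positive.
    obtain ⟨n₀, hn₀⟩ := exists_nat_gt
      (max ‖T‖ ((‖T‖ * ρ ^ 2 + ‖C‖ * ρ + ‖T‖) / (1 - ρ ^ 2)))
    obtain ⟨hn1, hn2⟩ := max_lt_iff.1 hn₀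
    rw [div_lt_iff₀ hρ] at hn2
    have step : ∀ n, n₀ ≤ n → ∀ B, ‖g n‖ * ρ ^ n ≤ B → ‖g (n + 1)‖ * ρ ^ (n + 1) ≤ B →
        ‖g (n + 2)‖ * ρ ^ (n + 2) ≤ B := by
      intro n hn B hB1 hB2
      have hnn : (n₀ : ℝ) ≤ n := by exact_mod_cast hn
      have hB : 0 ≤ B := le_trans (by positivity) hB1
      have hpos : 0 < (n : ℝ) + 2 - ‖T‖ := by linarith
      have e1 : ((n : ℝ) + 2 - ‖T‖) * ‖g (n + 2)‖ ≤ (n + ‖T‖) * ‖g n‖ + ‖C‖ * ‖g (n + 1)‖ := by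
        have a1 : ‖((n + 2 : ℕ) : ℂ) • g (n + 2)‖ = ((n : ℝ) + 2) * ‖g (n + 2)‖ := by
          rw [norm_smul, Complex.norm_natCast]; push_cast; ring
        have a2 := norm_sub_norm_le (((n + 2 : ℕ) : ℂ) • g (n + 2)) (T (g (n + 2)))
        rw [h n, a1] at a2
        have a3 : ‖((n : ℂ) • g n + T (g n)) + C (g (n + 1))‖
            ≤ n * ‖g n‖ + ‖T‖ * ‖g n‖ + ‖C‖ * ‖g (n + 1)‖ := by
          refine (norm_add_le _ _).trans (add_le_add ((norm_add_le _ _).trans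
            (add_le_add ?_ (T.le_opNorm _))) (C.le_opNorm _))
          rw [norm_smul, Complex.norm_natCast]
        have a4 := T.le_opNorm (g (n + 2))
        linarith
      have e2 : ((n : ℝ) + 2 - ‖T‖) * (‖g (n + 2)‖ * ρ ^ (n + 2))
          ≤ ((n : ℝ) + 2 - ‖T‖) * B := by
        calc ((n : ℝ) + 2 - ‖T‖) * (‖g (n + 2)‖ * ρ ^ (n + 2))
            = (((n : ℝ) + 2 - ‖T‖) * ‖g (n + 2)‖) * ρ ^ (n + 2) := by ring
          _ ≤ ((n + ‖T‖) * ‖g n‖ + ‖C‖ * ‖g (n + 1)‖) * ρ ^ (n + 2) := by gcongr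
          _ = (n + ‖T‖) * ρ ^ 2 * (‖g n‖ * ρ ^ n) + ‖C‖ * ρ * (‖g (n + 1)‖ * ρ ^ (n + 1)) := by
              ring
          _ ≤ (n + ‖T‖) * ρ ^ 2 * B + ‖C‖ * ρ * B := by gcongr
          _ = ((n + ‖T‖) * ρ ^ 2 + ‖C‖ * ρ) * B := by ring
          _ ≤ _ := by
              refine mul_le_mul_of_nonneg_right ?_ hB
              have : (n₀ : ℝ) * (1 - ρ ^ 2) ≤ n * (1 - ρ ^ 2) := by gcongr
              nlinarith
      exact le_of_mul_le_mul_left e2 hpos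
    obtain ⟨B, hB⟩ := ((Finset.range (n₀ + 2)).image fun n => ‖g n‖ * ρ ^ n).bddAbove
    have hB' : ∀ n, n < n₀ + 2 → ‖g n‖ * ρ ^ n ≤ B := fun n hn =>
      hB (by simpa using ⟨n, hn, rfl⟩)
    refine ⟨B, fun n => ?_⟩
    induction n using Nat.strong_induction_on with
    | _ n ih =>
      by_cases hn : n < n₀ + 2
      · exact hB' n hn
      · obtain ⟨m, rfl⟩ : ∃ m, n = m + 2 := ⟨n - 2, by omega⟩
        exact step m (by omega) B (ih m (by omega)) (ih (m + 1) (by omega))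
  intro r hr0 hr1
  obtain ⟨ρ, hρ1, hρ2⟩ := exists_between hr1
  have hρ0 : 0 < ρ := hr0.trans_lt hρ1
  obtain ⟨B, hB⟩ := key ρ hρ0 hρ2
  have hg : Summable fun n : ℕ => B * (r / ρ) ^ n :=
    (summable_geometric_of_lt_one (by positivity) ((div_lt_one hρ0).2 hρ1)).mul_left B
  refine Summable.of_nonneg_of_le (fun n => by positivity) (fun n => ?_) hg
  calc ‖g n‖ * r ^ n = (‖g n‖ * ρ ^ n) * (r / ρ) ^ n := by
        rw [div_pow]; field_simp
    _ ≤ _ := mul_le_mul_of_nonneg_right (hB n) (by positivity)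

/-- This is z dG/dz = T G + z/(1-z) Q G pulled back along z = 4t/(1+t)^2, for which dz/z =
(1-t)/(t(1+t)) dt and z/(1-z) = 4t/(1-t)^2. The singular points z = 1 and z = ∞ go to t = ±1, so the
Frobenius series at 0 converges on the whole disc. -/
theorem exists_koebe_solution [CompleteSpace E] (T Q : E →L[ℂ] E)
    (hT : ∀ n : ℕ, 0 < n → Function.Surjective fun x => (n : ℂ) • x - T x) (ξ : E)
    (hξ : T ξ = 0) :
    ∃ G : ℂ → E, G 0 = ξ ∧ ∀ t : ℂ, ‖t‖ < 1 → ∃ d, HasDerivAt G d t ∧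
      (t * (1 - t ^ 2)) • d = (1 - t) ^ 2 • T (G t) + (4 * t) • Q (G t) := by
  obtain ⟨g, hg0, hg1, hg⟩ := exists_threeTerm T ((4 : ℂ) • Q - (2 : ℂ) • T) hT ξ
  have hs := summableInDisc_of_threeTerm _ _ g hg
  set C := (4 : ℂ) • Q - (2 : ℂ) • T with hC
  refine ⟨psum g, ?_, fun t ht => ?_⟩
  · have := hs.hasSum (x := 0) (by simp)
    refine this.unique ?_
    convert hasSum_single (f := fun k : ℕ => (0 : ℂ) ^ k • g k) 0 ?_ using 1
    · simp [hg0]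
    · intro b hb; simp [hb]
  · obtain ⟨d, hd, hd'⟩ := hs.exists_hasDerivAt ht
    refine ⟨d, hd, ?_⟩
    have s0 := hs.hasSum ht
    have sT := T.hasSum s0
    have sC := C.hasSum s0
    have l := hd'.sub sT
    rw [← hasSum_nat_add_iff' 2] at l
    have r1 := (hd'.add sT).const_smul (t ^ 2)
    rw [← hasSum_nat_add_iff' 1] at sC
    have r2 := sC.const_smul t
    have := l.unique ((r1.add r2).congr_fun fun n => ?_)
    · simp only [Finset.sum_range_succ, Finset.sum_range_zero, map_smul] at this
      simp only [hg0, hξ] at this hg1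
      rw [← sub_eq_zero]
      rw [← sub_eq_zero] at this hg1
      have e : ∀ x, C x = (4 : ℂ) • Q x - (2 : ℂ) • T x := fun x => by simp [hC]
      simp only [e] at this hg1
      push_cast at this
      linear_combination (norm := module) this + t • hg1
    · have h2 := congrArg (fun x => t ^ (n + 2) • x) (hg n)
      simp only [map_smul, smul_add, smul_sub] at h2 ⊢
      rw [← sub_eq_zero] at h2 ⊢
      rw [← h2]
      push_cast
      module

end Frobenius

/-! ### The cut plane -/

theorem mem_cutPlane_iff {z : ℂ} : z ∈ cutPlane ↔ -z ∈ Complex.slitPlane := by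
  rw [Complex.mem_slitPlane_iff, cutPlane, Set.mem_compl_iff]
  constructor
  · intro h
    by_contra! hc
    refine h ⟨z.re, ?_, ?_⟩
    · simpa using hc.1
    · refine Complex.ext (by simp) ?_
      have := hc.2
      simp at this ⊢
      exact this.symm
  · rintro h ⟨x, hx, rfl⟩
    rw [Set.mem_Ici] at hx
    simp at h
    linarith

theorem ne_zero_of_mem_cutPlane {z : ℂ} (hz : z ∈ cutPlane) : z ≠ 0 := by
  rintro rfl
  simp [mem_cutPlane_iff] at hz

theorem one_sub_mem_slitPlane {z : ℂ} (hz : z ∈ cutPlane) : 1 - z ∈ Complex.slitPlane := by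
  rw [mem_cutPlane_iff, Complex.mem_slitPlane_iff] at hz
  rw [Complex.mem_slitPlane_iff]
  simp at hz ⊢
  rcases hz with hz | hz
  · left; linarith
  · right; exact hz

theorem one_sub_ne_zero {z : ℂ} (hz : z ∈ cutPlane) : 1 - z ≠ 0 :=
  Complex.slitPlane_ne_zero (one_sub_mem_slitPlane hz)

theorem one_sub_mem_slitPlane_of_norm_lt_one {z : ℂ} (hz : ‖z‖ < 1) :
    1 - z ∈ Complex.slitPlane := by
  rw [Complex.mem_slitPlane_iff]
  left
  have := (Complex.re_le_norm z).trans_lt hz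
  simp only [Complex.sub_re, Complex.one_re]
  linarith

theorem cutPow_add {z : ℂ} (a b : ℂ) : cutPow z (a + b) = cutPow z a * cutPow z b := by
  rw [cutPow, cutPow, cutPow, ← Complex.exp_add, add_mul]

theorem cutPow_natCast {z : ℂ} (hz : z ∈ cutPlane) (n : ℕ) : cutPow z n = z ^ n := by
  rw [cutPow, Complex.exp_nat_mul, Complex.exp_add,
    Complex.exp_log (neg_ne_zero.2 (ne_zero_of_mem_cutPlane hz)), Complex.exp_pi_mul_I]
  simp

theorem hasDerivAt_cutPow {z : ℂ} (hz : z ∈ cutPlane) (a : ℂ) :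
    HasDerivAt (fun z => cutPow z a) (cutPow z a * (a * z⁻¹)) z := by
  have h1 : HasDerivAt (fun z : ℂ => Complex.log (-z)) (z⁻¹) z := by
    convert (hasDerivAt_neg z).clog (mem_cutPlane_iff.1 hz) using 1
    rw [neg_div_neg_eq, one_div]
  exact ((h1.add_const _).const_mul a).cexp

/-! ### The inverse of the Koebe function -/

/-- The square root of `1 - z` with positive real part. -/
noncomputable def koebeRoot (z : ℂ) : ℂ := Complex.exp (Complex.log (1 - z) / 2)

/-- The inverse of `t ↦ 4 t / (1 + t) ^ 2`. -/
noncomputable def koebeInv (z : ℂ) : ℂ := (1 - koebeRoot z) / (1 + koebeRoot z)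

theorem koebeRoot_sq {z : ℂ} (hz : 1 - z ∈ Complex.slitPlane) : koebeRoot z ^ 2 = 1 - z := by
  rw [koebeRoot, ← Complex.exp_nat_mul]
  push_cast
  rw [mul_div_cancel₀ _ two_ne_zero, Complex.exp_log (Complex.slitPlane_ne_zero hz)]

theorem koebeRoot_re_pos {z : ℂ} (hz : 1 - z ∈ Complex.slitPlane) : 0 < (koebeRoot z).re := by
  rw [koebeRoot, Complex.exp_re]
  refine mul_pos (Real.exp_pos _) (Real.cos_pos_of_mem_Ioo ?_)
  have h : (Complex.log (1 - z) / 2).im = (1 - z).arg / 2 := by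
    rw [Complex.div_ofNat_im, Complex.log_im]
  rw [h]
  have h1 := Complex.neg_pi_lt_arg (1 - z)
  have h2 := (Complex.arg_le_pi (1 - z)).lt_of_ne (Complex.slitPlane_arg_ne_pi hz)
  constructor <;> linarith

theorem one_add_koebeRoot_ne_zero {z : ℂ} (hz : 1 - z ∈ Complex.slitPlane) :
    1 + koebeRoot z ≠ 0 := by
  intro h
  have := congrArg Complex.re h
  have h2 := koebeRoot_re_pos hz
  simp at this
  linarith

/-- For q = `koebeRoot z`, the inequality |1-q| < |1+q| says exactly that Re q > 0. -/
theorem norm_koebeInv_lt_one {z : ℂ} (hz : 1 - z ∈ Complex.slitPlane) : ‖koebeInv z‖ < 1 := by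
  rw [koebeInv, norm_div, div_lt_one (norm_pos_iff.2 (one_add_koebeRoot_ne_zero hz)),
    ← sq_lt_sq₀ (norm_nonneg _) (norm_nonneg _), ← Complex.normSq_eq_norm_sq,
    ← Complex.normSq_eq_norm_sq, Complex.normSq_apply, Complex.normSq_apply]
  have := koebeRoot_re_pos hz
  simp
  nlinarith

theorem koebeInv_zero : koebeInv 0 = 0 := by simp [koebeInv, koebeRoot]

theorem hasDerivAt_koebeRoot {z : ℂ} (hz : 1 - z ∈ Complex.slitPlane) :
    HasDerivAt koebeRoot (-(1 / (2 * koebeRoot z))) z := by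
  have h1 : HasDerivAt (fun z : ℂ => Complex.log (1 - z) / 2) (-1 / (1 - z) / 2) z :=
    (((hasDerivAt_id z).const_sub 1).clog hz).div_const 2
  refine h1.cexp.congr_deriv ?_
  change koebeRoot z * _ = _
  have h0 : koebeRoot z ≠ 0 := Complex.exp_ne_zero _
  rw [← koebeRoot_sq hz]
  field_simp

theorem hasDerivAt_koebeInv {z : ℂ} (hz : 1 - z ∈ Complex.slitPlane) :
    HasDerivAt koebeInv (1 / (koebeRoot z * (1 + koebeRoot z) ^ 2)) z := by
  have h0 : koebeRoot z ≠ 0 := Complex.exp_ne_zero _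
  have h1 := one_add_koebeRoot_ne_zero hz
  have hq := hasDerivAt_koebeRoot hz
  refine ((hq.const_sub 1).div (hq.const_add 1) h1).congr_deriv ?_
  field_simp
  ring

/-! ### Existence of the local solutions -/

/-- The solution is z^λ G(t(z)), defined on the entire cut plane. The factor G(t(z)) is holomorphic
on |z| < 1, including z = 0, so its Taylor series provides the required expansion. -/
theorem exists_isSolutionAtZero {N : ℕ} (P Q : Module.End ℂ (V N)) (lam : ℂ) (ξ : V N)
    (hξ : P ξ = lam • ξ) (hP : ∀ n : ℕ, 0 < n → ∀ x, P x = (lam + n) • x → x = 0) :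
    ∃ f, IsSolutionAtZero P Q lam ξ f := by
  set T : V N →L[ℂ] V N := LinearMap.toContinuousLinearMap (P - lam • LinearMap.id) with hTdef
  set Q' : V N →L[ℂ] V N := LinearMap.toContinuousLinearMap Q with hQdef
  have hT : ∀ x, T x = P x - lam • x := fun x => by simp [hTdef]
  have hQ' : ∀ x, Q' x = Q x := fun x => by simp [hQdef]
  have hsurj : ∀ n : ℕ, 0 < n → Function.Surjective fun x => (n : ℂ) • x - T x := by
    intro n hn
    have hL : (fun x => (n : ℂ) • x - T x)
        = ((n : ℂ) • LinearMap.id - (P - lam • LinearMap.id) : V N →ₗ[ℂ] V N) := by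
      ext x; simp [hT]
    -- In finite dimension the recursion is solvable as soon as λ + n is not an eigenvalue of P.
    rw [hL, ← LinearMap.injective_iff_surjective, ← LinearMap.ker_eq_bot, LinearMap.ker_eq_bot']
    intro x hx
    refine hP n hn x ?_
    simp only [LinearMap.sub_apply, LinearMap.smul_apply, LinearMap.id_apply] at hx
    rw [← sub_eq_zero] at hx ⊢
    linear_combination (norm := module) -hx
  obtain ⟨G, hG0, hG⟩ := exists_koebe_solution T Q' hsurj ξ (by rw [hT, hξ, sub_self])
  have hd : ∀ z : ℂ, 1 - z ∈ Complex.slitPlane → z ≠ 0 →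
      HasDerivAt (fun z => G (koebeInv z))
        (z⁻¹ • T (G (koebeInv z)) + (1 - z)⁻¹ • Q (G (koebeInv z))) z := by
    intro z hz hz0
    obtain ⟨d, hd, he⟩ := hG _ (norm_koebeInv_lt_one hz)
    refine (hd.scomp z (hasDerivAt_koebeInv hz)).congr_deriv ?_
    have h0 : koebeRoot z ≠ 0 := Complex.exp_ne_zero _
    have h1 := one_add_koebeRoot_ne_zero hz
    have h2 : z = 1 - koebeRoot z ^ 2 := by rw [koebeRoot_sq hz]; ring
    have h3 : 1 - koebeRoot z ≠ 0 := fun h => hz0 (by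
      rw [h2]; linear_combination (1 + koebeRoot z) * h)
    rw [hQ'] at he
    set q := koebeRoot z with hq
    set t := koebeInv z with ht
    have htq : t = (1 - q) / (1 + q) := rfl
    have ec : t * (1 - t ^ 2) ≠ 0 := by
      rw [htq]
      have : (1 - q) / (1 + q) * (1 - ((1 - q) / (1 + q)) ^ 2)
          = 4 * q * (1 - q) / (1 + q) ^ 3 := by field_simp; ring
      rw [this]
      exact div_ne_zero (mul_ne_zero (mul_ne_zero (by norm_num) h0) h3) (pow_ne_zero _ h1)
    have hdd : d = (t * (1 - t ^ 2))⁻¹ • ((1 - t) ^ 2 • T (G t) + (4 * t) • Q (G t)) := by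
      rw [← he, smul_smul, inv_mul_cancel₀ ec, one_smul]
    rw [hdd, smul_smul, smul_add, smul_smul, smul_smul]
    have hzz : 1 - z = q ^ 2 := (koebeRoot_sq hz).symm
    have e0 : t * (1 - t ^ 2) = 4 * q * (1 - q) / (1 + q) ^ 3 := by
      rw [htq]; field_simp; ring
    have e3 : 1 - t = 2 * q / (1 + q) := by rw [htq]; field_simp; ring
    have e4 : z = (1 - q) * (1 + q) := by rw [h2]; ring
    congr 2
    · rw [e0, e3, e4]; field_simp; norm_num
    · rw [e0, hzz, htq]; field_simp
  refine ⟨fun z => cutPow z lam • G (koebeInv z), fun z hz => ?_, ?_⟩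
  · have h0 := ne_zero_of_mem_cutPlane hz
    refine ((hasDerivAt_cutPow hz lam).smul (hd z (one_sub_mem_slitPlane hz) h0)).congr_deriv ?_
    simp only [map_smul, hT]
    module
  · have hdiff : DifferentiableOn ℂ (fun z => G (koebeInv z)) (Metric.ball 0 1) := by
      intro z hz
      have hz1 := one_sub_mem_slitPlane_of_norm_lt_one (mem_ball_zero_iff.1 hz)
      obtain ⟨d, hd, -⟩ := hG _ (norm_koebeInv_lt_one hz1)
      exact (hd.scomp z (hasDerivAt_koebeInv hz1)).differentiableAt.differentiableWithinAt
    refine ⟨fun n => ((n.factorial : ℂ))⁻¹ • iteratedDeriv n (fun z => G (koebeInv z)) 0, ?_,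
      fun z hz hz1 => ?_⟩
    · simp [koebeInv_zero, hG0]
    · have := (Complex.hasSum_taylorSeries_on_ball hdiff (mem_ball_zero_iff.2 hz1)).const_smul
        (cutPow z lam)
      refine this.congr_fun fun n => ?_
      rw [cutPow_add, cutPow_natCast hz]
      simp only [sub_zero, smul_smul]
      congr 1
      ring

/-! ### The inversion z ↦ 1/z and the solutions at infinity. -/

theorem inv_mem_cutPlane {z : ℂ} (hz : z ∈ cutPlane) : z⁻¹ ∈ cutPlane := by
  have h0 := ne_zero_of_mem_cutPlane hz
  rw [mem_cutPlane_iff, Complex.mem_slitPlane_iff] at hz ⊢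
  have h1 : 0 < Complex.normSq z := Complex.normSq_pos.2 h0
  rw [← inv_neg, Complex.inv_re, Complex.inv_im, Complex.normSq_neg]
  refine hz.imp (fun h => div_pos h h1) fun h => div_ne_zero (neg_ne_zero.2 h) h1.ne'

/-- Keeping the imaginary part in (0, 2π) forces log(1/z) = -log z + 2πi, whence the extra
exponential. -/
theorem cutPow_inv {z : ℂ} (hz : z ∈ cutPlane) (a : ℂ) :
    cutPow z⁻¹ a = cutPow z (-a) * Complex.exp (2 * Real.pi * Complex.I * a) := by
  rw [cutPow, cutPow, ← Complex.exp_add, ← inv_neg,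
    Complex.log_inv _ (Complex.slitPlane_arg_ne_pi (mem_cutPlane_iff.1 hz))]
  congr 1
  ring

/-- Inversion exchanges 0 and ∞ and carries (1) to the same equation with Q - P in place of P. The
constant factor compensates the e^{-2πiμ} that the branch of the power produces, so that the leading
coefficient is ζ itself. -/
theorem IsSolutionAtZero.comp_inv {N : ℕ} {P Q : Module.End ℂ (V N)} {mu : ℂ} {ζ : V N}
    {f : ℂ → V N} (hf : IsSolutionAtZero (Q - P) Q (-mu) ζ f) :
    IsSolutionAtInfty P Q mu ζ
      (fun z => Complex.exp (2 * Real.pi * Complex.I * mu) • f z⁻¹) := by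
  obtain ⟨hs, a, ha0, ha⟩ := hf
  refine ⟨fun z hz => ?_, a, ha0, fun z hz hz1 => ?_⟩
  · have h0 := ne_zero_of_mem_cutPlane hz
    have h1 := one_sub_ne_zero hz
    have h2 := one_sub_ne_zero (inv_mem_cutPlane hz)
    refine (((hs _ (inv_mem_cutPlane hz)).scomp z (hasDerivAt_inv h0)).const_smul
      (Complex.exp (2 * Real.pi * Complex.I * mu))).congr_deriv ?_
    simp only [map_smul, LinearMap.sub_apply, inv_inv]
    have h4 : (1 - z)⁻¹ = -((z ^ 2)⁻¹ * z) - (z ^ 2)⁻¹ * (1 - z⁻¹)⁻¹ := by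
      have : 1 - z⁻¹ = (z - 1) / z := by field_simp
      rw [this]
      have h5 : z - 1 ≠ 0 := fun h => h1 (by linear_combination -h)
      field_simp
      ring
    have h6 : z⁻¹ = (z ^ 2)⁻¹ * z := by field_simp
    rw [h4]
    generalize f z⁻¹ = y
    generalize (1 - z⁻¹)⁻¹ = w
    rw [h6]
    module
  · have hz' : ‖z⁻¹‖ < 1 := by rw [norm_inv]; exact inv_lt_one_of_one_lt₀ hz1
    have := (ha _ (inv_mem_cutPlane hz) hz').const_smul
      (Complex.exp (2 * Real.pi * Complex.I * mu))
    refine this.congr_fun fun n => ?_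
    rw [cutPow_inv hz, smul_smul]
    congr 1
    rw [show -(-mu + (n : ℂ)) = mu - n by ring, mul_left_comm, ← Complex.exp_add,
      show 2 * Real.pi * Complex.I * mu + 2 * Real.pi * Complex.I * (-mu + n)
        = n * (2 * Real.pi * Complex.I) by ring, Complex.exp_nat_mul_two_pi_mul_I, mul_one]

/-! ### Eigenbases -/

section Eigensystem

variable {N : ℕ} {φ : V N →ₗ[ℂ] ℂ} {v : V N} {A : Module.End ℂ (V N)} {α : Fin N → ℂ}
  {x : Fin N → V N}

theorem IsNormalizedEigensystem.linearIndependent (h : IsNormalizedEigensystem φ v A α x) :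
    LinearIndependent ℂ x := by
  refine Module.End.eigenvectors_linearIndependent' A α h.distinct x fun i =>
    Module.End.hasEigenvector_iff.2 ⟨Module.End.mem_eigenspace_iff.2 (h.apply_eq i), fun h0 => ?_⟩
  have := h.normalized i
  rw [h0, map_zero] at this
  exact zero_ne_one this

/-- The basis of normalised eigenvectors. -/
noncomputable def IsNormalizedEigensystem.basis (h : IsNormalizedEigensystem φ v A α x) :
    Module.Basis (Fin N) ℂ (V N) :=
  basisOfLinearIndependentOfCardEqFinrank' x h.linearIndependent (by simp)

theorem IsNormalizedEigensystem.basis_apply (h : IsNormalizedEigensystem φ v A α x) (i : Fin N) :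
    h.basis i = x i := by
  simp [IsNormalizedEigensystem.basis]

theorem IsNormalizedEigensystem.repr_apply (h : IsNormalizedEigensystem φ v A α x) (y : V N)
    (i : Fin N) : h.basis.repr (A y) i = α i * h.basis.repr y i := by
  have : (h.basis.coord i).comp A = α i • h.basis.coord i := by
    refine h.basis.ext fun k => ?_
    simp only [LinearMap.comp_apply, LinearMap.smul_apply, h.basis_apply, h.apply_eq, map_smul]
    rw [← h.basis_apply]
    by_cases hik : k = i
    · simp [hik]
    · simp [hik]
  exact congrArg (fun L => L y) this

theorem IsNormalizedEigensystem.apply_eq_sum (h : IsNormalizedEigensystem φ v A α x) (y : V N) :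
    φ y = ∑ i, h.basis.repr y i := by
  nth_rewrite 1 [← h.basis.sum_repr y]
  simp [h.basis_apply, h.normalized]

theorem IsNormalizedEigensystem.eq_zero (h : IsNormalizedEigensystem φ v A α x) {i : Fin N}
    {n : ℕ} (hn : 0 < n) {y : V N} (hy : A y = (α i + n) • y) : y = 0 := by
  refine h.basis.repr.map_eq_zero_iff.1 (Finsupp.ext fun k => ?_)
  have h1 := h.repr_apply y k
  rw [hy, map_smul] at h1
  have h2 : (α i + n - α k) * h.basis.repr y k = 0 := by
    simp only [Finsupp.smul_apply, smul_eq_mul] at h1; linear_combination h1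
  refine (mul_eq_zero.1 h2).resolve_left fun h3 => h.nonresonant k i n hn ?_
  linear_combination -h3

end Eigensystem

/-! ### Uniqueness of solutions and transport matrices -/

theorem IsSolution.sub_sum {N : ℕ} {P Q : Module.End ℂ (V N)} {f : ℂ → V N}
    {h : Fin N → ℂ → V N} (hf : IsSolution P Q f) (hh : ∀ j, IsSolution P Q (h j))
    (c : Fin N → ℂ) : IsSolution P Q fun z => f z - ∑ j, c j • h j z := by
  intro z hz
  refine ((hf z hz).sub (HasDerivAt.fun_sum fun j (_ : j ∈ Finset.univ) =>
    (hh j z hz).const_smul (c j))).congr_deriv ?_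
  simp only [map_sub, map_sum, map_smul, smul_sub, Finset.smul_sum, smul_add,
    Finset.sum_add_distrib]
  simp only [smul_comm (c _)]
  abel

/-- The cut plane is star-shaped about -1. Along the segment from -1 to z the equation is a linear
ODE in a real variable with bounded coefficients, so real uniqueness applies. -/
theorem IsSolution.eq_zero {N : ℕ} {P Q : Module.End ℂ (V N)} {f : ℂ → V N}
    (hf : IsSolution P Q f) (h0 : f (-1) = 0) {z : ℂ} (hz : z ∈ cutPlane) : f z = 0 := by
  set P' : V N →L[ℂ] V N := LinearMap.toContinuousLinearMap P with hP'
  set Q' : V N →L[ℂ] V N := LinearMap.toContinuousLinearMap Q with hQ'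
  let γ : ℝ → ℂ := fun t => -1 + t * (z + 1)
  have hγ : ∀ t ∈ Set.Icc (0 : ℝ) 1, γ t ∈ cutPlane := by
    intro t ht
    rw [mem_cutPlane_iff, Complex.mem_slitPlane_iff] at hz ⊢
    simp [γ] at hz ⊢
    rcases ht.1.eq_or_lt with rfl | h
    · left; simp
    · rcases hz with hz | hz
      · left; nlinarith [ht.2]
      · right; exact ⟨h.ne', hz⟩
  have hγd : ∀ t, HasDerivAt γ (z + 1) t := fun t =>
    (((Complex.ofRealCLM.hasDerivAt (x := t)).mul_const (z + 1)).const_add (-1)).congr_deriv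
      (by simp)
  have hγc : Continuous γ := by fun_prop
  have hFd : ∀ t ∈ Set.Icc (0 : ℝ) 1, HasDerivAt (fun t => f (γ t))
      ((z + 1) • ((γ t)⁻¹ • P' (f (γ t)) + (1 - γ t)⁻¹ • Q' (f (γ t)))) t := by
    intro t ht
    exact (hf _ (hγ t ht)).scomp t (hγd t)
  obtain ⟨B, hB⟩ := isCompact_Icc.exists_bound_of_continuousOn (s := Set.Icc (0 : ℝ) 1)
    (f := fun t => (z + 1) • ((γ t)⁻¹ • P' + (1 - γ t)⁻¹ • Q')) (by
      have c1 : ContinuousOn (fun t => (γ t)⁻¹) (Set.Icc (0 : ℝ) 1) :=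
        hγc.continuousOn.inv₀ fun t ht => ne_zero_of_mem_cutPlane (hγ t ht)
      have c2 : ContinuousOn (fun t => (1 - γ t)⁻¹) (Set.Icc (0 : ℝ) 1) :=
        (continuous_const.sub hγc).continuousOn.inv₀ fun t ht => one_sub_ne_zero (hγ t ht)
      fun_prop)
  have key := ODE_solution_unique_of_mem_Icc_right (K := B.toNNReal)
    (v := fun t x => (z + 1) • ((γ t)⁻¹ • P' x + (1 - γ t)⁻¹ • Q' x))
    (s := fun _ => Set.univ) (f := fun t => f (γ t)) (g := fun _ => 0) (a := 0) (b := 1)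
    (fun t ht => LipschitzWith.lipschitzOnWith (by
      have := ((z + 1) • ((γ t)⁻¹ • P' + (1 - γ t)⁻¹ • Q')).lipschitz
      refine this.weaken ?_
      rw [← NNReal.coe_le_coe]
      exact (hB t ⟨ht.1, ht.2.le⟩).trans (Real.le_coe_toNNReal B)))
    (fun t ht => (hFd t ht).continuousAt.continuousWithinAt)
    (fun t ht => (hFd t ⟨ht.1, ht.2.le⟩).hasDerivWithinAt) (fun _ _ => Set.mem_univ _)
    continuousOn_const (fun t _ => by simpa using hasDerivWithinAt_const t _ (0 : V N))
    (fun _ _ => Set.mem_univ _) (by simpa [γ] using h0)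
  simpa [γ] using key (Set.right_mem_Icc.2 zero_le_one)

/-- Evaluation at -1 embeds the solutions into an N-dimensional space, so N independent solutions
span them. -/
theorem exists_transport {N : ℕ} {P Q : Module.End ℂ (V N)} {f : ℂ → V N}
    {h : Fin N → ℂ → V N} (hf : IsSolution P Q f) (hh : ∀ j, IsSolution P Q (h j))
    (hind : ∀ c : Fin N → ℂ, (∀ z ∈ cutPlane, ∑ j, c j • h j z = 0) → ∀ j, c j = 0) :
    ∃ c : Fin N → ℂ, ∀ z ∈ cutPlane, f z = ∑ j, c j • h j z := by
  have hli : LinearIndependent ℂ fun j => h j (-1) := by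
    rw [Fintype.linearIndependent_iff]
    intro c hc
    refine hind c fun z hz => ?_
    have h0 : IsSolution P Q fun _ => (0 : V N) := fun z _ => by
      simpa using hasDerivAt_const z (0 : V N)
    have := (h0.sub_sum hh c).eq_zero (by simp [hc]) hz
    simpa using this
  let b := basisOfLinearIndependentOfCardEqFinrank' _ hli (by simp)
  refine ⟨fun j => b.repr (f (-1)) j, fun z hz => sub_eq_zero.1 ?_⟩
  refine (hf.sub_sum hh _).eq_zero ?_ hz
  have := b.sum_repr (f (-1))
  rw [sub_eq_zero]
  conv_lhs => rw [← this]
  simp [b]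

/-! ### Growth of quotients of Gamma functions on vertical strips -/

theorem inv_Gamma_eq_prod_mul (s : ℂ) (m : ℕ) :
    (Complex.Gamma s)⁻¹ = (∏ k ∈ Finset.range m, (s + k)) * (Complex.Gamma (s + m))⁻¹ := by
  induction m with
  | zero => simp
  | succ m ih =>
    rw [ih, Complex.one_div_Gamma_eq_self_mul_one_div_Gamma_add_one (s + m),
      Finset.prod_range_succ]
    push_cast
    ring_nf

theorem norm_betaIntegral_le {u₀ : ℝ} (hu₀ : 0 < u₀) {v : ℂ} (hv : 0 < v.re) :
    ∃ C, ∀ u : ℂ, u₀ ≤ u.re → ‖u.betaIntegral v‖ ≤ C := by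
  have hc := (Complex.betaIntegral_convergent (u := u₀) (v := v) (by simpa using hu₀) hv).norm
  refine ⟨_, fun u hu => intervalIntegral.norm_integral_le_of_norm_le zero_le_one ?_ hc⟩
  refine Eventually.of_forall fun x hx => ?_
  rw [norm_mul, norm_mul]
  refine mul_le_mul_of_nonneg_right ?_ (norm_nonneg _)
  rw [Complex.norm_cpow_eq_rpow_re_of_pos hx.1, Complex.norm_cpow_eq_rpow_re_of_pos hx.1]
  refine Real.rpow_le_rpow_of_exponent_ge hx.1 hx.2 ?_
  simpa using hu

/-- With t = λ - μ + m of positive real part, Γ(s-λ)/Γ(s-μ+m) = B(s-λ, t)/Γ(t), and the beta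
integral is bounded for Re(s-λ) bounded below by a positive constant. Passing from Γ(s-μ+m) back to
Γ(s-μ) costs a polynomial of degree m. This avoids Stirling's formula. -/
theorem exists_norm_Gamma_div_le (lam mu : ℂ) {σ₁ : ℝ} (σ₂ : ℝ) (h : lam.re < σ₁) :
    ∃ (C : ℝ) (K : ℕ), ∀ s : ℂ, σ₁ ≤ s.re → s.re ≤ σ₂ →
      ‖Complex.Gamma (s - lam) / Complex.Gamma (s - mu)‖ ≤ C * (1 + |s.im|) ^ K := by
  obtain ⟨m, hm⟩ := exists_nat_gt (mu - lam).re
  set t : ℂ := lam - mu + m with ht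
  have htre : 0 < t.re := by
    simp [ht] at hm ⊢; linarith
  obtain ⟨C, hC⟩ := norm_betaIntegral_le (sub_pos.2 h) htre
  set D : ℝ := |σ₁| + |σ₂| + ‖mu‖ + m + 1 with hD
  have hD0 : 0 ≤ D := by positivity
  refine ⟨D ^ m * (C / ‖Complex.Gamma t‖), m, fun s hs1 hs2 => ?_⟩
  have hsl : 0 < (s - lam).re := by simp; linarith
  have hb := Complex.Gamma_mul_Gamma_eq_betaIntegral hsl htre
  have hst : s - lam + t = s - mu + m := by rw [ht]; ring
  have hΓt : Complex.Gamma t ≠ 0 := Complex.Gamma_ne_zero_of_re_pos htre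
  have hΓs : Complex.Gamma (s - mu + m) ≠ 0 := by
    rw [← hst]
    exact Complex.Gamma_ne_zero_of_re_pos (by rw [Complex.add_re]; linarith)
  rw [hst] at hb
  have e : Complex.Gamma (s - lam) / Complex.Gamma (s - mu)
      = (∏ k ∈ Finset.range m, (s - mu + k)) * ((s - lam).betaIntegral t / Complex.Gamma t) := by
    rw [div_eq_mul_inv, inv_Gamma_eq_prod_mul (s - mu) m]
    field_simp
    linear_combination (∏ k ∈ Finset.range m, (s - mu + (k : ℂ))) * hb
  rw [e, norm_mul, norm_div, norm_prod, mul_right_comm]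
  have hCs := hC (s - lam) (by simpa using hs1)
  have hC0 : 0 ≤ C := (norm_nonneg _).trans hCs
  refine mul_le_mul ?_ (by gcongr) (by positivity) (by positivity)
  rw [← mul_pow]
  calc ∏ k ∈ Finset.range m, ‖s - mu + k‖ ≤ ∏ _k ∈ Finset.range m, D * (1 + |s.im|) := by
        refine Finset.prod_le_prod (fun _ _ => norm_nonneg _) fun k hk => ?_
        have hk' : (k : ℝ) ≤ m := by exact_mod_cast (Finset.mem_range.1 hk).le
        have h1 : ‖s - mu + k‖ ≤ ‖s‖ + ‖mu‖ + k := by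
          refine (norm_add_le _ _).trans (add_le_add (norm_sub_le _ _) ?_)
          simp
        have h2 := Complex.norm_le_abs_re_add_abs_im s
        have h3 : |s.re| ≤ |σ₁| + |σ₂| := by
          rw [abs_le]
          constructor
          · linarith [neg_abs_le σ₁, abs_nonneg σ₂]
          · linarith [le_abs_self σ₂, abs_nonneg σ₁]
        have h4 : |s.im| ≤ D * |s.im| := by
          have : 1 ≤ D := by
            have : 0 ≤ |σ₁| + |σ₂| + ‖mu‖ + m := by positivity
            linarith
          nlinarith [abs_nonneg s.im]
        nlinarith
    _ = _ := by simp

theorem exists_norm_prod_Gamma_div_le {ι : Type*} (S : Finset ι) (lam mu : ι → ℂ) {σ₁ : ℝ}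
    (σ₂ : ℝ) (h : ∀ k, (lam k).re < σ₁) :
    ∃ (C : ℝ) (K : ℕ), ∀ s : ℂ, σ₁ ≤ s.re → s.re ≤ σ₂ →
      ‖∏ k ∈ S, (Complex.Gamma (s - lam k) / Complex.Gamma (s - mu k))‖
        ≤ C * (1 + |s.im|) ^ K := by
  classical
  induction S using Finset.induction_on with
  | empty => exact ⟨1, 0, by simp⟩
  | insert a S ha ih =>
    obtain ⟨C, K, hC⟩ := ih
    obtain ⟨C', K', hC'⟩ := exists_norm_Gamma_div_le (lam a) (mu a) σ₂ (h a)
    refine ⟨C' * C, K' + K, fun s h1 h2 => ?_⟩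
    rw [Finset.prod_insert ha, norm_mul, pow_add, mul_mul_mul_comm]
    exact mul_le_mul (hC' s h1 h2) (hC s h1 h2) (norm_nonneg _)
      ((norm_nonneg _).trans (hC' s h1 h2))

theorem sinh_le_norm_sin (z : ℂ) : Real.sinh |z.im| ≤ ‖Complex.sin z‖ := by
  have h1 : ‖Complex.sin z‖ = ‖Complex.exp (-z * Complex.I) - Complex.exp (z * Complex.I)‖ / 2 := by
    rw [Complex.sin, norm_div, norm_mul, Complex.norm_I, mul_one, Complex.norm_ofNat]
  have h2 := abs_norm_sub_norm_le (Complex.exp (-z * Complex.I)) (Complex.exp (z * Complex.I))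
  rw [Complex.norm_exp, Complex.norm_exp] at h2
  have h3 : (-z * Complex.I).re = z.im := by simp
  have h4 : (z * Complex.I).re = -z.im := by simp
  rw [h3, h4] at h2
  rw [h1, ← Real.abs_sinh, Real.sinh_eq, abs_div, abs_two]
  linarith

/-! ### Antiperiodic functions on a half-plane -/

/-- `s` does not differ from `e` by an integer. -/
def NotCongr (e s : ℂ) : Prop := ∀ n : ℤ, s ≠ e + n

theorem isOpen_notCongr (e : ℂ) : IsOpen {s | NotCongr e s} := by
  have h : IsClosed (Set.range fun n : ℤ => e + (n : ℂ)) := by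
    have h1 : Topology.IsClosedEmbedding fun n : ℤ => (n : ℂ) := Complex.isClosedEmbedding_intCast
    exact ((Homeomorph.addLeft e).isClosedEmbedding.comp h1).isClosed_range
  convert h.isOpen_compl using 1
  ext s
  simp [NotCongr, eq_comm]

theorem NotCongr.add_one {e s : ℂ} (h : NotCongr e s) : NotCongr e (s + 1) := by
  intro n hn
  refine h (n - 1) ?_
  push_cast
  linear_combination hn

theorem eventually_notCongr (e s : ℂ) : ∀ᶠ z in 𝓝[≠] s, NotCongr e z := by
  by_cases h : NotCongr e s
  · exact mem_nhdsWithin_of_mem_nhds ((isOpen_notCongr e).mem_nhds h)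
  · simp only [NotCongr, not_forall, not_not] at h
    obtain ⟨n, rfl⟩ := h
    filter_upwards [self_mem_nhdsWithin,
      mem_nhdsWithin_of_mem_nhds (Metric.ball_mem_nhds (e + n : ℂ) one_pos)] with z hz hz1 m hm
    rw [hm, Metric.mem_ball, dist_eq_norm, add_sub_add_left_eq_sub, ← Int.cast_sub,
      Complex.norm_intCast] at hz1
    have : |m - n| < 1 := by exact_mod_cast hz1
    rw [Int.abs_lt_one_iff, sub_eq_zero] at this
    exact hz (by rw [hm, this]; rfl)

/-- The singularities are removable. The modulus of the extension is 1-periodic and decays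
vertically, so it attains its maximum over the half-plane; by the maximum principle the extension is
constant, and an antiperiodic constant is 0. -/
theorem eq_zero_of_antiperiodic {r : ℂ → ℂ} {σ : ℝ} {e : ℂ}
    (hd : ∀ s : ℂ, σ < s.re → NotCongr e s → DifferentiableAt ℂ r s)
    (hr : ∀ n : ℤ, σ < (e + n).re →
      Tendsto (fun s => (s - (e + n)) * r s) (𝓝[≠] (e + n)) (𝓝 0))
    (hp : ∀ s : ℂ, σ < s.re → NotCongr e s → r (s + 1) = -r s)
    (hdec : ∀ ε > 0, ∃ T, ∀ s : ℂ, σ + 1 ≤ s.re → s.re ≤ σ + 2 → T ≤ |s.im| → ‖r s‖ ≤ ε)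
    {s : ℂ} (hs : σ < s.re) (hse : NotCongr e s) : r s = 0 := by
  set D : Set ℂ := {s | σ < s.re} with hDdef
  have hDo : IsOpen D := isOpen_lt continuous_const Complex.continuous_re
  -- Punctured limits extend r across the points e + n and agree with r wherever r is
  -- differentiable.
  set R : ℂ → ℂ := fun s => limUnder (𝓝[≠] s) r with hRdef
  have hRr : ∀ s ∈ D, NotCongr e s → R s = r s := fun s hs hse =>
    ((hd s hs hse).continuousAt.tendsto.mono_left nhdsWithin_le_nhds).limUnder_eq
  have hRd : ∀ s ∈ D, DifferentiableAt ℂ R s := by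
    intro s hs
    by_cases hse : NotCongr e s
    · refine (hd s hs hse).congr_of_eventuallyEq ?_
      filter_upwards [hDo.mem_nhds hs, (isOpen_notCongr e).mem_nhds hse] with z h1 h2
      exact hRr z h1 h2
    · have hse' := hse
      simp only [NotCongr, not_forall, not_not] at hse'
      obtain ⟨n, hn⟩ := hse'
      have hev : ∀ᶠ z in 𝓝 s, z ∈ D ∧ (z ≠ s → NotCongr e z) :=
        (hDo.eventually_mem hs).and (eventually_nhdsWithin_iff.1 (eventually_notCongr e s))
      obtain ⟨U, hU, hUm⟩ := hev.exists_mem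
      have h1 : DifferentiableOn ℂ (Function.update r s (limUnder (𝓝[≠] s) r)) U := by
        refine Complex.differentiableOn_update_limUnder_of_isLittleO hU (fun z hz =>
          (hd z (hUm z hz.1).1 ((hUm z hz.1).2 hz.2)).differentiableWithinAt) ?_
        rw [Asymptotics.isLittleO_iff_tendsto']
        · have h2 := hr n (hn ▸ hs)
          rw [← hn] at h2
          have h3 : Tendsto (fun z : ℂ => (z - s) * r s) (𝓝[≠] s) (𝓝 0) := by
            have : Tendsto (fun z : ℂ => (z - s) * r s) (𝓝 s) (𝓝 ((s - s) * r s)) :=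
              (Continuous.tendsto (by fun_prop) s)
            simpa using this.mono_left nhdsWithin_le_nhds
          refine (by simpa using h2.sub h3 :
            Tendsto _ (𝓝[≠] s) (𝓝 (0 : ℂ))).congr fun z => ?_
          rw [div_inv_eq_mul]; ring
        · filter_upwards [self_mem_nhdsWithin] with z hz h0
          exact absurd (sub_eq_zero.1 (inv_eq_zero.1 h0)) hz
      refine (h1.differentiableAt hU).congr_of_eventuallyEq ?_
      filter_upwards [hU] with z hz
      by_cases hzs : z = s
      · subst hzs; simp [hRdef]
      · rw [Function.update_of_ne hzs]
        exact hRr z (hUm z hz).1 ((hUm z hz).2 hzs)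
  have hD1 : ∀ s ∈ D, s + 1 ∈ D := fun s hs => by
    simp only [hDdef, Set.mem_ofPred_eq, Complex.add_re, Complex.one_re] at hs ⊢; linarith
  have hRp : ∀ s ∈ D, R (s + 1) = -R s := by
    intro s hs
    have h1 : Tendsto (fun z => R (z + 1) + R z) (𝓝[≠] s) (𝓝 (R (s + 1) + R s)) := by
      have h2 : ContinuousAt (fun z => R (z + 1)) s :=
        ContinuousAt.comp (f := fun z => z + 1) (hRd _ (hD1 s hs)).continuousAt (by fun_prop)
      exact (h2.add (hRd s hs).continuousAt).tendsto.mono_left nhdsWithin_le_nhds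
    have h2 : (fun z => R (z + 1) + R z) =ᶠ[𝓝[≠] s] fun _ => 0 := by
      filter_upwards [eventually_notCongr e s,
        mem_nhdsWithin_of_mem_nhds (hDo.mem_nhds hs)] with z hz1 hz2
      rw [hRr z hz2 hz1, hRr _ (hD1 z hz2) hz1.add_one, hp z hz2 hz1, neg_add_cancel]
    exact eq_neg_of_add_eq_zero_left
      (tendsto_nhds_unique h1 (tendsto_const_nhds.congr' h2.symm))
  have hRn : ∀ (n : ℕ) (s : ℂ), s ∈ D → s + n ∈ D ∧ ‖R (s + n)‖ = ‖R s‖ := by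
    intro n s hs
    induction n with
    | zero => simpa using hs
    | succ n ih =>
      rw [Nat.cast_succ, ← add_assoc, hRp _ ih.1, norm_neg]
      exact ⟨hD1 _ ih.1, ih.2⟩
  have hshift : ∀ s ∈ D, ∃ s', σ + 1 ≤ s'.re ∧ s'.re ≤ σ + 2 ∧ ‖R s'‖ = ‖R s‖ := by
    intro s hs
    rcases le_total s.re (σ + 2) with h | h
    · refine ⟨s + (⌈σ + 1 - s.re⌉₊ : ℕ), ?_, ?_, (hRn _ s hs).2⟩
      · have := Nat.le_ceil (σ + 1 - s.re)
        simp only [Complex.add_re, Complex.natCast_re]; linarith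
      · simp only [Complex.add_re, Complex.natCast_re]
        rcases le_total (σ + 1 - s.re) 0 with h2 | h2
        · rw [Nat.ceil_eq_zero.2 h2]; simpa using h
        · have := Nat.ceil_lt_add_one h2; linarith
    · have h1 := Nat.floor_le (show 0 ≤ s.re - σ - 1 by linarith)
      have h2 := Nat.lt_floor_add_one (s.re - σ - 1)
      have hre : (s - (⌊s.re - σ - 1⌋₊ : ℕ)).re = s.re - ⌊s.re - σ - 1⌋₊ := by
        simp
      refine ⟨s - (⌊s.re - σ - 1⌋₊ : ℕ), ?_, ?_, ?_⟩
      · rw [hre]; linarith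
      · rw [hre]; linarith
      · have := (hRn ⌊s.re - σ - 1⌋₊ (s - (⌊s.re - σ - 1⌋₊ : ℕ)) (by
          change σ < _; rw [hre]; linarith)).2
        rw [← this, sub_add_cancel]
  rw [← hRr s hs hse]
  by_contra hne
  have hpos : 0 < ‖R s‖ := norm_pos_iff.2 hne
  obtain ⟨T, hT⟩ := hdec (‖R s‖ / 2) (by positivity)
  -- Above this height no point is congruent to e, so the decay of r is a decay of R.
  set T' := max T (|e.im| + 1)
  have hT' : ∀ z : ℂ, σ + 1 ≤ z.re → z.re ≤ σ + 2 → T' ≤ |z.im| → ‖R z‖ ≤ ‖R s‖ / 2 := by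
    intro z h1 h2 h3
    rw [hRr z (show σ < z.re by linarith) fun n hn => ?_]
    · exact hT z h1 h2 ((le_max_left _ _).trans h3)
    · have h4 := (le_max_right T (|e.im| + 1)).trans h3
      rw [hn] at h4
      simp at h4
      linarith
  have hK : IsCompact (Set.Icc (σ + 1) (σ + 2) ×ℂ Set.Icc (-T') T') :=
    isCompact_Icc.reProdIm isCompact_Icc
  obtain ⟨s₁, hs1, hs2, hs3⟩ := hshift s hs
  have hs₁K : s₁ ∈ Set.Icc (σ + 1) (σ + 2) ×ℂ Set.Icc (-T') T' := by
    refine ⟨⟨hs1, hs2⟩, abs_le.1 ?_⟩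
    by_contra! h
    have := hT' s₁ hs1 hs2 h.le
    rw [hs3] at this
    linarith
  have hKD : ∀ z ∈ Set.Icc (σ + 1) (σ + 2) ×ℂ Set.Icc (-T') T', z ∈ D := fun z hz =>
    show σ < z.re by have := hz.1.1; linarith
  obtain ⟨c, hcK, hc⟩ := hK.exists_isMaxOn ⟨s₁, hs₁K⟩
    (f := fun z => ‖R z‖) (fun z hz => (hRd z (hKD z hz)).continuousAt.norm.continuousWithinAt)
  have hmax : IsMaxOn (norm ∘ R) D c := by
    intro z hz
    obtain ⟨z₁, hz1, hz2, hz3⟩ := hshift z hz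
    have hs1c : ‖R s₁‖ ≤ ‖R c‖ := hc hs₁K
    simp only [Function.comp_apply, Set.mem_ofPred_eq]
    rw [← hz3]
    by_cases h : |z₁.im| ≤ T'
    · exact hc ⟨⟨hz1, hz2⟩, abs_le.1 h⟩
    · have := hT' z₁ hz1 hz2 (not_le.1 h).le
      linarith
  have hconst := Complex.eqOn_of_isPreconnected_of_isMaxOn_norm
    (convex_halfSpace_re_gt σ).isPreconnected hDo
    (fun z hz => (hRd z hz).differentiableWithinAt) (hKD c hcK) hmax
  have h1 := hconst (hD1 c (hKD c hcK))
  rw [hRp c (hKD c hcK)] at h1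
  have h2 : R c = 0 := by
    have : -R c = R c := h1
    linear_combination (-1 / 2 : ℂ) * this
  have h3 : R s = R c := hconst hs
  exact hne (h3.trans h2)

/-! ### Primitives of power series, as functions of the Mellin variable -/

/-- The termwise primitive of `w ↦ exp (-s * w) * ∑ a n * exp ((lam + n) * w)`. -/
noncomputable def polarSum (lam : ℂ) (a : ℕ → ℂ) (s w : ℂ) : ℂ :=
  ∑' n : ℕ, a n * Complex.exp ((lam + n - s) * w) / (lam + n - s)

theorem norm_exp_lt_one {w : ℂ} (hw : w.re < 0) : ‖Complex.exp w‖ < 1 := by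
  rw [Complex.norm_exp]
  exact Real.exp_lt_one_iff.2 hw

theorem exists_norm_inv_le (lam s : ℂ) : ∃ C, ∀ n : ℕ, ‖(lam + n - s)⁻¹‖ ≤ C := by
  have h1 : Tendsto (fun n : ℕ => ‖(lam + n - s)‖) atTop atTop := by
    refine tendsto_atTop_mono (f := fun n : ℕ => (n : ℝ) - ‖lam - s‖) (fun n => ?_)
      (tendsto_atTop_add_const_right _ _ tendsto_natCast_atTop_atTop)
    have := norm_sub_norm_le (n : ℂ) (-(lam - s))
    rw [norm_neg, Complex.norm_natCast] at this
    rwa [sub_neg_eq_add, show (n : ℂ) + (lam - s) = lam + n - s by ring] at this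
  have h2 := h1.inv_tendsto_atTop.bddAbove_range
  obtain ⟨C, hC⟩ := h2
  exact ⟨C, fun n => by rw [norm_inv]; exact hC ⟨n, rfl⟩⟩

theorem SummableInDisc.div_sub {a : ℕ → ℂ} (ha : SummableInDisc a) (lam s : ℂ) :
    SummableInDisc fun n : ℕ => a n / (lam + n - s) := by
  obtain ⟨C, hC⟩ := exists_norm_inv_le lam s
  refine ha.of_norm_le C fun n => ?_
  rw [div_eq_mul_inv, norm_mul, mul_comm]
  exact mul_le_mul_of_nonneg_right (hC n) (norm_nonneg _)

theorem SummableInDisc.hasSum_polarSum {a : ℕ → ℂ} (ha : SummableInDisc a) (lam s : ℂ) {w : ℂ}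
    (hw : w.re < 0) :
    HasSum (fun n : ℕ => a n * Complex.exp ((lam + n - s) * w) / (lam + n - s))
      (polarSum lam a s w) := by
  refine Summable.hasSum ?_
  refine ((((ha.div_sub lam s).hasSum (norm_exp_lt_one hw)).mul_left
    (Complex.exp ((lam - s) * w))).summable).congr fun n => ?_
  rw [smul_eq_mul, ← Complex.exp_nat_mul, ← mul_assoc, ← Complex.exp_add,
    show (lam - s) * w + n * w = (lam + n - s) * w by ring]
  ring

theorem polarSum_eq {a : ℕ → ℂ} (ha : SummableInDisc a) (lam s : ℂ) {w : ℂ} (hw : w.re < 0) :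
    polarSum lam a s w
      = Complex.exp ((lam - s) * w) * psum (fun n => a n / (lam + n - s)) (Complex.exp w) := by
  refine (ha.hasSum_polarSum lam s hw).unique ?_
  refine (((ha.div_sub lam s).hasSum (norm_exp_lt_one hw)).mul_left
    (Complex.exp ((lam - s) * w))).congr_fun fun n => ?_
  rw [smul_eq_mul, ← Complex.exp_nat_mul, ← mul_assoc, ← Complex.exp_add,
    show (lam - s) * w + n * w = (lam + n - s) * w by ring]
  ring

theorem hasDerivAt_polarSum {a : ℕ → ℂ} (ha : SummableInDisc a) {lam s : ℂ}
    (hs : ∀ n : ℕ, s ≠ lam + n) {w : ℂ} (hw : w.re < 0) :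
    HasDerivAt (polarSum lam a s)
      (Complex.exp (-s * w) * (Complex.exp (lam * w) * psum a (Complex.exp w))) w := by
  have hc := ha.div_sub lam s
  obtain ⟨d, hd, hd'⟩ := hc.exists_hasDerivAt (norm_exp_lt_one hw)
  have h1 : HasDerivAt (fun w => Complex.exp ((lam - s) * w) *
      psum (fun n => a n / (lam + n - s)) (Complex.exp w))
      (Complex.exp ((lam - s) * w) * (lam - s) * psum (fun n => a n / (lam + n - s)) (Complex.exp w)
        + Complex.exp ((lam - s) * w) * (Complex.exp w • d)) w := by
    refine HasDerivAt.mul ?_ ?_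
    · exact (((hasDerivAt_id w).const_mul (lam - s)).cexp).congr_deriv (by simp)
    · exact hd.scomp w (Complex.hasDerivAt_exp w)
  have h2 := ((hc.hasSum (norm_exp_lt_one hw)).mul_left (lam - s)).add hd'
  have h3 : psum a (Complex.exp w) = (lam - s) * psum (fun n => a n / (lam + n - s)) (Complex.exp w)
      + Complex.exp w • d := by
    refine (ha.hasSum (norm_exp_lt_one hw)).unique (h2.congr_fun fun n => ?_)
    have : lam + n - s ≠ 0 := fun h => hs n (by linear_combination -h)
    simp only [smul_eq_mul]
    field_simp
    ring
  refine (h1.congr_of_eventuallyEq ?_).congr_deriv ?_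
  · filter_upwards [(isOpen_lt Complex.continuous_re continuous_const).mem_nhds hw] with z hz
    exact polarSum_eq ha lam s hz
  · rw [h3, ← mul_assoc (Complex.exp (-s * w)), ← Complex.exp_add,
      show -s * w + lam * w = (lam - s) * w by ring]
    ring

/-- Integration by parts for the tail, termwise: (λ+n-κ)/(λ+n-s) = 1 + (s-κ)/(λ+n-s). -/
theorem polarSum_sub_mul {a : ℕ → ℂ} (ha : SummableInDisc a) {lam s : ℂ} (κ : ℂ)
    (hs : ∀ n : ℕ, s ≠ lam + n) {w : ℂ} (hw : w.re < 0) :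
    polarSum lam (fun n => (lam + n - κ) * a n) s w
      = Complex.exp (-s * w) * (Complex.exp (lam * w) * psum a (Complex.exp w))
        + (s - κ) * polarSum lam a s w := by
  have h1 := ((ha.hasSum (norm_exp_lt_one hw)).mul_left
    (Complex.exp (-s * w) * Complex.exp (lam * w)))
  have h2 := (ha.hasSum_polarSum lam s hw).mul_left (s - κ)
  rw [← mul_assoc]
  refine HasSum.tsum_eq ((h1.add h2).congr_fun fun n => ?_)
  have : lam + n - s ≠ 0 := fun h => hs n (by linear_combination -h)
  rw [smul_eq_mul, ← Complex.exp_nat_mul,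
    ← mul_assoc (Complex.exp (-s * w) * Complex.exp (lam * w)),
    ← Complex.exp_add, ← Complex.exp_add,
    show -s * w + lam * w + n * w = (lam + n - s) * w by ring]
  field_simp
  ring

theorem polarSum_const_mul (lam : ℂ) (a : ℕ → ℂ) (κ s w : ℂ) :
    polarSum lam (fun n => κ * a n) s w = κ * polarSum lam a s w := by
  rw [polarSum, polarSum, ← tsum_mul_left]
  exact tsum_congr fun n => by ring

theorem polarSum_sum {ι : Type*} (S : Finset ι) {a : ι → ℕ → ℂ} (ha : ∀ i, SummableInDisc (a i))
    (lam s : ℂ) {w : ℂ} (hw : w.re < 0) :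
    polarSum lam (fun n => ∑ i ∈ S, a i n) s w = ∑ i ∈ S, polarSum lam (a i) s w := by
  refine HasSum.tsum_eq ((hasSum_sum fun i _ => (ha i).hasSum_polarSum lam s hw).congr_fun
    fun n => ?_)
  simp only [Finset.sum_mul, Finset.sum_div]

theorem polarSum_add {a b : ℕ → ℂ} (ha : SummableInDisc a) (hb : SummableInDisc b)
    (lam s : ℂ) {w : ℂ} (hw : w.re < 0) :
    polarSum lam (fun n => a n + b n) s w = polarSum lam a s w + polarSum lam b s w := by
  refine HasSum.tsum_eq (((ha.hasSum_polarSum lam s hw).add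
    (hb.hasSum_polarSum lam s hw)).congr_fun fun n => ?_)
  ring

/-- Lowering all exponents by one is a shift of the coefficients only if no term with exponent λ - 1
arises, hence the vanishing of `a 0`. -/
theorem polarSum_add_one {a : ℕ → ℂ} (ha : SummableInDisc a) (ha0 : a 0 = 0)
    (lam s : ℂ) {w : ℂ} (hw : w.re < 0) :
    polarSum lam a (s + 1) w = polarSum lam (fun n => a (n + 1)) s w := by
  have h := ha.hasSum_polarSum lam (s + 1) hw
  rw [← hasSum_nat_add_iff' 1] at h
  simp only [Finset.sum_range_one, ha0, zero_mul, zero_div, sub_zero] at h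
  refine h.unique (Summable.hasSum ?_ |>.congr_fun fun n => ?_)
  · refine h.summable.congr fun n => ?_
    push_cast
    ring_nf
  · push_cast
    ring_nf

theorem tendsto_sub_mul_of_continuousAt {g : ℂ → ℂ} {s₀ : ℂ} (hg : ContinuousAt g s₀) :
    Tendsto (fun s => (s - s₀) * g s) (𝓝[≠] s₀) (𝓝 0) := by
  have h1 : Tendsto (fun s => s - s₀) (𝓝 s₀) (𝓝 (s₀ - s₀)) := Continuous.tendsto (by fun_prop) _
  have := h1.mul hg.tendsto
  rw [sub_self, zero_mul] at this
  exact this.mono_left nhdsWithin_le_nhds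

/-- Only finitely many denominators can be small near s₀. The others have modulus at least 1 on the
unit ball about s₀, so the tail converges uniformly there and is holomorphic. Holomorphy and
residues then reduce to a finite sum. -/
theorem exists_polarSum_eq_add {a : ℕ → ℂ} (ha : SummableInDisc a) (lam s₀ : ℂ) {w : ℂ}
    (hw : w.re < 0) (m : ℕ) :
    ∃ (n₀ : ℕ) (T : ℂ → ℂ), m ≤ n₀ ∧ DifferentiableAt ℂ T s₀ ∧ ∀ s ∈ Metric.ball s₀ 1,
      polarSum lam a s w = (∑ n ∈ Finset.range n₀,
        a n * Complex.exp ((lam + n - s) * w) / (lam + n - s)) + T s := by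
  obtain ⟨n₁, hn₁⟩ := exists_nat_ge (‖lam‖ + ‖s₀‖ + 2)
  set n₀ := max m n₁
  have hlow : ∀ n : ℕ, ∀ s ∈ Metric.ball s₀ 1, 1 ≤ ‖lam + (n + n₀ : ℕ) - s‖ := by
    intro n s hs
    rw [Metric.mem_ball, dist_eq_norm] at hs
    have h1 := norm_sub_norm_le ((n + n₀ : ℕ) : ℂ) (s - lam)
    rw [Complex.norm_natCast, show ((n + n₀ : ℕ) : ℂ) - (s - lam) = lam + (n + n₀ : ℕ) - s by ring]
      at h1
    have h2 : ‖s - lam‖ ≤ ‖s - s₀‖ + ‖s₀‖ + ‖lam‖ := by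
      have : s - lam = (s - s₀) + s₀ - lam := by ring
      rw [this]
      exact (norm_sub_le _ _).trans (add_le_add (norm_add_le _ _) le_rfl)
    have h3 : (n₁ : ℝ) ≤ (n + n₀ : ℕ) := by
      exact_mod_cast (le_max_right m n₁).trans (Nat.le_add_left _ _)
    linarith
  refine ⟨n₀, fun s => ∑' n : ℕ, a (n + n₀) *
    Complex.exp ((lam + (n + n₀ : ℕ) - s) * w) / (lam + (n + n₀ : ℕ) - s),
    le_max_left _ _, ?_, fun s hs => ?_⟩
  · have hb : Summable fun n : ℕ => Real.exp ((‖lam‖ + ‖s₀‖ + 1) * ‖w‖) *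
        (‖a (n + n₀)‖ * Real.exp w.re ^ (n + n₀)) :=
      ((summable_nat_add_iff n₀).2
        (ha _ (Real.exp_pos _).le (Real.exp_lt_one_iff.2 hw))).mul_left _
    refine (Complex.differentiableOn_tsum_of_summable_norm hb (fun n => ?_) Metric.isOpen_ball
      fun n s hs => ?_).differentiableAt (Metric.ball_mem_nhds s₀ one_pos)
    · intro s hs
      have h0 : lam + (n + n₀ : ℕ) - s ≠ 0 := by
        have := hlow n s hs
        exact norm_pos_iff.1 (by linarith)
      refine DifferentiableAt.differentiableWithinAt ?_
      fun_prop (disch := exact h0)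
    · rw [norm_div, norm_mul]
      refine (div_le_self (by positivity) (hlow n s hs)).trans ?_
      have h1 : ‖Complex.exp ((lam + (n + n₀ : ℕ) - s) * w)‖
          ≤ Real.exp ((‖lam‖ + ‖s₀‖ + 1) * ‖w‖) * Real.exp w.re ^ (n + n₀) := by
        rw [show (lam + (n + n₀ : ℕ) - s) * w = (lam - s) * w + (n + n₀ : ℕ) * w by ring,
          Complex.exp_add, Complex.exp_nat_mul, norm_mul, norm_pow, Complex.norm_exp,
          Complex.norm_exp]
        refine mul_le_mul_of_nonneg_right (Real.exp_le_exp.2 ?_) (by positivity)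
        refine (Complex.re_le_norm _).trans ?_
        rw [norm_mul]
        refine mul_le_mul_of_nonneg_right ?_ (norm_nonneg _)
        rw [Metric.mem_ball, dist_eq_norm] at hs
        have : lam - s = lam - (s - s₀) - s₀ := by ring
        rw [this]
        linarith [norm_sub_le (lam - (s - s₀)) s₀, norm_sub_le lam (s - s₀)]
      calc _ ≤ ‖a (n + n₀)‖ * (Real.exp ((‖lam‖ + ‖s₀‖ + 1) * ‖w‖) * Real.exp w.re ^ (n + n₀)) :=
            mul_le_mul_of_nonneg_left h1 (norm_nonneg _)
        _ = _ := by ring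
  · exact ((ha.hasSum_polarSum lam s hw).summable.sum_add_tsum_nat_add n₀).symm

theorem differentiableAt_polarTerm {c lam s₀ w : ℂ} {n : ℕ} (h : s₀ ≠ lam + n) :
    DifferentiableAt ℂ (fun s => c * Complex.exp ((lam + n - s) * w) / (lam + n - s)) s₀ := by
  have h0 : lam + n - s₀ ≠ 0 := fun h' => h (by linear_combination -h')
  fun_prop (disch := exact h0)

theorem differentiableAt_polarSum {a : ℕ → ℂ} (ha : SummableInDisc a) {lam s₀ : ℂ} {w : ℂ}
    (hw : w.re < 0) (hs : ∀ n : ℕ, s₀ ≠ lam + n) :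
    DifferentiableAt ℂ (fun s => polarSum lam a s w) s₀ := by
  obtain ⟨n₀, T, -, hT, he⟩ := exists_polarSum_eq_add ha lam s₀ hw 0
  have : DifferentiableAt ℂ (fun s => (∑ n ∈ Finset.range n₀,
      a n * Complex.exp ((lam + n - s) * w) / (lam + n - s)) + T s) s₀ :=
    (DifferentiableAt.fun_sum fun n _ => differentiableAt_polarTerm (hs n)).add hT
  refine this.congr_of_eventuallyEq ?_
  filter_upwards [Metric.ball_mem_nhds s₀ one_pos] with s hs
  exact he s hs

theorem tendsto_sub_mul_polarSum {a : ℕ → ℂ} (ha : SummableInDisc a) (lam : ℂ) {w : ℂ}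
    (hw : w.re < 0) (m : ℕ) :
    Tendsto (fun s => (s - (lam + m)) * polarSum lam a s w) (𝓝[≠] (lam + m)) (𝓝 (-a m)) := by
  obtain ⟨n₀, T, hm, hT, he⟩ := exists_polarSum_eq_add ha lam (lam + m) hw (m + 1)
  have h1 : Tendsto (fun s => (∑ n ∈ Finset.range n₀, (s - (lam + m)) *
      (a n * Complex.exp ((lam + n - s) * w) / (lam + n - s))) + (s - (lam + m)) * T s)
      (𝓝[≠] (lam + m)) (𝓝 ((∑ n ∈ Finset.range n₀, if n = m then -a m else 0) + 0)) := by
    refine (tendsto_finsetSum _ fun n _ => ?_).add (tendsto_sub_mul_of_continuousAt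
      hT.continuousAt)
    by_cases hn : n = m
    · subst hn
      rw [if_pos rfl]
      have h2 : Tendsto (fun s => -(a n * Complex.exp ((lam + n - s) * w))) (𝓝 (lam + n))
          (𝓝 (-(a n * Complex.exp ((lam + n - (lam + n)) * w)))) :=
        Continuous.tendsto (by fun_prop) _
      rw [sub_self, zero_mul, Complex.exp_zero, mul_one] at h2
      refine (h2.mono_left nhdsWithin_le_nhds).congr' ?_
      filter_upwards [self_mem_nhdsWithin] with s hs
      have : lam + n - s ≠ 0 := fun h => hs (by rw [Set.mem_singleton_iff]; linear_combination -h)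
      field_simp
      ring
    · rw [if_neg hn]
      refine tendsto_sub_mul_of_continuousAt
        (differentiableAt_polarTerm fun h => hn ?_).continuousAt
      have := add_left_cancel h
      exact_mod_cast this.symm
  rw [Finset.sum_ite_eq', if_pos (Finset.mem_range.2 (by omega)), add_zero] at h1
  refine h1.congr' ?_
  filter_upwards [mem_nhdsWithin_of_mem_nhds (Metric.ball_mem_nhds (lam + m) one_pos)] with s hs
  rw [he s hs, mul_add, Finset.mul_sum]

theorem exists_norm_polarSum_le {a : ℕ → ℂ} (ha : SummableInDisc a) (lam : ℂ) {w : ℂ}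
    (hw : w.re < 0) :
    ∃ C, 0 ≤ C ∧ ∀ s, (∀ n : ℕ, 1 ≤ ‖lam + n - s‖) →
      ‖polarSum lam a s w‖ ≤ C * Real.exp (-(s * w).re) := by
  have hb := ((ha _ (Real.exp_pos _).le (Real.exp_lt_one_iff.2 hw)).mul_left
    (Real.exp (lam * w).re)).hasSum
  refine ⟨∑' n : ℕ, Real.exp (lam * w).re * (‖a n‖ * Real.exp w.re ^ n),
    tsum_nonneg fun n => by positivity, fun s hs => ?_⟩
  refine tsum_of_norm_bounded (hb.mul_right (Real.exp (-(s * w).re))) fun n => ?_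
  rw [norm_div, norm_mul]
  refine (div_le_self (by positivity) (hs n)).trans (le_of_eq ?_)
  rw [show (lam + n - s) * w = lam * w + n * w - s * w by ring, Complex.norm_exp, Complex.sub_re,
    Complex.add_re, sub_eq_add_neg, Real.exp_add, Real.exp_add,
    show ((n : ℂ) * w).re = n * w.re by simp, Real.exp_nat_mul]
  ring

/-! ### Regularised Mellin transforms -/

/-- The strip that `w ↦ -exp w` maps onto the cut plane. -/
def strip : Set ℂ := {w | |w.im| < Real.pi}

theorem isOpen_strip : IsOpen strip :=
  isOpen_lt (by fun_prop) continuous_const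

theorem mem_strip_iff {w : ℂ} : w ∈ strip ↔ |w.im| < Real.pi := Iff.rfl

/-- `g` is holomorphic on the strip, with expansions in the exponents `lam + n` on the left and
`mu j - n` on the right. -/
structure HasExpansions {N : ℕ} (lam : ℂ) (mu : Fin N → ℂ) (a : ℕ → ℂ) (b : Fin N → ℕ → ℂ)
    (g : ℂ → ℂ) : Prop where
  summable_zero : SummableInDisc a
  summable_infty : ∀ j, SummableInDisc (b j)
  differentiable : ∀ w ∈ strip, DifferentiableAt ℂ g w
  zero : ∀ w ∈ strip, w.re < 0 → g w = Complex.exp (lam * w) * psum a (Complex.exp w)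
  infty : ∀ w ∈ strip, 0 < w.re →
    g w = ∑ j, Complex.exp (mu j * w) * psum (b j) (Complex.exp (-w))

/-- The regularised integral of `exp (-s * w) * g w` over the line `w.im = θ`. -/
noncomputable def regMellin {N : ℕ} (lam : ℂ) (mu : Fin N → ℂ) (a : ℕ → ℂ) (b : Fin N → ℕ → ℂ)
    (g : ℂ → ℂ) (θ : ℝ) (s : ℂ) : ℂ :=
  polarSum lam a s (-1 + θ * Complex.I)
    + (∫ t in (-1 : ℝ)..1, Complex.exp (-s * (t + θ * Complex.I)) * g (t + θ * Complex.I))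
    + ∑ j, polarSum (-mu j) (b j) (-s) (-(1 + θ * Complex.I))

/-- `s` is not one of the possible poles of the regularised Mellin transform. -/
def NotPole {N : ℕ} (lam : ℂ) (mu : Fin N → ℂ) (s : ℂ) : Prop :=
  (∀ n : ℕ, s ≠ lam + n) ∧ ∀ j, ∀ n : ℕ, -s ≠ -mu j + n

section

variable {N : ℕ} {lam : ℂ} {mu : Fin N → ℂ} {a : ℕ → ℂ} {b : Fin N → ℕ → ℂ} {g : ℂ → ℂ}

theorem re_left (θ : ℝ) : (-1 + θ * Complex.I : ℂ).re < 0 := by simp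

theorem re_right (θ : ℝ) : (-(1 + θ * Complex.I) : ℂ).re < 0 := by simp

theorem add_mul_I_mem_strip {θ : ℝ} (hθ : |θ| < Real.pi) (t : ℝ) :
    (t + θ * Complex.I : ℂ) ∈ strip := by
  simpa [mem_strip_iff] using hθ

theorem intervalIntegrable_exp_mul {g : ℂ → ℂ} (hg : ContinuousOn g strip) {θ : ℝ}
    (hθ : |θ| < Real.pi) (s : ℂ) (x y : ℝ) :
    IntervalIntegrable (fun t : ℝ => Complex.exp (-s * (t + θ * Complex.I)) *
      g (t + θ * Complex.I)) MeasureTheory.volume x y := by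
  refine Continuous.intervalIntegrable ?_ _ _
  have h1 : Continuous fun t : ℝ => g (t + θ * Complex.I) :=
    hg.comp_continuous (by fun_prop) fun t => add_mul_I_mem_strip hθ t
  exact Continuous.mul (by fun_prop) h1

theorem HasExpansions.continuousOn (h : HasExpansions lam mu a b g) : ContinuousOn g strip :=
  fun w hw => (h.differentiable w hw).continuousAt.continuousWithinAt

theorem HasExpansions.hasDerivAt_left (h : HasExpansions lam mu a b g) {s : ℂ}
    (hs : NotPole lam mu s) {w : ℂ} (hw : w ∈ strip) (hw0 : w.re < 0) :
    HasDerivAt (polarSum lam a s) (Complex.exp (-s * w) * g w) w := by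
  rw [h.zero w hw hw0]
  exact hasDerivAt_polarSum h.summable_zero hs.1 hw0

theorem HasExpansions.hasDerivAt_right (h : HasExpansions lam mu a b g) {s : ℂ}
    (hs : NotPole lam mu s) {w : ℂ} (hw : w ∈ strip) (hw0 : 0 < w.re) :
    HasDerivAt (fun w => ∑ j, polarSum (-mu j) (b j) (-s) (-w))
      (-(Complex.exp (-s * w) * g w)) w := by
  rw [h.infty w hw hw0, Finset.mul_sum, ← Finset.sum_neg_distrib]
  refine HasDerivAt.fun_sum fun j _ => ?_
  have h1 : HasDerivAt (polarSum (-mu j) (b j) (-s)) _ (-w) :=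
    hasDerivAt_polarSum (h.summable_infty j) (hs.2 j) (by simpa using hw0)
  refine (h1.scomp w (hasDerivAt_neg w)).congr_deriv ?_
  rw [neg_smul, one_smul]
  simp only [neg_neg, mul_neg, neg_mul]

/-- Cauchy's theorem on the rectangle with corners -1 and 1 + iθ. The tail terms are primitives of
the integrand up to sign, so their changes cancel the two vertical sides. -/
theorem HasExpansions.regMellin_eq (h : HasExpansions lam mu a b g) {s : ℂ}
    (hs : NotPole lam mu s) {θ : ℝ} (hθ : |θ| < Real.pi) :
    regMellin lam mu a b g θ s = regMellin lam mu a b g 0 s := by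
  set H : ℂ → ℂ := fun w => Complex.exp (-s * w) * g w with hH
  have hHd : ∀ w ∈ strip, DifferentiableAt ℂ H w := fun w hw => by
    have := h.differentiable w hw
    fun_prop
  have hmem : ∀ y ∈ Set.uIcc 0 θ, |y| < Real.pi := fun y hy => by
    rw [Set.mem_uIcc] at hy
    rw [abs_lt] at hθ ⊢
    have := Real.pi_pos
    rcases hy with hy | hy <;> constructor <;> linarith
  have hmem' : ∀ (x : ℝ), ∀ y ∈ Set.uIcc 0 θ, (x + y * Complex.I : ℂ) ∈ strip :=
    fun x y hy => add_mul_I_mem_strip (hmem y hy) x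
  have hlin : ∀ (x : ℂ) (y : ℝ), HasDerivAt (fun y : ℝ => x + y * Complex.I) Complex.I y :=
    fun x y => (((Complex.ofRealCLM.hasDerivAt (x := y)).mul_const Complex.I).const_add x).congr_deriv
      (by simp)
  have hint : ∀ x : ℝ, IntervalIntegrable (fun y : ℝ => Complex.I * H (x + y * Complex.I))
      MeasureTheory.volume 0 θ := fun x => by
    refine ContinuousOn.intervalIntegrable fun y hy => ?_
    have h1 := (hHd _ (hmem' x y hy)).continuousAt
    have h2 : ContinuousAt (fun y : ℝ => H (x + y * Complex.I)) y :=
      ContinuousAt.comp (f := fun y : ℝ => (x + y * Complex.I : ℂ)) h1 (by fun_prop)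
    exact (h2.const_mul _).continuousWithinAt
  have hL := intervalIntegral.integral_eq_sub_of_hasDerivAt (a := 0) (b := θ)
    (f := fun y : ℝ => polarSum lam a s (-1 + y * Complex.I))
    (f' := fun y : ℝ => Complex.I * H ((-1 : ℝ) + y * Complex.I)) (fun y hy => by
      have h1 := h.hasDerivAt_left hs (by simpa using hmem' (-1) y hy) (re_left y)
      refine (h1.scomp y (hlin (-1) y)).congr_deriv ?_
      simp [hH]) (hint (-1))
  have hR := intervalIntegral.integral_eq_sub_of_hasDerivAt (a := 0) (b := θ)
    (f := fun y : ℝ => -∑ j, polarSum (-mu j) (b j) (-s) (-(1 + y * Complex.I)))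
    (f' := fun y : ℝ => Complex.I * H ((1 : ℝ) + y * Complex.I)) (fun y hy => by
      have h1 := h.hasDerivAt_right hs (w := 1 + y * Complex.I)
        (by simpa using hmem' 1 y hy) (by simp)
      have := (h1.scomp y (hlin 1 y)).neg
      refine this.congr_deriv ?_
      simp [hH]) (hint 1)
  have hrect := Complex.integral_boundary_rect_eq_zero_of_differentiableOn H (-1)
    (1 + θ * Complex.I) (fun w hw => by
      refine (hHd w ?_).differentiableWithinAt
      have := hw.2
      simp at this
      exact hmem _ this)
  simp only [intervalIntegral.integral_const_mul] at hL hR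
  simp only [Complex.neg_re, Complex.one_re, Complex.add_re, Complex.mul_re, Complex.ofReal_re,
    Complex.I_re, mul_zero, Complex.ofReal_im, Complex.I_im, mul_one, sub_self, add_zero,
    Complex.neg_im, Complex.one_im, neg_zero, Complex.add_im, Complex.mul_im, zero_add,
    smul_eq_mul] at hrect
  rw [hL, hR] at hrect
  rw [regMellin, regMellin]
  simp only [hH] at hrect
  linear_combination -hrect

theorem regMellin_const_mul (κ : ℂ) (θ : ℝ) (s : ℂ) :
    regMellin lam mu (fun n => κ * a n) (fun j n => κ * b j n) (fun w => κ * g w) θ s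
      = κ * regMellin lam mu a b g θ s := by
  simp only [regMellin, polarSum_const_mul, mul_add, Finset.mul_sum,
    ← intervalIntegral.integral_const_mul]
  congr 3
  ext t
  ring

theorem regMellin_add {a' : ℕ → ℂ} {b' : Fin N → ℕ → ℂ} {g' : ℂ → ℂ} (ha : SummableInDisc a)
    (ha' : SummableInDisc a') (hb : ∀ j, SummableInDisc (b j)) (hb' : ∀ j, SummableInDisc (b' j))
    (hg : ContinuousOn g strip) (hg' : ContinuousOn g' strip) {θ : ℝ} (hθ : |θ| < Real.pi)
    (s : ℂ) :
    regMellin lam mu (fun n => a n + a' n) (fun j n => b j n + b' j n) (fun w => g w + g' w) θ s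
      = regMellin lam mu a b g θ s + regMellin lam mu a' b' g' θ s := by
  have hi := intervalIntegral.integral_add (intervalIntegrable_exp_mul hg hθ s (-1) 1)
    (intervalIntegrable_exp_mul hg' hθ s (-1) 1)
  simp only [← mul_add] at hi
  rw [regMellin, regMellin, regMellin, polarSum_add ha ha' lam s (re_left θ), hi,
    Finset.sum_congr rfl fun j _ => polarSum_add (hb j) (hb' j) (-mu j) (-s) (re_right θ),
    Finset.sum_add_distrib]
  ring

theorem regMellin_sum {ι : Type*} (S : Finset ι) {a : ι → ℕ → ℂ} {b : ι → Fin N → ℕ → ℂ}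
    {g : ι → ℂ → ℂ} (h : ∀ k, HasExpansions lam mu (a k) (b k) (g k)) {θ : ℝ}
    (hθ : |θ| < Real.pi) (s : ℂ) :
    regMellin lam mu (fun n => ∑ k ∈ S, a k n) (fun j n => ∑ k ∈ S, b k j n)
      (fun w => ∑ k ∈ S, g k w) θ s = ∑ k ∈ S, regMellin lam mu (a k) (b k) (g k) θ s := by
  simp only [regMellin, polarSum_sum S (fun k => (h k).summable_zero) lam s (re_left θ),
    Finset.mul_sum]
  rw [intervalIntegral.integral_finsetSum
    (fun k _ => intervalIntegrable_exp_mul (h k).continuousOn hθ s _ _),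
    Finset.sum_congr rfl fun j _ =>
      polarSum_sum S (fun k => (h k).summable_infty j) (-mu j) (-s) (re_right θ),
    Finset.sum_comm, Finset.sum_add_distrib, Finset.sum_add_distrib]

/-- Here G = g' - κ g. Integration by parts on the middle segment leaves boundary terms at ±1 + iθ,
and these cancel those of `polarSum_sub_mul` from the two tails: the regularised transform behaves
like a convergent one. -/
theorem HasExpansions.regMellin_deriv (h : HasExpansions lam mu a b g) {κ : ℂ} {G : ℂ → ℂ}
    (hG : ContinuousOn G strip) (hg : ∀ w ∈ strip, HasDerivAt g (G w + κ * g w) w)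
    {s : ℂ} (hs : NotPole lam mu s) {θ : ℝ} (hθ : |θ| < Real.pi) :
    regMellin lam mu (fun n => (lam + n - κ) * a n) (fun j n => (mu j - n - κ) * b j n) G θ s
      = (s - κ) * regMellin lam mu a b g θ s := by
  have e1 := polarSum_sub_mul h.summable_zero κ hs.1 (re_left θ)
  have e2 : ∀ j, polarSum (-mu j) (fun n => (mu j - n - κ) * b j n) (-s) (-(1 + θ * Complex.I))
      = -(Complex.exp (-s * (1 + θ * Complex.I)) * (Complex.exp (mu j * (1 + θ * Complex.I)) *
          psum (b j) (Complex.exp (-(1 + θ * Complex.I)))))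
        + (s - κ) * polarSum (-mu j) (b j) (-s) (-(1 + θ * Complex.I)) := by
    intro j
    have := polarSum_sub_mul (h.summable_infty j) (-κ) (hs.2 j) (re_right θ)
    have e3 : (fun n : ℕ => (mu j - n - κ) * b j n)
        = fun n : ℕ => (-1) * ((-mu j + n - -κ) * b j n) := by ext n; ring
    rw [e3, polarSum_const_mul, this]
    simp only [neg_neg, neg_mul, mul_neg]
    ring
  have hlin : ∀ t : ℝ, HasDerivAt (fun t : ℝ => (t + θ * Complex.I : ℂ)) 1 t :=
    fun t => ((Complex.ofRealCLM.hasDerivAt (x := t)).add_const _).congr_deriv (by simp)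
  have hparts := intervalIntegral.integral_eq_sub_of_hasDerivAt (a := -1) (b := 1)
    (f := fun t : ℝ => Complex.exp (-s * (t + θ * Complex.I)) * g (t + θ * Complex.I))
    (f' := fun t : ℝ => Complex.exp (-s * (t + θ * Complex.I)) * G (t + θ * Complex.I)
      - (s - κ) * (Complex.exp (-s * (t + θ * Complex.I)) * g (t + θ * Complex.I)))
    (fun t _ => by
      have h1 := (hg _ (add_mul_I_mem_strip hθ t)).scomp t (hlin t)
      have h2 := ((hlin t).const_mul (-s)).cexp
      refine (h2.mul h1).congr_deriv ?_
      simp only [Function.comp_apply, one_smul]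
      ring)
    ((intervalIntegrable_exp_mul hG hθ s _ _).sub
      ((intervalIntegrable_exp_mul h.continuousOn hθ s _ _).const_mul _))
  rw [intervalIntegral.integral_sub (intervalIntegrable_exp_mul hG hθ s _ _)
      ((intervalIntegrable_exp_mul h.continuousOn hθ s _ _).const_mul _),
    intervalIntegral.integral_const_mul] at hparts
  have hg1 := h.infty (1 + θ * Complex.I) (by simpa using add_mul_I_mem_strip hθ 1) (by simp)
  have hg2 := h.zero (-1 + θ * Complex.I) (by simpa using add_mul_I_mem_strip hθ (-1)) (re_left θ)
  rw [regMellin, regMellin, e1, Finset.sum_congr rfl fun j _ => e2 j, Finset.sum_add_distrib,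
    ← Finset.mul_sum, Finset.sum_neg_distrib, ← Finset.mul_sum, ← hg1, ← hg2]
  push_cast at hparts
  linear_combination hparts

/-- Multiplication by e^{-w} lowers exponents by one: on the left this drops the zero coefficient `a
0`, on the right it inserts a zero coefficient in front of `b j`. -/
theorem regMellin_add_one (ha : SummableInDisc a) (ha0 : a 0 = 0)
    {b' : Fin N → ℕ → ℂ} (hb' : ∀ j, SummableInDisc (b' j))
    (hb0 : ∀ j, b' j 0 = 0) (hbb : ∀ j n, b' j (n + 1) = b j n) (θ : ℝ) (s : ℂ) :
    regMellin lam mu a b g θ (s + 1)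
      = regMellin lam mu (fun n => a (n + 1)) b' (fun w => Complex.exp (-w) * g w) θ s := by
  rw [regMellin, regMellin, polarSum_add_one ha ha0 lam s (re_left θ)]
  congr 1
  · congr 2
    ext t
    rw [← mul_assoc, ← Complex.exp_add]
    congr 2
    ring
  · refine Finset.sum_congr rfl fun j _ => ?_
    have := polarSum_add_one (hb' j) (hb0 j) (-mu j) (-(s + 1)) (re_right θ)
    simp only [hbb] at this
    rw [← this]
    congr 1
    ring

theorem HasExpansions.differentiableAt_integral (h : HasExpansions lam mu a b g) (s : ℂ) :
    DifferentiableAt ℂ (fun s => ∫ t in (-1 : ℝ)..1,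
      Complex.exp (-s * (t + (0 : ℝ) * Complex.I)) * g (t + (0 : ℝ) * Complex.I)) s := by
  have h0 : |(0 : ℝ)| < Real.pi := by simpa using Real.pi_pos
  have hgc : Continuous fun t : ℝ => g (t + (0 : ℝ) * Complex.I) :=
    h.continuousOn.comp_continuous (by fun_prop) fun t => add_mul_I_mem_strip h0 t
  have hF' : Continuous fun p : ℂ × ℝ => Complex.exp (-p.1 * (p.2 + (0 : ℝ) * Complex.I)) *
      (-(p.2 + (0 : ℝ) * Complex.I)) * g (p.2 + (0 : ℝ) * Complex.I) := by
    have : Continuous fun p : ℂ × ℝ => g (p.2 + (0 : ℝ) * Complex.I) := hgc.comp continuous_snd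
    exact Continuous.mul (by fun_prop) this
  obtain ⟨B, hB⟩ := ((isCompact_closedBall s 1).prod (isCompact_Icc (a := (-1 : ℝ)) (b := 1))
    ).exists_bound_of_continuousOn hF'.continuousOn
  refine (intervalIntegral.hasDerivAt_integral_of_dominated_loc_of_deriv_le
    (F' := fun (s : ℂ) (t : ℝ) => Complex.exp (-s * (t + (0 : ℝ) * Complex.I)) *
      (-(t + (0 : ℝ) * Complex.I)) * g (t + (0 : ℝ) * Complex.I))
    (bound := fun _ => B) (Metric.ball_mem_nhds s one_pos) ?_
    (intervalIntegrable_exp_mul h.continuousOn h0 s _ _) ?_ ?_ intervalIntegrable_const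
    ?_).2.differentiableAt
  · exact Eventually.of_forall fun z => by
      have : Continuous fun t : ℝ => Complex.exp (-z * (t + (0 : ℝ) * Complex.I)) *
        g (t + (0 : ℝ) * Complex.I) := Continuous.mul (by fun_prop) hgc
      exact this.aestronglyMeasurable
  · exact (hF'.comp (by fun_prop : Continuous fun t : ℝ => (s, t))).aestronglyMeasurable
  · refine Eventually.of_forall fun t ht z hz => hB (z, t) ⟨Metric.ball_subset_closedBall hz, ?_⟩
    rw [Set.uIoc_of_le (by norm_num)] at ht
    exact ⟨ht.1.le, ht.2⟩
  · refine Eventually.of_forall fun t _ z _ => ?_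
    have h2 : HasDerivAt (fun z : ℂ => -z * (t + (0 : ℝ) * Complex.I))
        (-1 * (t + (0 : ℝ) * Complex.I)) z := (hasDerivAt_neg z).mul_const _
    refine (h2.cexp.mul_const _).congr_deriv ?_
    ring

theorem HasExpansions.differentiableAt_regMellin (h : HasExpansions lam mu a b g) {s : ℂ}
    (hs : NotPole lam mu s) : DifferentiableAt ℂ (regMellin lam mu a b g 0) s := by
  refine ((differentiableAt_polarSum h.summable_zero (re_left 0) hs.1).add
    (h.differentiableAt_integral s)).add (DifferentiableAt.fun_sum fun j _ => ?_)
  exact DifferentiableAt.comp s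
    (differentiableAt_polarSum (h.summable_infty j) (re_right 0) (hs.2 j)) (differentiableAt_id.neg)

theorem HasExpansions.tendsto_sub_mul_regMellin (h : HasExpansions lam mu a b g) (s₀ A : ℂ)
    (B : Fin N → ℂ)
    (hA : Tendsto (fun s => (s - s₀) * polarSum lam a s (-1 + (0 : ℝ) * Complex.I))
      (𝓝[≠] s₀) (𝓝 A))
    (hB : ∀ j, Tendsto (fun s => (s - s₀) *
      polarSum (-mu j) (b j) (-s) (-(1 + (0 : ℝ) * Complex.I))) (𝓝[≠] s₀) (𝓝 (B j))) :
    Tendsto (fun s => (s - s₀) * regMellin lam mu a b g 0 s) (𝓝[≠] s₀) (𝓝 (A + ∑ j, B j)) := by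
  have h1 := tendsto_sub_mul_of_continuousAt (h.differentiableAt_integral s₀).continuousAt
  have h2 := (hA.add h1).add (tendsto_finsetSum Finset.univ fun j _ => hB j)
  rw [add_zero] at h2
  refine h2.congr fun s => ?_
  rw [regMellin, mul_add, mul_add, Finset.mul_sum]

theorem tendsto_polarSum_left_of_ne (ha : SummableInDisc a) {s₀ : ℂ}
    (hs : ∀ n : ℕ, s₀ ≠ lam + n) {w : ℂ} (hw : w.re < 0) :
    Tendsto (fun s => (s - s₀) * polarSum lam a s w) (𝓝[≠] s₀) (𝓝 0) :=
  tendsto_sub_mul_of_continuousAt (differentiableAt_polarSum ha hw hs).continuousAt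

theorem tendsto_neg_nhdsNE (s₀ : ℂ) : Tendsto (fun s : ℂ => -s) (𝓝[≠] s₀) (𝓝[≠] (-s₀)) :=
  tendsto_nhdsWithin_of_tendsto_nhds_of_eventually_within _
    ((continuous_neg.tendsto s₀).mono_left nhdsWithin_le_nhds) (by
      filter_upwards [self_mem_nhdsWithin] with s hs h
      exact hs (neg_injective h))

theorem tendsto_polarSum_right_of_ne {ν : ℂ} {c : ℕ → ℂ} (hc : SummableInDisc c) {s₀ : ℂ}
    (hs : ∀ n : ℕ, -s₀ ≠ -ν + n) {w : ℂ} (hw : w.re < 0) :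
    Tendsto (fun s => (s - s₀) * polarSum (-ν) c (-s) w) (𝓝[≠] s₀) (𝓝 0) := by
  have := (tendsto_polarSum_left_of_ne hc hs hw).comp (tendsto_neg_nhdsNE s₀)
  rw [← neg_zero]
  refine this.neg.congr fun s => ?_
  simp only [Function.comp_apply]
  ring

theorem tendsto_polarSum_right {ν : ℂ} {c : ℕ → ℂ} (hc : SummableInDisc c) (m : ℕ) {w : ℂ}
    (hw : w.re < 0) :
    Tendsto (fun s => (s - (ν - m)) * polarSum (-ν) c (-s) w) (𝓝[≠] (ν - m)) (𝓝 (c m)) := by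
  have h1 := tendsto_sub_mul_polarSum hc (-ν) hw m
  have h2 := tendsto_neg_nhdsNE (ν - m)
  rw [show -(ν - (m : ℂ)) = -ν + m by ring] at h2
  have := (h1.comp h2).neg
  rw [neg_neg] at this
  refine this.congr fun s => ?_
  simp only [Function.comp_apply]
  ring

/-- On the line Im w = θ the kernel e^{-sw} has modulus e^{-Re(s) Re(w) + θ Im(s)}. Distance at
least 1 from all potential poles keeps the denominators harmless. -/
theorem HasExpansions.exists_norm_regMellin_le (h : HasExpansions lam mu a b g) (σ₁ σ₂ : ℝ)
    {θ : ℝ} (hθ : |θ| < Real.pi) :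
    ∃ C, 0 ≤ C ∧ ∀ s : ℂ, σ₁ ≤ s.re → s.re ≤ σ₂ → (∀ n : ℕ, 1 ≤ ‖lam + n - s‖) →
      (∀ j, ∀ n : ℕ, 1 ≤ ‖-mu j + n - -s‖) →
      ‖regMellin lam mu a b g θ s‖ ≤ C * Real.exp (θ * s.im) := by
  obtain ⟨C₁, hC₁, h1⟩ := exists_norm_polarSum_le h.summable_zero lam (re_left θ)
  choose C₂ hC₂ h2 using fun j =>
    exists_norm_polarSum_le (h.summable_infty j) (-mu j) (re_right θ)
  have hgc : Continuous fun t : ℝ => g (t + θ * Complex.I) :=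
    h.continuousOn.comp_continuous (by fun_prop) fun t => add_mul_I_mem_strip hθ t
  obtain ⟨B, hB⟩ := (isCompact_Icc (a := (-1 : ℝ)) (b := 1)).exists_bound_of_continuousOn
    hgc.continuousOn
  have hB0 : 0 ≤ B := (norm_nonneg _).trans (hB 0 (by simp))
  set S := |σ₁| + |σ₂| with hS
  refine ⟨(C₁ + 2 * B + ∑ j, C₂ j) * Real.exp S, mul_nonneg (add_nonneg (by positivity)
    (Finset.sum_nonneg fun j _ => hC₂ j)) (Real.exp_pos _).le, fun s hs1 hs2 hp1 hp2 => ?_⟩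
  have hsS : |s.re| ≤ S := by
    rw [abs_le]
    constructor
    · linarith [neg_abs_le σ₁, abs_nonneg σ₂]
    · linarith [le_abs_self σ₂, abs_nonneg σ₁]
  rw [abs_le] at hsS
  have e1 : ‖polarSum lam a s (-1 + θ * Complex.I)‖ ≤ C₁ * (Real.exp S * Real.exp (θ * s.im)) := by
    refine (h1 s hp1).trans (mul_le_mul_of_nonneg_left ?_ hC₁)
    rw [← Real.exp_add]
    refine Real.exp_le_exp.2 ?_
    simp
    linarith
  have e2 : ∀ j, ‖polarSum (-mu j) (b j) (-s) (-(1 + θ * Complex.I))‖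
      ≤ C₂ j * (Real.exp S * Real.exp (θ * s.im)) := by
    intro j
    refine (h2 j (-s) (hp2 j)).trans (mul_le_mul_of_nonneg_left ?_ (hC₂ j))
    rw [← Real.exp_add]
    refine Real.exp_le_exp.2 ?_
    simp
    linarith
  have e3 : ‖∫ t in (-1 : ℝ)..1, Complex.exp (-s * (t + θ * Complex.I)) * g (t + θ * Complex.I)‖
      ≤ (Real.exp S * Real.exp (θ * s.im)) * B * |1 - (-1 : ℝ)| := by
    refine intervalIntegral.norm_integral_le_of_norm_le_const fun t ht => ?_
    rw [Set.uIoc_of_le (by norm_num)] at ht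
    rw [norm_mul]
    refine mul_le_mul ?_ (hB t ⟨ht.1.le, ht.2⟩) (norm_nonneg _) (by positivity)
    rw [← Real.exp_add, Complex.norm_exp]
    refine Real.exp_le_exp.2 ?_
    simp
    nlinarith [ht.1, ht.2]
  rw [regMellin]
  refine (norm_add_le _ _).trans ((add_le_add ((norm_add_le _ _).trans (add_le_add e1 e3))
    ((norm_sum_le _ _).trans (Finset.sum_le_sum fun j _ => e2 j))).trans (le_of_eq ?_))
  rw [← Finset.sum_mul]
  norm_num
  ring

/-- The line Im w = 0 is moved to Im w = -2 or 2, against the sign of Im s. The number 2 is a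
convenient angle below π; exponential decay is needed to beat the polynomial growth of the Gamma
quotients. -/
theorem HasExpansions.exists_norm_regMellin_le_exp (h : HasExpansions lam mu a b g) (σ₁ σ₂ : ℝ) :
    ∃ C T : ℝ, 0 ≤ C ∧ ∀ s : ℂ, σ₁ ≤ s.re → s.re ≤ σ₂ → T ≤ |s.im| →
      ‖regMellin lam mu a b g 0 s‖ ≤ C * Real.exp (-(2 * |s.im|)) := by
  have hπ : |(2 : ℝ)| < Real.pi := by rw [abs_two]; linarith [Real.pi_gt_three]
  have hπ' : |(-2 : ℝ)| < Real.pi := by rwa [abs_neg]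
  obtain ⟨C₁, hC₁, h1⟩ := h.exists_norm_regMellin_le σ₁ σ₂ hπ
  obtain ⟨C₂, hC₂, h2⟩ := h.exists_norm_regMellin_le σ₁ σ₂ hπ'
  set T : ℝ := |lam.im| + (∑ j, |(mu j).im|) + 1
  have key : ∀ (x s : ℂ), |x.im| + 1 ≤ |s.im| → ∀ n : ℕ, 1 ≤ ‖x + n - s‖ := by
    intro x s hx n
    refine le_trans ?_ (Complex.abs_im_le_norm _)
    have h3 := abs_sub_abs_le_abs_sub s.im x.im
    rw [abs_sub_comm] at h3
    simp
    linarith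
  refine ⟨max C₁ C₂, T, hC₁.trans (le_max_left _ _), fun s hs1 hs2 hsT => ?_⟩
  have hj : ∀ j, |(mu j).im| ≤ ∑ j, |(mu j).im| := fun j =>
    Finset.single_le_sum (f := fun j => |(mu j).im|) (fun _ _ => abs_nonneg _) (Finset.mem_univ j)
  have hsum : 0 ≤ ∑ j, |(mu j).im| := Finset.sum_nonneg fun _ _ => abs_nonneg _
  have k1 : ∀ n : ℕ, 1 ≤ ‖lam + n - s‖ := key lam s (by linarith)
  have k2 : ∀ j, ∀ n : ℕ, 1 ≤ ‖-mu j + n - -s‖ := fun j => key (-mu j) (-s) (by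
    simp only [Complex.neg_im, abs_neg]
    linarith [hj j, abs_nonneg lam.im])
  have hs : NotPole lam mu s := by
    constructor
    · intro n hn
      have := k1 n
      rw [hn, sub_self, norm_zero] at this
      linarith
    · intro j n hn
      have := k2 j n
      rw [hn, sub_self, norm_zero] at this
      linarith
  rcases le_total 0 s.im with h0 | h0
  · rw [← h.regMellin_eq hs hπ', abs_of_nonneg h0]
    refine (h2 s hs1 hs2 k1 k2).trans (mul_le_mul (le_max_right _ _) (by rw [neg_mul])
      (Real.exp_pos _).le (hC₂.trans (le_max_right _ _)))
  · rw [← h.regMellin_eq hs hπ, abs_of_nonpos h0]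
    refine (h1 s hs1 hs2 k1 k2).trans (mul_le_mul (le_max_left _ _) (by rw [mul_neg, neg_neg])
      (Real.exp_pos _).le (hC₁.trans (le_max_left _ _)))

end

/-! ### Solutions in the logarithmic coordinate -/

theorem neg_exp_mem_cutPlane {w : ℂ} (hw : w ∈ strip) : -Complex.exp w ∈ cutPlane := by
  rw [mem_cutPlane_iff, neg_neg, Complex.mem_slitPlane_iff_arg]
  rw [mem_strip_iff, abs_lt] at hw
  refine ⟨?_, Complex.exp_ne_zero w⟩
  rw [← Complex.log_im, Complex.log_exp hw.1 hw.2.le]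
  exact hw.2.ne

/-- In the chosen branch log(-e^w) = w + iπ. This is the origin of the factor e^{iπ(λ_i-μ_j)} in the
transport matrix. -/
theorem cutPow_neg_exp {w : ℂ} (hw : w ∈ strip) (a : ℂ) :
    cutPow (-Complex.exp w) a = Complex.exp (a * w) * Complex.exp (a * (Real.pi * Complex.I)) := by
  rw [mem_strip_iff, abs_lt] at hw
  rw [cutPow, neg_neg, Complex.log_exp hw.1 hw.2.le, mul_add, Complex.exp_add]

theorem one_add_exp_ne_zero {w : ℂ} (hw : w ∈ strip) : 1 + Complex.exp w ≠ 0 := by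
  have := one_sub_ne_zero (neg_exp_mem_cutPlane hw)
  rwa [sub_neg_eq_add] at this

theorem IsSolution.hasDerivAt_exp {N : ℕ} {P Q : Module.End ℂ (V N)} {φ : V N →ₗ[ℂ] ℂ} {v : V N}
    (hφv : ∀ x, Q x = φ x • v) {f : ℂ → V N} (hf : IsSolution P Q f) {w : ℂ} (hw : w ∈ strip) :
    HasDerivAt (fun w => f (-Complex.exp w)) (P (f (-Complex.exp w)) -
      (Complex.exp w / (1 + Complex.exp w) * φ (f (-Complex.exp w))) • v) w := by
  refine ((hf _ (neg_exp_mem_cutPlane hw)).scomp w (Complex.hasDerivAt_exp w).neg).congr_deriv ?_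
  have h0 := Complex.exp_ne_zero w
  rw [sub_neg_eq_add, hφv, smul_add, smul_smul, smul_smul, smul_smul,
    show -Complex.exp w * (-Complex.exp w)⁻¹ = 1 by rw [mul_inv_cancel₀ (neg_ne_zero.2 h0)],
    one_smul, sub_eq_add_neg, ← neg_smul]
  congr 2
  ring

/-! ### Shifts, sums and linear images of power series on the disc. -/

section PowerSeriesShift

theorem SummableInDisc.succ {c : ℕ → ℂ} (hc : SummableInDisc c) :
    SummableInDisc fun n => c (n + 1) := by
  intro r hr0 hr1
  rcases hr0.eq_or_lt with rfl | hr0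
  · refine summable_of_ne_finset_zero (s := {0}) fun k hk => ?_
    rw [Finset.mem_singleton] at hk
    simp [hk]
  · refine (((summable_nat_add_iff 1).2 (hc r hr0.le hr1)).mul_left (r⁻¹)).congr fun k => ?_
    rw [pow_succ]
    field_simp

theorem SummableInDisc.of_succ {c : ℕ → ℂ} (hc : SummableInDisc fun n => c (n + 1)) :
    SummableInDisc c := by
  intro r hr0 hr1
  refine (summable_nat_add_iff 1).1 (((hc r hr0 hr1).mul_left r).congr fun k => ?_)
  rw [pow_succ]
  ring

theorem SummableInDisc.psum_succ {c : ℕ → ℂ} (hc : SummableInDisc c) (h0 : c 0 = 0) {x : ℂ}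
    (hx : ‖x‖ < 1) : psum c x = x * psum (fun n => c (n + 1)) x := by
  have h1 := hc.hasSum hx
  rw [← hasSum_nat_add_iff' 1] at h1
  simp only [Finset.sum_range_one, h0, smul_zero, sub_zero] at h1
  refine h1.unique (((hc.succ.hasSum hx).mul_left x).congr_fun fun n => ?_)
  simp only [smul_eq_mul, pow_succ]
  ring

theorem SummableInDisc.add {c b : ℕ → ℂ} (hc : SummableInDisc c) (hb : SummableInDisc b) :
    SummableInDisc fun n => c n + b n := by
  intro r h0 h1
  refine Summable.of_nonneg_of_le (fun n => by positivity) (fun n => ?_)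
    ((hc r h0 h1).add (hb r h0 h1))
  rw [← add_mul]
  exact mul_le_mul_of_nonneg_right (norm_add_le _ _) (by positivity)

theorem SummableInDisc.psum_add {c b : ℕ → ℂ} (hc : SummableInDisc c) (hb : SummableInDisc b)
    {x : ℂ} (hx : ‖x‖ < 1) : psum (fun n => c n + b n) x = psum c x + psum b x :=
  ((hc.add hb).hasSum hx).unique
    (((hc.hasSum hx).add (hb.hasSum hx)).congr_fun fun n => by rw [smul_add])

theorem SummableInDisc.const_mul {c : ℕ → ℂ} (hc : SummableInDisc c) (κ : ℂ) :
    SummableInDisc fun n => κ * c n :=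
  hc.of_norm_le ‖κ‖ fun n => by rw [norm_mul]

theorem SummableInDisc.psum_const_mul {c : ℕ → ℂ} (hc : SummableInDisc c) (κ : ℂ)
    {x : ℂ} (hx : ‖x‖ < 1) : psum (fun n => κ * c n) x = κ * psum c x :=
  ((hc.const_mul κ).hasSum hx).unique
    (((hc.hasSum hx).mul_left κ).congr_fun fun n => by simp only [smul_eq_mul]; ring)

theorem SummableInDisc.map {N : ℕ} {A : ℕ → V N} (hA : SummableInDisc A) (ψ : V N →ₗ[ℂ] ℂ) :
    SummableInDisc fun n => ψ (A n) :=
  hA.of_norm_le ‖LinearMap.toContinuousLinearMap ψ‖ fun n =>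
    (LinearMap.toContinuousLinearMap ψ).le_opNorm (A n)

theorem SummableInDisc.psum_map {N : ℕ} {A : ℕ → V N} (hA : SummableInDisc A) (ψ : V N →ₗ[ℂ] ℂ)
    {x : ℂ} (hx : ‖x‖ < 1) : psum (fun n => ψ (A n)) x = ψ (psum A x) :=
  ((hA.map ψ).hasSum hx).unique
    (((LinearMap.toContinuousLinearMap ψ).hasSum (hA.hasSum hx)).congr_fun fun n => by simp)

end PowerSeriesShift

theorem exists_strip_exp_mul_eq {ε : ℂ} (hε : ε = 1 ∨ ε = -1) {x : ℝ} (h0 : 0 < x) (h1 : x < 1) :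
    ∃ w ∈ strip, (ε * w).re < 0 ∧ Complex.exp (ε * w) = x := by
  have hεε : ε * ε = 1 := by rcases hε with rfl | rfl <;> norm_num
  refine ⟨ε * (Real.log x : ℂ), ?_, ?_, ?_⟩
  · have : (ε * (Real.log x : ℂ)).im = 0 := by rcases hε with rfl | rfl <;> simp
    rw [mem_strip_iff, this, abs_zero]
    exact Real.pi_pos
  · rw [← mul_assoc, hεε, one_mul, Complex.ofReal_re]
    exact Real.log_neg h0 h1
  · rw [← mul_assoc, hεε, one_mul, ← Complex.ofReal_exp, Real.exp_log h0]

theorem IsNormalizedEigensystem.coord_ne_zero {N : ℕ} {φ : V N →ₗ[ℂ] ℂ} {v : V N}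
    {P : Module.End ℂ (V N)} {lam : Fin N → ℂ} {ξ : Fin N → V N}
    (h : IsNormalizedEigensystem φ v P lam ξ) (i : Fin N) : h.basis.repr v i ≠ 0 := by
  obtain ⟨d, hd, hv⟩ := h.generalPosition
  have h1 : ∀ y, y = ∑ k, d k • h.basis k → h.basis.repr y i = d i := by
    rintro y rfl
    rw [h.basis.repr_sum_self]
  rw [h1 v (by simpa only [h.basis_apply] using hv)]
  exact hd i

/-- Substituting the series of F into F' = P F - W v shows that the series with coefficients ε(ν+n)
A_n - P A_n sums, up to an exponential, to a multiple of v. Hence each of these coefficients is a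
multiple of v, and W inherits an expansion with the same exponents. The sign ε = 1 serves the
expansion at zero, ε = -1 that at infinity. -/
theorem exists_coefficients {N : ℕ} {φ : V N →ₗ[ℂ] ℂ} {v : V N}
    {P : Module.End ℂ (V N)} {lam : Fin N → ℂ} {ξ : Fin N → V N}
    (h : IsNormalizedEigensystem φ v P lam ξ) (i : Fin N) {ε ν : ℂ} (hε : ε = 1 ∨ ε = -1)
    {F : ℂ → V N} {W : ℂ → ℂ} {A : ℕ → V N}
    (hF : ∀ w ∈ strip, HasDerivAt F (P (F w) - W w • v) w)
    (hA : ∀ w ∈ strip, (ε * w).re < 0 →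
      HasSum (fun n : ℕ => Complex.exp (ε * (ν + n) * w) • A n) (F w)) :
    SummableInDisc A ∧
    (∀ w ∈ strip, (ε * w).re < 0 → F w = Complex.exp (ε * ν * w) • psum A (Complex.exp (ε * w))) ∧
    ∃ α : ℕ → ℂ, SummableInDisc α ∧
      (∀ w ∈ strip, (ε * w).re < 0 →
        W w = Complex.exp (ε * ν * w) * psum α (Complex.exp (ε * w))) ∧
      ∀ n : ℕ, (ε * (ν + n)) • A n - P (A n) = -(α n • v) := by
  have hA' : ∀ w ∈ strip, (ε * w).re < 0 → HasSum (fun n : ℕ => Complex.exp (ε * w) ^ n • A n)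
      (Complex.exp (-(ε * ν * w)) • F w) := by
    intro w hw hw0
    refine ((hA w hw hw0).const_smul (Complex.exp (-(ε * ν * w)))).congr_fun fun n => ?_
    rw [smul_smul, ← Complex.exp_add, ← Complex.exp_nat_mul]
    congr 2
    ring
  have hreal : ∀ (E : Type) [NormedAddCommGroup E] [NormedSpace ℂ E] (c : ℕ → E) (y : ℂ → E),
      (∀ w ∈ strip, (ε * w).re < 0 → HasSum (fun n : ℕ => Complex.exp (ε * w) ^ n • c n) (y w)) →
      SummableInDisc c := by
    intro E _ _ c y hy
    choose! w hw hw0 hwx using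
      fun (x : ℝ) (hx : 0 < x ∧ x < 1) => exists_strip_exp_mul_eq hε hx.1 hx.2
    refine SummableInDisc.of_hasSum (y := fun x => y (w x)) fun x h0 h1 => ?_
    have := hy (w x) (hw x ⟨h0, h1⟩) (hw0 x ⟨h0, h1⟩)
    rwa [hwx x ⟨h0, h1⟩] at this
  have hsA := hreal _ A _ hA'
  have hFA : ∀ w ∈ strip, (ε * w).re < 0 →
      F w = Complex.exp (ε * ν * w) • psum A (Complex.exp (ε * w)) := by
    intro w hw hw0
    rw [(hsA.hasSum (norm_exp_lt_one hw0)).unique (hA' w hw hw0), smul_smul, ← Complex.exp_add,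
      add_neg_cancel, Complex.exp_zero, one_smul]
  refine ⟨hsA, hFA, ?_⟩
  set y : ℕ → V N := fun n => (ε * (ν + n)) • A n - P (A n) with hy
  set P' : V N →L[ℂ] V N := LinearMap.toContinuousLinearMap P with hP'
  have hyW : ∀ w ∈ strip, (ε * w).re < 0 → HasSum (fun n : ℕ => Complex.exp (ε * w) ^ n • y n)
      (-(Complex.exp (-(ε * ν * w)) * W w) • v) := by
    intro w hw hw0
    obtain ⟨d, hd, hd'⟩ := hsA.exists_hasDerivAt (norm_exp_lt_one hw0)
    have h1 : HasDerivAt (fun w => Complex.exp (ε * ν * w)) (Complex.exp (ε * ν * w) * (ε * ν)) w :=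
      (((hasDerivAt_id w).const_mul (ε * ν)).cexp).congr_deriv (by simp)
    have h2 : HasDerivAt (fun w => Complex.exp (ε * w)) (Complex.exp (ε * w) * ε) w :=
      (((hasDerivAt_id w).const_mul ε).cexp).congr_deriv (by simp)
    have h3 := h1.smul (hd.scomp w h2)
    have hop : IsOpen {w : ℂ | w ∈ strip ∧ (ε * w).re < 0} :=
      isOpen_strip.inter (isOpen_lt (Complex.continuous_re.comp (continuous_const.mul continuous_id))
        continuous_const)
    have h4 : HasDerivAt F _ w := h3.congr_of_eventuallyEq (by
      filter_upwards [hop.mem_nhds ⟨hw, hw0⟩] with z hz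
      exact hFA z hz.1 hz.2)
    have h5 := (hF w hw).unique h4
    have h6 := (((hsA.hasSum (norm_exp_lt_one hw0)).const_smul (ε * ν)).add
      (hd'.const_smul ε)).sub (P'.hasSum (hsA.hasSum (norm_exp_lt_one hw0)))
    have h7 : (ε * ν) • psum A (Complex.exp (ε * w)) + ε • Complex.exp (ε * w) • d
        - P' (psum A (Complex.exp (ε * w))) = -(Complex.exp (-(ε * ν * w)) * W w) • v := by
      rw [hFA w hw hw0] at h5
      have h8 : P' (psum A (Complex.exp (ε * w))) = P (psum A (Complex.exp (ε * w))) := by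
        simp [hP']
      have h9 : Complex.exp (-(ε * ν * w)) * Complex.exp (ε * ν * w) = 1 := by
        rw [← Complex.exp_add, neg_add_cancel, Complex.exp_zero]
      have h10 := congrArg (fun x => Complex.exp (-(ε * ν * w)) • x) h5
      simp only [map_smul, smul_sub, smul_add, smul_smul, Function.comp_apply] at h10
      rw [h9, one_smul] at h10
      rw [h8]
      have e1 : Complex.exp (-(ε * ν * w)) * (Complex.exp (ε * ν * w) * (Complex.exp (ε * w) * ε))
          = Complex.exp (ε * w) * ε := by rw [← mul_assoc, h9, one_mul]
      have e2 : Complex.exp (-(ε * ν * w)) * (Complex.exp (ε * ν * w) * (ε * ν))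
          = ε * ν := by rw [← mul_assoc, h9, one_mul]
      rw [e1, e2] at h10
      linear_combination (norm := module) -h10
    rw [← h7]
    refine h6.congr_fun fun n => ?_
    simp only [hy, map_smul, smul_sub]
    have : P' (A n) = P (A n) := by simp [hP']
    rw [this]
    module
  set e : Fin N → V N →L[ℂ] ℂ := fun k => LinearMap.toContinuousLinearMap (h.basis.coord k) with he
  have hek : ∀ k x, e k x = h.basis.repr x k := fun k x => by simp [he]
  have hdi := h.coord_ne_zero i
  -- Any coordinate would do, since general position makes every coordinate of v non-zero.
  set α : ℕ → ℂ := fun n => -(h.basis.repr (y n) i / h.basis.repr v i) with hα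
  have hαW : ∀ w ∈ strip, (ε * w).re < 0 → HasSum (fun n : ℕ => Complex.exp (ε * w) ^ n • α n)
      (Complex.exp (-(ε * ν * w)) * W w) := by
    intro w hw hw0
    have := ((e i).hasSum (hyW w hw hw0)).mul_left (-(h.basis.repr v i)⁻¹)
    have h1 : -(h.basis.repr v i)⁻¹ * e i (-(Complex.exp (-(ε * ν * w)) * W w) • v)
        = Complex.exp (-(ε * ν * w)) * W w := by
      rw [map_smul, hek, smul_eq_mul]
      field_simp
    rw [h1] at this
    refine this.congr_fun fun n => ?_
    rw [map_smul, hek, smul_eq_mul, smul_eq_mul]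
    simp only [hα]
    ring
  have hsα := hreal _ α _ hαW
  refine ⟨α, hsα, fun w hw hw0 => ?_, fun n => ?_⟩
  · rw [(hsα.hasSum (norm_exp_lt_one hw0)).unique (hαW w hw hw0), ← mul_assoc, ← Complex.exp_add,
      add_neg_cancel, Complex.exp_zero, one_mul]
  · refine h.basis.repr.injective (Finsupp.ext fun k => ?_)
    have hsy := hreal _ y _ hyW
    -- These minors of y n against v are the coefficients of a power series with sum 0; their
    -- vanishing makes y n proportional to v.
    set c : ℕ → ℂ := fun n => h.basis.repr v i * h.basis.repr (y n) k
      - h.basis.repr v k * h.basis.repr (y n) i with hc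
    have hcs : ∀ w ∈ strip, (ε * w).re < 0 →
        HasSum (fun n : ℕ => Complex.exp (ε * w) ^ n • c n) 0 := by
      intro w hw hw0
      have := (((e k).hasSum (hyW w hw hw0)).mul_left (h.basis.repr v i)).sub
        (((e i).hasSum (hyW w hw hw0)).mul_left (h.basis.repr v k))
      have h1 : h.basis.repr v i * e k (-(Complex.exp (-(ε * ν * w)) * W w) • v)
          - h.basis.repr v k * e i (-(Complex.exp (-(ε * ν * w)) * W w) • v) = 0 := by
        rw [map_smul, map_smul, hek, hek, smul_eq_mul, smul_eq_mul]
        ring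
      rw [h1] at this
      refine this.congr_fun fun n => ?_
      rw [map_smul, map_smul, hek, hek]
      simp only [hc, smul_eq_mul]
      ring
    have hc0 := (hreal _ c _ hcs).eq_zero (fun x h0 h1 => by
      obtain ⟨w, hw, hw0, hwx⟩ := exists_strip_exp_mul_eq hε h0 h1
      rw [← hwx]
      exact ((hreal _ c _ hcs).hasSum (norm_exp_lt_one hw0)).unique (hcs w hw hw0)) n
    simp only [hc] at hc0
    change h.basis.repr (y n) k = _
    simp only [hα, map_neg, map_smul, Finsupp.neg_apply, Finsupp.smul_apply, smul_eq_mul]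
    field_simp
    linear_combination hc0

/-! ### The characteristic polynomial of a rank one perturbation -/

/-- With φ(ζ_j) = 1 the eigenvector equation reads P ζ_j = μ_j ζ_j + v, so (λ_k - μ_j) times the
k-th coordinate of ζ_j is d_k, the k-th coordinate of v. As d_k ≠ 0, λ_k ≠ μ_j. Since the
coordinates of ζ_j add up to φ(ζ_j) = 1, the two monic polynomials of degree N agree at the N
distinct points μ_j. -/
theorem prod_sub_eq {N : ℕ} {P Q : Module.End ℂ (V N)} {φ : V N →ₗ[ℂ] ℂ} {v : V N}
    (hφv : ∀ x, Q x = φ x • v) {lam mu : Fin N → ℂ} {ξ ζ : Fin N → V N}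
    (hP : IsNormalizedEigensystem φ v P lam ξ)
    (hR : IsNormalizedEigensystem φ v (Q - P) (fun j => -mu j) ζ) :
    (∀ k j, lam k ≠ mu j) ∧ ∀ s : ℂ, ∏ j, (s - mu j) = ∏ k, (s - lam k)
      + ∑ k, hP.basis.repr v k * ∏ l ∈ Finset.univ.erase k, (s - lam l) := by
  have hcoord : ∀ j k, (lam k - mu j) * hP.basis.repr (ζ j) k = hP.basis.repr v k := by
    intro j k
    have h1 := hR.apply_eq j
    rw [LinearMap.sub_apply, hφv, hR.normalized, one_smul] at h1
    have h2 : P (ζ j) = mu j • ζ j + v := by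
      rw [← sub_eq_zero] at h1 ⊢
      linear_combination (norm := module) -h1
    have h3 := hP.repr_apply (ζ j) k
    rw [h2, map_add, map_smul] at h3
    simp only [Finsupp.add_apply, Finsupp.smul_apply, smul_eq_mul] at h3
    linear_combination -h3
  refine ⟨fun k j hkj => hP.coord_ne_zero k ?_, fun s => ?_⟩
  · rw [← hcoord j k, hkj, sub_self, zero_mul]
  · set D : Polynomial ℂ := ∏ k, (Polynomial.X - Polynomial.C (lam k)) with hD
    set S : Polynomial ℂ := ∑ k, Polynomial.C (hP.basis.repr v k) *
      ∏ l ∈ Finset.univ.erase k, (Polynomial.X - Polynomial.C (lam l)) with hS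
    set M : Polynomial ℂ := ∏ j, (Polynomial.X - Polynomial.C (mu j)) with hM
    have hDd : D.degree = N := by
      rw [hD, Polynomial.degree_prod]; simp
    have hMd : M.degree = N := by
      rw [hM, Polynomial.degree_prod]; simp
    have hDm : D.Monic := Polynomial.monic_prod_of_monic _ _ fun k _ => Polynomial.monic_X_sub_C _
    have hMm : M.Monic := Polynomial.monic_prod_of_monic _ _ fun k _ => Polynomial.monic_X_sub_C _
    have hdeg1 : (M - D).degree < (N : ℕ) := by
      have := Polynomial.degree_sub_lt_left (p := M) (q := D) (by rw [hDd, hMd]) hMm.ne_zero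
        (by rw [hMm.leadingCoeff, hDm.leadingCoeff])
      rwa [hMd] at this
    have hdeg2 : S.degree < (N : ℕ) := by
      rw [← Polynomial.mem_degreeLT]
      refine Submodule.sum_mem _ fun k _ => ?_
      rw [Polynomial.mem_degreeLT]
      refine (Polynomial.degree_mul_le _ _).trans_lt ?_
      have h1 : (∏ l ∈ Finset.univ.erase k, (Polynomial.X - Polynomial.C (lam l))).degree
          = ((N - 1 : ℕ) : WithBot ℕ) := by
        rw [Polynomial.degree_prod]; simp
      have h2 : ((N - 1 : ℕ) : WithBot ℕ) < (N : ℕ) := by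
        have := k.pos
        exact_mod_cast Nat.sub_lt this one_pos
      rw [h1]
      refine lt_of_le_of_lt (add_le_add_left Polynomial.degree_C_le _) ?_
      simpa using h2
    have key : M = D + S := by
      refine Polynomial.eq_of_degree_sub_lt_of_eval_index_eq (s := Finset.univ) (v := mu)
        (fun j _ l _ hjl => hR.distinct (by simp [hjl])) ?_ fun j _ => ?_
      · rw [← sub_sub, Finset.card_univ, Fintype.card_fin]
        exact (Polynomial.degree_sub_le _ _).trans_lt (max_lt hdeg1 hdeg2)
      · simp only [hM, hD, hS, Polynomial.eval_add, Polynomial.eval_prod, Polynomial.eval_sub,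
          Polynomial.eval_X, Polynomial.eval_C, Polynomial.eval_finsetSum, Polynomial.eval_mul]
        rw [Finset.prod_eq_zero (Finset.mem_univ j) (sub_self _)]
        have h1 : ∀ k, hP.basis.repr v k * ∏ l ∈ Finset.univ.erase k, (mu j - lam l)
            = -(hP.basis.repr (ζ j) k * ∏ l, (mu j - lam l)) := by
          intro k
          rw [← Finset.mul_prod_erase _ _ (Finset.mem_univ k), ← hcoord j k]
          ring
        rw [Finset.sum_congr rfl fun k _ => h1 k, Finset.sum_neg_distrib, ← Finset.sum_mul,
          ← hP.apply_eq_sum, hR.normalized]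
        ring
    have := congrArg (Polynomial.eval s) key
    simpa only [hM, hD, hS, Polynomial.eval_add, Polynomial.eval_prod, Polynomial.eval_sub,
          Polynomial.eval_X, Polynomial.eval_C, Polynomial.eval_finsetSum, Polynomial.eval_mul]
      using this

/-! ### The Mellin transform of a solution -/

/-- The function by which the derivative of `F`, in the logarithmic coordinate, differs
from `P F`. -/
noncomputable def inhomogeneity {N : ℕ} (φ : V N →ₗ[ℂ] ℂ) (F : ℂ → V N) (w : ℂ) : ℂ :=
  Complex.exp w / (1 + Complex.exp w) * φ (F w)

/-- The factor e^{-w} becomes the shift s ↦ s + 1 under the Mellin transform; it is what produces a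
difference equation. -/
theorem apply_eq_inhomogeneity {N : ℕ} (φ : V N →ₗ[ℂ] ℂ) (F : ℂ → V N) {w : ℂ} (hw : w ∈ strip) :
    φ (F w) = inhomogeneity φ F w + Complex.exp (-w) * inhomogeneity φ F w := by
  have h0 := one_add_exp_ne_zero hw
  have h1 := Complex.exp_ne_zero w
  rw [inhomogeneity, Complex.exp_neg]
  field_simp
  ring

section

variable {N : ℕ} {P Q : Module.End ℂ (V N)} {φ : V N →ₗ[ℂ] ℂ} {v : V N}
  {lam mu : Fin N → ℂ} {ξ ζ : Fin N → V N} {f : ℂ → V N}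

theorem hasSum_zero_exp {ν : ℂ} {a : ℕ → V N}
    (ha : ∀ z ∈ cutPlane, ‖z‖ < 1 → HasSum (fun n : ℕ => cutPow z (ν + n) • a n) (f z))
    {w : ℂ} (hw : w ∈ strip) (hw0 : ((1 : ℂ) * w).re < 0) :
    HasSum (fun n : ℕ => Complex.exp (1 * (ν + n) * w) •
      (Complex.exp ((ν + n) * (Real.pi * Complex.I)) • a n)) (f (-Complex.exp w)) := by
  rw [one_mul] at hw0
  have := ha _ (neg_exp_mem_cutPlane hw) (by rw [norm_neg]; exact norm_exp_lt_one hw0)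
  refine this.congr_fun fun n => ?_
  rw [cutPow_neg_exp hw, smul_smul, one_mul]

theorem hasSum_infty_exp {ν : ℂ} {b : ℕ → V N}
    (hb : ∀ z ∈ cutPlane, 1 < ‖z‖ → HasSum (fun n : ℕ => cutPow z (ν - n) • b n) (f z))
    {w : ℂ} (hw : w ∈ strip) (hw0 : ((-1 : ℂ) * w).re < 0) :
    HasSum (fun n : ℕ => Complex.exp (-1 * (-ν + n) * w) •
      (Complex.exp ((ν - n) * (Real.pi * Complex.I)) • b n)) (f (-Complex.exp w)) := by
  have hw1 : 0 < w.re := by simpa using hw0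
  have := hb _ (neg_exp_mem_cutPlane hw) (by
    rw [norm_neg, Complex.norm_exp]; exact Real.one_lt_exp_iff.2 hw1)
  refine this.congr_fun fun n => ?_
  rw [cutPow_neg_exp hw, smul_smul, show (-1 : ℂ) * (-ν + n) * w = (ν - n) * w by ring]

/-- The expansion coefficients of a solution at zero. -/
theorem exists_coefficients_zero (hφv : ∀ x, Q x = φ x • v)
    (hP : IsNormalizedEigensystem φ v P lam ξ) (i : Fin N) (hf : IsSolution P Q f) {a : ℕ → V N}
    {τ : ℂ} (ha0 : a 0 = τ • ξ i)
    (ha : ∀ z ∈ cutPlane, ‖z‖ < 1 → HasSum (fun n : ℕ => cutPow z (lam i + n) • a n) (f z)) :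
    ∃ (A : ℕ → V N) (α : ℕ → ℂ), SummableInDisc A ∧ SummableInDisc α ∧
      (∀ w ∈ strip, w.re < 0 → f (-Complex.exp w)
        = Complex.exp (lam i * w) • psum A (Complex.exp w)) ∧
      (∀ w ∈ strip, w.re < 0 → inhomogeneity φ (fun w => f (-Complex.exp w)) w
        = Complex.exp (lam i * w) * psum α (Complex.exp w)) ∧
      (∀ n : ℕ, (lam i + n) • A n - P (A n) = -(α n • v)) ∧
      (∀ n, φ (A n) = α n + α (n + 1)) ∧
      α 0 = 0 ∧ α 1 = τ * Complex.exp (lam i * (Real.pi * Complex.I)) := by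
  obtain ⟨hA, hFA, α, hα, hWα, hrec⟩ := exists_coefficients hP i (ε := 1) (Or.inl rfl)
    (W := inhomogeneity φ (fun w => f (-Complex.exp w)))
    (fun w hw => hf.hasDerivAt_exp hφv hw) (fun w hw hw0 => hasSum_zero_exp ha hw hw0)
  simp only [one_mul] at hFA hWα hrec
  set A : ℕ → V N := fun n : ℕ => Complex.exp ((lam i + n) * (Real.pi * Complex.I)) • a n with hAdef
  have hA0 : A 0 = (τ * Complex.exp (lam i * (Real.pi * Complex.I))) • ξ i := by
    simp only [hAdef, Nat.cast_zero, add_zero, ha0, smul_smul, mul_comm]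
  -- A_0 is a multiple of the eigenvector ξ_i, so the recursion at n = 0 reads 0 = -α_0 v.
  have hα0 : α 0 = 0 := by
    have h0 : (lam i + (0 : ℕ)) • A 0 - P (A 0) = -(α 0 • v) := hrec 0
    rw [hA0, map_smul, hP.apply_eq, Nat.cast_zero, add_zero, smul_comm, sub_self, eq_comm,
      neg_eq_zero] at h0
    have h1 := congrArg (fun x => hP.basis.repr x i) h0
    simp only [map_smul, Finsupp.smul_apply, map_zero, Finsupp.zero_apply, smul_eq_mul] at h1
    exact (mul_eq_zero.1 h1).resolve_right (hP.coord_ne_zero i)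
  have hφA : ∀ n, φ (A n) = α n + α (n + 1) := by
    refine (hA.map φ).congr_of_psum (hα.add hα.succ) fun x h0 h1 => ?_
    obtain ⟨w, hw, hw0, hwx⟩ := exists_strip_exp_mul_eq (Or.inl rfl) h0 h1
    rw [one_mul] at hw0 hwx
    rw [← hwx, hA.psum_map φ (norm_exp_lt_one hw0), hα.psum_add hα.succ (norm_exp_lt_one hw0)]
    have h2 := apply_eq_inhomogeneity φ (fun w => f (-Complex.exp w)) hw
    rw [hWα w hw hw0] at h2
    simp only [hFA w hw hw0, map_smul, smul_eq_mul] at h2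
    rw [← mul_right_inj' (Complex.exp_ne_zero (lam i * w)), h2, mul_add,
      hα.psum_succ hα0 (norm_exp_lt_one hw0)]
    have h3 : Complex.exp (-w) * Complex.exp w = 1 := by
      rw [← Complex.exp_add, neg_add_cancel, Complex.exp_zero]
    linear_combination (Complex.exp (lam i * w) * psum (fun n => α (n + 1)) (Complex.exp w)) * h3
  refine ⟨A, α, hA, hα, hFA, hWα, hrec, hφA, hα0, ?_⟩
  have := hφA 0
  rw [hα0, zero_add, hA0, map_smul, hP.normalized, smul_eq_mul, mul_one] at this
  exact this.symm

/-- The expansion coefficients of a solution at infinity. -/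
theorem exists_coefficients_infty (hφv : ∀ x, Q x = φ x • v)
    (hP : IsNormalizedEigensystem φ v P lam ξ)
    (hR : IsNormalizedEigensystem φ v (Q - P) (fun j => -mu j) ζ) (j : Fin N)
    (hf : IsSolutionAtInfty P Q (mu j) (ζ j) f) :
    ∃ (B : ℕ → V N) (β β' : ℕ → ℂ), SummableInDisc B ∧ SummableInDisc β ∧ SummableInDisc β' ∧
      (∀ w ∈ strip, 0 < w.re → f (-Complex.exp w)
        = Complex.exp (mu j * w) • psum B (Complex.exp (-w))) ∧
      (∀ w ∈ strip, 0 < w.re → inhomogeneity φ (fun w => f (-Complex.exp w)) w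
        = Complex.exp (mu j * w) * psum β (Complex.exp (-w))) ∧
      (∀ n : ℕ, (mu j - n) • B n - P (B n) = -(β n • v)) ∧
      (∀ n, φ (B n) = β n + β' n) ∧ β' 0 = 0 ∧ (∀ n, β' (n + 1) = β n) ∧
      β 0 = Complex.exp (mu j * (Real.pi * Complex.I)) := by
  obtain ⟨hs, b, hb0, hb⟩ := hf
  obtain ⟨hB, hFB, β, hβ, hWβ, hrec⟩ := exists_coefficients hP j (ε := -1) (Or.inr rfl)
    (W := inhomogeneity φ (fun w => f (-Complex.exp w)))
    (fun w hw => hs.hasDerivAt_exp hφv hw) (fun w hw hw0 => hasSum_infty_exp hb hw hw0)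
  have e1 : ∀ n : ℕ, -1 * (-mu j + n) = mu j - n := fun n => by ring
  simp only [e1] at hrec
  simp only [neg_mul, one_mul, neg_neg, Complex.neg_re, Left.neg_neg_iff] at hFB hWβ
  set B : ℕ → V N := fun n : ℕ => Complex.exp ((mu j - n) * (Real.pi * Complex.I)) • b n with hBdef
  -- β preceded by a zero: the coefficients of e^{-w} times the inhomogeneity, in powers of e^{-w}.
  set β' : ℕ → ℂ := fun n => Nat.rec 0 (fun n _ => β n) n with hβ'
  have hβ's : SummableInDisc β' := SummableInDisc.of_succ (c := β') hβ
  have hB0 : B 0 = Complex.exp (mu j * (Real.pi * Complex.I)) • ζ j := by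
    simp only [hBdef, Nat.cast_zero, sub_zero, hb0]
  refine ⟨B, β, β', hB, hβ, hβ's, hFB, hWβ, hrec, ?_, rfl, fun _ => rfl, ?_⟩
  · refine (hB.map φ).congr_of_psum (hβ.add hβ's) fun x h0 h1 => ?_
    obtain ⟨w, hw, hw0, hwx⟩ := exists_strip_exp_mul_eq (Or.inr rfl) h0 h1
    rw [neg_one_mul] at hw0 hwx
    have hw1 : 0 < w.re := by simpa using hw0
    have hn := norm_exp_lt_one hw0
    rw [← hwx, hB.psum_map φ hn, hβ.psum_add hβ's hn, hβ's.psum_succ rfl hn]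
    have h2 := apply_eq_inhomogeneity φ (fun w => f (-Complex.exp w)) hw
    rw [hWβ w hw hw1] at h2
    simp only [hFB w hw hw1, map_smul, smul_eq_mul] at h2
    rw [← mul_right_inj' (Complex.exp_ne_zero (mu j * w)), h2]
    change _ = _ * (_ + _ * psum β _)
    ring
  · have h0 : (mu j - (0 : ℕ)) • B 0 - P (B 0) = -(β 0 • v) := hrec 0
    have h1 := hR.apply_eq j
    rw [LinearMap.sub_apply, hφv, hR.normalized, one_smul] at h1
    have h2 : P (ζ j) = mu j • ζ j + v := by
      rw [← sub_eq_zero] at h1 ⊢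
      linear_combination (norm := module) -h1
    rw [hB0, map_smul, h2, Nat.cast_zero, sub_zero] at h0
    have h3 : (β 0 - Complex.exp (mu j * (Real.pi * Complex.I))) • v = 0 := by
      rw [← sub_eq_zero] at h0
      linear_combination (norm := module) h0
    have h4 := congrArg (fun x => hP.basis.repr x j) h3
    simp only [map_smul, Finsupp.smul_apply, map_zero, Finsupp.zero_apply, smul_eq_mul] at h4
    exact sub_eq_zero.1 ((mul_eq_zero.1 h4).resolve_right (hP.coord_ne_zero j))

/-- The recursion for α and the difference equation for the transform have the same proof: divide
the coordinate equations by s - λ_k (or λ_i + n - λ_k), sum over k using that φ is the sum of the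
coordinates, and clear denominators with `prod_sub_eq`. -/
theorem exists_mellin_data (hφv : ∀ x, Q x = φ x • v)
    (hP : IsNormalizedEigensystem φ v P lam ξ)
    (hR : IsNormalizedEigensystem φ v (Q - P) (fun j => -mu j) ζ) (i : Fin N)
    (hf : IsSolution P Q f) {a : ℕ → V N} {τ : ℂ} (ha0 : a 0 = τ • ξ i)
    (ha : ∀ z ∈ cutPlane, ‖z‖ < 1 → HasSum (fun n : ℕ => cutPow z (lam i + n) • a n) (f z))
    {h : Fin N → ℂ → V N} (hh : ∀ j, IsSolutionAtInfty P Q (mu j) (ζ j) (h j)) {c : Fin N → ℂ}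
    (hc : ∀ z ∈ cutPlane, f z = ∑ j, c j • h j z) :
    ∃ (α : ℕ → ℂ) (β : Fin N → ℕ → ℂ) (g : ℂ → ℂ),
      HasExpansions (lam i) mu α (fun j n => c j * β j n) g ∧
      α 0 = 0 ∧ α 1 = τ * Complex.exp (lam i * (Real.pi * Complex.I)) ∧
      (∀ n : ℕ, α (n + 1) * ∏ k, (lam i + n - lam k)
        = (if n = 0 then 0 else -(α n * ∏ j, (lam i + n - mu j)))) ∧
      (∀ j, β j 0 = Complex.exp (mu j * (Real.pi * Complex.I))) ∧
      ∀ s, NotPole (lam i) mu s →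
        regMellin (lam i) mu α (fun j n => c j * β j n) g 0 (s + 1) * ∏ k, (s - lam k)
          = -(regMellin (lam i) mu α (fun j n => c j * β j n) g 0 s * ∏ j, (s - mu j)) := by
  obtain ⟨A, α, hA, hα, hFA, hWα, hrec, hφA, hα0, hα1⟩ :=
    exists_coefficients_zero hφv hP i hf ha0 ha
  choose B β β' hB hβ hβ' hFB hWβ hrecB hφB hβ'0 hββ' hβ0 using
    fun j => exists_coefficients_infty hφv hP hR j (hh j)
  set F : ℂ → V N := fun w => f (-Complex.exp w) with hF
  replace hFA : ∀ w ∈ strip, w.re < 0 →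
    F w = Complex.exp (lam i * w) • psum A (Complex.exp w) := hFA
  set g : ℂ → ℂ := inhomogeneity φ F with hg
  obtain ⟨-, hprod⟩ := prod_sub_eq hφv hP hR
  have hFd : ∀ w ∈ strip, HasDerivAt F (P (F w) - g w • v) w := fun w hw =>
    hf.hasDerivAt_exp hφv hw
  have hFc : ∀ w ∈ strip, F w = ∑ j, c j • h j (-Complex.exp w) := fun w hw =>
    hc _ (neg_exp_mem_cutPlane hw)
  have hdiff : ∀ ψ : V N →ₗ[ℂ] ℂ, ∀ w ∈ strip, DifferentiableAt ℂ (fun w => ψ (F w)) w :=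
    fun ψ w hw => ((LinearMap.toContinuousLinearMap ψ).hasFDerivAt.comp_hasDerivAt w
      (hFd w hw)).differentiableAt
  have hgE : HasExpansions (lam i) mu α (fun j n => c j * β j n) g := by
    refine ⟨hα, fun j => (hβ j).const_mul _, fun w hw => ?_, hWα, fun w hw hw0 => ?_⟩
    · have h1 := hdiff φ w hw
      have h2 : DifferentiableAt ℂ (fun w => Complex.exp w / (1 + Complex.exp w)) w :=
        Complex.differentiableAt_exp.div (Complex.differentiableAt_exp.const_add 1)
          (one_add_exp_ne_zero hw)
      exact h2.mul h1
    · have hn : ‖Complex.exp (-w)‖ < 1 := norm_exp_lt_one (by simpa using hw0)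
      have h1 : g w = ∑ j, c j * inhomogeneity φ (fun w => h j (-Complex.exp w)) w := by
        simp only [hg, inhomogeneity, hFc w hw, map_sum, map_smul, smul_eq_mul, Finset.mul_sum]
        exact Finset.sum_congr rfl fun j _ => by ring
      rw [h1]
      refine Finset.sum_congr rfl fun j _ => ?_
      rw [hWβ j w hw hw0, (hβ j).psum_const_mul _ hn]
      ring
  have hFE : ∀ ψ : V N →ₗ[ℂ] ℂ, HasExpansions (lam i) mu (fun n => ψ (A n))
      (fun j n => c j * ψ (B j n)) (fun w => ψ (F w)) := by
    intro ψ
    refine ⟨hA.map ψ, fun j => ((hB j).map ψ).const_mul _, hdiff ψ, fun w hw hw0 => ?_,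
      fun w hw hw0 => ?_⟩
    · rw [hFA w hw hw0, map_smul, smul_eq_mul, hA.psum_map ψ (norm_exp_lt_one hw0)]
    · have hn : ‖Complex.exp (-w)‖ < 1 := norm_exp_lt_one (by simpa using hw0)
      rw [hFc w hw, map_sum]
      refine Finset.sum_congr rfl fun j _ => ?_
      rw [map_smul, hFB j w hw hw0, map_smul, smul_eq_mul, smul_eq_mul,
        ((hB j).map ψ).psum_const_mul _ hn, (hB j).psum_map ψ hn]
      ring
  have hπ : |(0 : ℝ)| < Real.pi := by simpa using Real.pi_pos
  have hcoordA : ∀ k (n : ℕ), (lam i + n - lam k) * hP.basis.coord k (A n)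
      = -hP.basis.repr v k * α n := by
    intro k n
    have h1 := congrArg (fun x => hP.basis.repr x k) (hrec n)
    simp only [map_sub, map_neg, map_smul, Finsupp.sub_apply, Finsupp.neg_apply,
      Finsupp.smul_apply, smul_eq_mul, hP.repr_apply] at h1
    rw [Module.Basis.coord_apply]
    linear_combination h1
  have hcoordB : ∀ k j (n : ℕ), (mu j - n - lam k) * (c j * hP.basis.coord k (B j n))
      = -hP.basis.repr v k * (c j * β j n) := by
    intro k j n
    have h1 := congrArg (fun x => hP.basis.repr x k) (hrecB j n)
    simp only [map_sub, map_neg, map_smul, Finsupp.sub_apply, Finsupp.neg_apply,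
      Finsupp.smul_apply, smul_eq_mul, hP.repr_apply] at h1
    rw [Module.Basis.coord_apply]
    linear_combination c j * h1
  refine ⟨α, β, g, hgE, hα0, hα1, fun n => ?_, hβ0, fun s hs => ?_⟩
  · by_cases hn : n = 0
    · rw [if_pos hn, hn, Finset.prod_eq_zero (Finset.mem_univ i) (by simp), mul_zero]
    · rw [if_neg hn, hprod]
      have h1 := hφA n
      rw [hP.apply_eq_sum] at h1
      have h2 : ∀ k, hP.basis.repr (A n) k * ∏ l, (lam i + n - lam l)
          = -(α n * (hP.basis.repr v k * ∏ l ∈ Finset.univ.erase k, (lam i + n - lam l))) := by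
        intro k
        have := hcoordA k n
        rw [Module.Basis.coord_apply] at this
        rw [← Finset.mul_prod_erase _ _ (Finset.mem_univ k)]
        linear_combination (∏ l ∈ Finset.univ.erase k, (lam i + n - lam l)) * this
      have h3 : (∑ k, hP.basis.repr (A n) k) * ∏ l, (lam i + n - lam l)
          = -(α n * ∑ k, hP.basis.repr v k * ∏ l ∈ Finset.univ.erase k, (lam i + n - lam l)) := by
        rw [Finset.sum_mul, Finset.sum_congr rfl fun k _ => h2 k, Finset.sum_neg_distrib,
          Finset.mul_sum]
      rw [h1] at h3
      linear_combination h3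
  · set Y := regMellin (lam i) mu α (fun j n => c j * β j n) g 0 with hY
    set M : Fin N → ℂ := fun k => regMellin (lam i) mu (fun n => hP.basis.coord k (A n))
      (fun j n => c j * hP.basis.coord k (B j n)) (fun w => hP.basis.coord k (F w)) 0 s with hM
    -- The transform of F_k' - λ_k F_k = -d_k g.
    have h1 : ∀ k, (s - lam k) * M k = -hP.basis.repr v k * Y s := by
      intro k
      have h2 := (hFE (hP.basis.coord k)).regMellin_deriv (κ := lam k)
        (G := fun w => -hP.basis.repr v k * g w) (continuousOn_const.mul hgE.continuousOn)
        (fun w hw => by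
          refine ((LinearMap.toContinuousLinearMap (hP.basis.coord k)).hasFDerivAt.comp_hasDerivAt
            w (hFd w hw)).congr_deriv ?_
          simp only [LinearMap.coe_toContinuousLinearMap', map_sub, map_smul, smul_eq_mul,
            Module.Basis.coord_apply, hP.repr_apply]
          ring) hs hπ
      simp only [hcoordA, hcoordB] at h2
      rw [regMellin_const_mul] at h2
      exact h2.symm
    -- The transform of φ(F) = g + e^{-w} g.
    have h2 : ∑ k, M k = Y s + Y (s + 1) := by
      have h3 := regMellin_sum Finset.univ (fun k => hFE (hP.basis.coord k)) hπ s
      have h4 : ∀ x, ∑ k, hP.basis.coord k x = φ x := fun x => (hP.apply_eq_sum x).symm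
      simp only [← Finset.mul_sum, h4, hφA, hφB] at h3
      have h5 := regMellin_add_one (lam := lam i) (mu := mu) hα hα0
        (b := fun j n => c j * β j n) (b' := fun j n => c j * β' j n) (g := g)
        (fun j => (hβ' j).const_mul _)
        (fun j => by rw [hβ'0, mul_zero]) (fun j n => by rw [hββ']) 0 s
      have h6 := regMellin_add (lam := lam i) (mu := mu) hα hα.succ
        (b := fun j n => c j * β j n) (b' := fun j n => c j * β' j n) (g := g)
        (g' := fun w => Complex.exp (-w) * g w)
        (fun j => (hβ j).const_mul _) (fun j => (hβ' j).const_mul _) hgE.continuousOn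
        (ContinuousOn.mul (by fun_prop) hgE.continuousOn) hπ s
      simp only [hM]
      rw [← h3, hY, h5, ← h6]
      simp only [mul_add]
      have h7 : ∀ w ∈ strip, φ (F w) = g w + Complex.exp (-w) * g w := fun w hw =>
        apply_eq_inhomogeneity φ F hw
      rw [regMellin, regMellin]
      congr 2
      refine intervalIntegral.integral_congr fun t _ => ?_
      simp only [h7 _ (add_mul_I_mem_strip hπ t)]
    rw [hprod s]
    have h3 : ∀ k, M k * ∏ l, (s - lam l)
        = -(Y s * (hP.basis.repr v k * ∏ l ∈ Finset.univ.erase k, (s - lam l))) := by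
      intro k
      rw [← Finset.mul_prod_erase _ _ (Finset.mem_univ k)]
      linear_combination (∏ l ∈ Finset.univ.erase k, (s - lam l)) * h1 k
    have h4 : (∑ k, M k) * ∏ l, (s - lam l)
        = -(Y s * ∑ k, hP.basis.repr v k * ∏ l ∈ Finset.univ.erase k, (s - lam l)) := by
      rw [Finset.sum_mul, Finset.sum_congr rfl fun k _ => h3 k, Finset.sum_neg_distrib,
        Finset.mul_sum]
    rw [h2] at h4
    linear_combination h4

end

/-! ### The connection coefficients -/

theorem sin_pi_mul_ne_zero {e s : ℂ} (h : NotCongr e s) :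
    Complex.sin (Real.pi * (s - e)) ≠ 0 := by
  intro h0
  obtain ⟨n, hn⟩ := Complex.sin_eq_zero_iff.1 h0
  refine h n ?_
  have hπ : (Real.pi : ℂ) ≠ 0 := by exact_mod_cast Real.pi_ne_zero
  have : (Real.pi : ℂ) * (s - e) = Real.pi * n := by rw [hn]; ring
  linear_combination mul_left_cancel₀ hπ this

theorem tendsto_sub_div_sin (e : ℂ) (n : ℕ) :
    Tendsto (fun s => (s - (e + n)) * (Complex.sin (Real.pi * (s - e)))⁻¹) (𝓝[≠] (e + n))
      (𝓝 ((-1) ^ n / Real.pi)) := by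
  have hπ : (Real.pi : ℂ) ≠ 0 := by exact_mod_cast Real.pi_ne_zero
  have h1 : HasDerivAt (fun s => Complex.sin (Real.pi * (s - e)))
      (Complex.cos (Real.pi * (e + n - e)) * (Real.pi * 1)) (e + n) :=
    (((hasDerivAt_id (e + n : ℂ)).sub_const e).const_mul (Real.pi : ℂ)).csin
  have h2 : Complex.cos (Real.pi * (e + n - e)) = (-1) ^ n := by
    rw [add_sub_cancel_left, mul_comm]
    exact_mod_cast congrArg Complex.ofReal (Real.cos_nat_mul_pi n)
  rw [h2, hasDerivAt_iff_tendsto_slope, mul_one] at h1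
  have h3 := h1.inv₀ (mul_ne_zero (pow_ne_zero _ (by norm_num)) hπ)
  have h4 : ((-1 : ℂ) ^ n * Real.pi)⁻¹ = (-1) ^ n / Real.pi := by
    rw [mul_inv, ← inv_pow, inv_neg_one, div_eq_mul_inv]
  rw [h4] at h3
  refine h3.congr fun s => ?_
  have h5 : Complex.sin (Real.pi * (e + n - e)) = 0 := by
    rw [add_sub_cancel_left, mul_comm]
    exact Complex.sin_nat_mul_pi n
  rw [slope_def_field, h5, sub_zero, inv_div, div_eq_mul_inv]

theorem continuous_inv_Gamma : Continuous fun s : ℂ => (Complex.Gamma s)⁻¹ :=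
  Complex.differentiable_one_div_Gamma.continuous

theorem inv_Gamma_ne_zero_of_notCongr {e s : ℂ} (h : NotCongr e s) :
    (Complex.Gamma (s - e))⁻¹ ≠ 0 := by
  refine inv_ne_zero (Complex.Gamma_ne_zero fun m hm => h (-m) ?_)
  push_cast
  linear_combination hm

/-- The facts about the Mellin transform of a solution that determine its connection
coefficients `c`. -/
structure ConnectionData {N : ℕ} (lam mu : Fin N → ℂ) (i : Fin N) (τ : ℂ) (c : Fin N → ℂ)
    (α : ℕ → ℂ) (β : Fin N → ℕ → ℂ) (g : ℂ → ℂ) : Prop where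
  nonresonant_lam : ∀ k l, ∀ n : ℕ, 0 < n → lam k - lam l ≠ n
  nonresonant_mu : ∀ k l, ∀ n : ℕ, 0 < n → mu k - mu l ≠ n
  injective_mu : Function.Injective mu
  lam_ne_mu : ∀ k j, lam k ≠ mu j
  expansions : HasExpansions (lam i) mu α (fun j n => c j * β j n) g
  coeff_one : α 1 = τ * Complex.exp (lam i * (Real.pi * Complex.I))
  coeff_succ : ∀ n : ℕ, α (n + 1) * ∏ k, (lam i + n - lam k)
        = (if n = 0 then 0 else -(α n * ∏ j, (lam i + n - mu j)))
  coeff_infty : ∀ j, β j 0 = Complex.exp (mu j * (Real.pi * Complex.I))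
  mellin_add_one : ∀ s, NotPole (lam i) mu s →
        regMellin (lam i) mu α (fun j n => c j * β j n) g 0 (s + 1) * ∏ k, (s - lam k)
          = -(regMellin (lam i) mu α (fun j n => c j * β j n) g 0 s * ∏ j, (s - mu j))

namespace ConnectionData

variable {N : ℕ} {lam mu : Fin N → ℂ} {i : Fin N} {τ : ℂ} {c : Fin N → ℂ}
  {α : ℕ → ℂ} {β : Fin N → ℕ → ℂ} {g : ℂ → ℂ}

theorem notPole {s : ℂ} (h1 : NotCongr (lam i) s) (h2 : ∀ j, NotCongr (mu j) s) :
    NotPole (lam i) mu s := by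
  refine ⟨fun n hn => h1 n (by exact_mod_cast hn), fun j n hn => h2 j (-n) ?_⟩
  push_cast
  linear_combination -hn

/-- The periodic factor of the Mellin transform is trivial, on a right half-plane. -/
theorem exists_mellin_eq_right (d : ConnectionData lam mu i τ c α β g) {σ : ℝ}
    (hl : ∀ k, (lam k).re < σ) (hm : ∀ j, (mu j).re < σ) :
    ∃ κ : ℂ, ∀ s : ℂ, σ < s.re → NotCongr (lam i) s →
      regMellin (lam i) mu α (fun j n => c j * β j n) g 0 s *
        ∏ k, (Complex.Gamma (s - lam k) / Complex.Gamma (s - mu k))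
        = κ * (Complex.sin (Real.pi * (s - lam i)))⁻¹ := by
  have hπ : (Real.pi : ℂ) ≠ 0 := by exact_mod_cast Real.pi_ne_zero
  set Y := regMellin (lam i) mu α (fun j n => c j * β j n) g 0 with hY
  set G : ℂ → ℂ := fun s => ∏ k, (Complex.Gamma (s - lam k) / Complex.Gamma (s - mu k)) with hG
  have hsl : ∀ k, ∀ s : ℂ, σ < s.re → 0 < (s - lam k).re := fun k s hs => by
    rw [Complex.sub_re]; linarith [hl k]
  have hsm : ∀ k, ∀ s : ℂ, σ < s.re → 0 < (s - mu k).re := fun k s hs => by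
    rw [Complex.sub_re]; linarith [hm k]
  have ne_of_re : ∀ z : ℂ, 0 < z.re → z ≠ 0 := by
    rintro z hz rfl
    simp at hz
  have hGd : ∀ s : ℂ, σ < s.re → DifferentiableAt ℂ G s := by
    intro s hs
    refine DifferentiableAt.fun_finsetProd fun k _ => DifferentiableAt.div ?_ ?_
      (Complex.Gamma_ne_zero_of_re_pos (hsm k s hs))
    · refine DifferentiableAt.comp s (Complex.differentiableAt_Gamma _ fun m hm' => ?_)
        (by fun_prop)
      have := hsl k s hs
      rw [hm'] at this
      simp at this
      linarith [Nat.cast_nonneg (α := ℝ) m]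
    · refine DifferentiableAt.comp s (Complex.differentiableAt_Gamma _ fun m hm' => ?_)
        (by fun_prop)
      have := hsm k s hs
      rw [hm'] at this
      simp at this
      linarith [Nat.cast_nonneg (α := ℝ) m]
  have hG1 : ∀ s : ℂ, σ < s.re → G (s + 1) * ∏ k, (s - mu k) = G s * ∏ k, (s - lam k) := by
    intro s hs
    simp only [hG, ← Finset.prod_mul_distrib]
    refine Finset.prod_congr rfl fun k _ => ?_
    have e1 := ne_of_re _ (hsl k s hs)
    have e2 := ne_of_re _ (hsm k s hs)
    rw [add_sub_right_comm, add_sub_right_comm, Complex.Gamma_add_one _ e1,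
      Complex.Gamma_add_one _ e2]
    have e3 := Complex.Gamma_ne_zero_of_re_pos (hsm k s hs)
    field_simp
  have hpm : ∀ s : ℂ, σ < s.re → ∏ k, (s - mu k) ≠ 0 := fun s hs =>
    Finset.prod_ne_zero_iff.2 fun k _ => ne_of_re _ (hsm k s hs)
  have hpl : ∀ s : ℂ, σ < s.re → ∏ k, (s - lam k) ≠ 0 := fun s hs =>
    Finset.prod_ne_zero_iff.2 fun k _ => ne_of_re _ (hsl k s hs)
  have hmuR : ∀ s : ℂ, σ < s.re → ∀ j, ∀ n : ℕ, -s ≠ -mu j + n := by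
    intro s hs j n hn
    have h1 := hsm j s hs
    rw [show s - mu j = -n by linear_combination -hn] at h1
    simp at h1
    linarith [Nat.cast_nonneg (α := ℝ) n]
  have hNP : ∀ s : ℂ, σ < s.re → NotCongr (lam i) s → NotPole (lam i) mu s :=
    fun s hs h1 => ⟨fun n hn => h1 n (by exact_mod_cast hn), hmuR s hs⟩
  -- the residues are independent of the pole
  set K : ℕ → ℂ := fun n => α n * G (lam i + n) * (-1) ^ n with hK
  have hKs : ∀ n : ℕ, σ < (lam i + n).re → K (n + 1) = K n := by
    intro n hn
    have hn0 : n ≠ 0 := by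
      rintro rfl
      simp at hn
      linarith [hl i]
    have h1 := d.coeff_succ n
    rw [if_neg hn0] at h1
    have h2 := hG1 _ hn
    have h3 := hpm _ hn
    have h4 := hpl _ hn
    refine mul_right_cancel₀ h3 (mul_right_cancel₀ h4 ?_)
    simp only [hK, Nat.cast_add, Nat.cast_one, ← add_assoc, pow_succ]
    linear_combination (-(α (n + 1)) * (-1) ^ n * ∏ k, (lam i + n - lam k)) * h2 -
      (G (lam i + n) * (-1) ^ n * (∏ k, (lam i + n - lam k))) * h1
  have hKle : ∀ n m : ℕ, n ≤ m → σ < (lam i + n).re → K m = K n := by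
    intro n m hnm hn
    induction m, hnm using Nat.le_induction with
    | base => rfl
    | succ m hm' ih =>
      rw [hKs m ?_, ih]
      have : (n : ℝ) ≤ m := by exact_mod_cast hm'
      simp only [Complex.add_re, Complex.natCast_re] at hn ⊢
      linarith
  obtain ⟨n₀, hn₀⟩ := exists_nat_gt (σ - (lam i).re)
  have hn₀' : σ < (lam i + n₀).re := by
    simp only [Complex.add_re, Complex.natCast_re]; linarith
  have hKc : ∀ n : ℕ, σ < (lam i + n).re → K n = K n₀ := by
    intro n hn
    rcases le_total n n₀ with h | h
    · exact (hKle n n₀ h hn).symm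
    · exact hKle n₀ n h hn₀'
  -- At λ_i + m the product of the transform and G has residue -α_m G(λ_i + m), while the reciprocal
  -- sine has residue (-1)^m/π. One κ removes all the poles because K is constant.
  set κ : ℂ := -(K n₀ * Real.pi) with hκ
  refine ⟨κ, fun s hs hse => sub_eq_zero.1 ?_⟩
  refine eq_zero_of_antiperiodic (σ := σ) (e := lam i)
    (r := fun s => Y s * G s - κ * (Complex.sin (Real.pi * (s - lam i)))⁻¹) ?_ ?_ ?_ ?_ hs hse
  · intro s hs hse
    have h1 := d.expansions.differentiableAt_regMellin (hNP s hs hse)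
    have h2 := hGd s hs
    have h3 : DifferentiableAt ℂ (fun s => (Complex.sin (Real.pi * (s - lam i)))⁻¹) s :=
      DifferentiableAt.inv (by fun_prop) (sin_pi_mul_ne_zero hse)
    exact (h1.mul h2).sub (h3.const_mul κ)
  · intro n hn
    obtain ⟨m, rfl⟩ : ∃ m : ℕ, n = m := by
      refine Int.eq_ofNat_of_zero_le ?_
      by_contra! h
      have : (n : ℝ) < 0 := by exact_mod_cast h
      simp only [Complex.add_re, Complex.intCast_re] at hn
      linarith [hl i]
    rw [Int.cast_natCast] at hn ⊢
    have h1 := d.expansions.tendsto_sub_mul_regMellin (lam i + m) (-α m) (fun _ => 0)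
      (tendsto_sub_mul_polarSum d.expansions.summable_zero (lam i) (re_left 0) m)
      (fun j => tendsto_polarSum_right_of_ne (d.expansions.summable_infty j)
        (hmuR _ hn j) (re_right 0))
    have h2 : Tendsto G (𝓝[≠] (lam i + m)) (𝓝 (G (lam i + m))) :=
      (hGd _ hn).continuousAt.tendsto.mono_left nhdsWithin_le_nhds
    have h3 := (h1.mul h2).sub ((tendsto_sub_div_sin (lam i) m).const_mul κ)
    have h4 : (-α m + ∑ _j : Fin N, (0 : ℂ)) * G (lam i + m) - κ * ((-1) ^ m / Real.pi) = 0 := by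
      have h5 : ((-1 : ℂ) ^ m) * (-1) ^ m = 1 := by rw [← mul_pow]; norm_num
      have h6 : κ * ((-1) ^ m / Real.pi) = -(α m * G (lam i + m)) := by
        rw [hκ, ← hKc m hn]
        simp only [hK]
        field_simp
        linear_combination (-(α m * G (lam i + m))) * h5
      rw [h6, Finset.sum_const_zero]
      ring
    rw [h4] at h3
    refine h3.congr fun s => ?_
    ring
  · intro s hs hse
    have h1 := d.mellin_add_one s (hNP s hs hse)
    have h2 := hG1 s hs
    have h3 := hpm s hs
    have h4 := hpl s hs
    have h5 : Complex.sin (Real.pi * (s + 1 - lam i)) = -Complex.sin (Real.pi * (s - lam i)) := by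
      rw [show (Real.pi : ℂ) * (s + 1 - lam i) = Real.pi * (s - lam i) + Real.pi by ring,
        Complex.sin_add_pi]
    have h6 : Y (s + 1) * G (s + 1) = -(Y s * G s) := by
      refine mul_right_cancel₀ h3 (mul_right_cancel₀ h4 ?_)
      linear_combination (G (s + 1) * ∏ k, (s - mu k)) * h1 - (Y s * ∏ k, (s - mu k)) * h2
    simp only [h5, h6, inv_neg]
    ring
  -- Exponential decay of the transform beats the polynomial growth of the Gamma quotients, and the
  -- reciprocal sine is at most 1/sinh, hence tends to 0.
  · obtain ⟨C, T, hC, hCT⟩ := d.expansions.exists_norm_regMellin_le_exp (σ + 1) (σ + 2)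
    obtain ⟨C', K', hC'⟩ := exists_norm_prod_Gamma_div_le Finset.univ lam mu (σ₁ := σ + 1) (σ + 2)
      (fun k => by linarith [hl k])
    set L := |(lam i).im| with hL
    have t1 : Tendsto (fun y : ℝ => (C * Real.exp 1 * C') * ((1 + y) ^ K' * Real.exp (-(1 + y))))
        atTop (𝓝 ((C * Real.exp 1 * C') * 0)) :=
      ((Real.tendsto_pow_mul_exp_neg_atTop_nhds_zero K').comp
        (tendsto_atTop_add_const_left _ 1 tendsto_id)).const_mul _
    have t2 : Tendsto (fun y : ℝ => ‖κ‖ * (y - L)⁻¹) atTop (𝓝 (‖κ‖ * 0)) :=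
      (tendsto_inv_atTop_zero.comp (tendsto_atTop_add_const_right _ (-L) tendsto_id)).const_mul _
    have t3 := t1.add t2
    simp only [mul_zero, add_zero] at t3
    intro ε hε
    obtain ⟨T', hT'⟩ := eventually_atTop.1 (t3.eventually (gt_mem_nhds hε))
    refine ⟨max (max T T') (L + 1), fun s hs1 hs2 hsT => ?_⟩
    have hT1 : T ≤ |s.im| := ((le_max_left _ _).trans (le_max_left _ _)).trans hsT
    have hT2 : T' ≤ |s.im| := ((le_max_right _ _).trans (le_max_left _ _)).trans hsT
    have hT3 : L + 1 ≤ |s.im| := (le_max_right _ _).trans hsT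
    refine le_trans ?_ (hT' |s.im| hT2).le
    refine (norm_sub_le _ _).trans (add_le_add ?_ ?_)
    · rw [norm_mul]
      have b1 := hCT s hs1 hs2 hT1
      have b2 := hC' s hs1 hs2
      refine (mul_le_mul b1 b2 (norm_nonneg _) (by positivity)).trans ?_
      have hC'0 : 0 ≤ C' * (1 + |s.im|) ^ K' := (norm_nonneg _).trans b2
      calc C * Real.exp (-(2 * |s.im|)) * (C' * (1 + |s.im|) ^ K')
          ≤ C * (Real.exp 1 * Real.exp (-(1 + |s.im|))) * (C' * (1 + |s.im|) ^ K') := by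
            refine mul_le_mul_of_nonneg_right (mul_le_mul_of_nonneg_left ?_ hC) hC'0
            rw [← Real.exp_add]
            refine Real.exp_le_exp.2 ?_
            linarith [abs_nonneg s.im]
        _ = _ := by ring
    · rw [norm_mul, norm_inv]
      refine mul_le_mul_of_nonneg_left (inv_anti₀ (by linarith) ?_) (norm_nonneg _)
      refine le_trans ?_ (sinh_le_norm_sin _)
      refine le_trans ?_ (Real.self_le_sinh_iff.2 (abs_nonneg _))
      have h7 : ((Real.pi : ℂ) * (s - lam i)).im = Real.pi * (s.im - (lam i).im) := by
        simp
      rw [h7, abs_mul, abs_of_pos Real.pi_pos]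
      have h8 := abs_sub_abs_le_abs_sub s.im (lam i).im
      nlinarith [Real.pi_gt_three, abs_nonneg (s.im - (lam i).im)]

/-- The identity on the right half-plane, rewritten with the entire function 1/Γ, is carried to the
left one unit at a time by the difference equation. -/
theorem exists_mellin_eq (d : ConnectionData lam mu i τ c α β g) :
    ∃ κ : ℂ, ∀ s : ℂ, NotCongr (lam i) s → (∀ j, NotCongr (mu j) s) →
      (Real.pi : ℂ) * regMellin (lam i) mu α (fun j n => c j * β j n) g 0 s *
        (Complex.Gamma (1 - s + lam i))⁻¹ * ∏ j, (Complex.Gamma (s - mu j))⁻¹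
        = κ * ∏ k ∈ Finset.univ.erase i, (Complex.Gamma (s - lam k))⁻¹ := by
  have hπ : (Real.pi : ℂ) ≠ 0 := by exact_mod_cast Real.pi_ne_zero
  set Y := regMellin (lam i) mu α (fun j n => c j * β j n) g 0 with hY
  obtain ⟨σ, hσ⟩ : ∃ σ : ℝ, ∀ k, (lam k).re < σ ∧ (mu k).re < σ := by
    obtain ⟨B, hB⟩ := (Set.finite_range fun k => max (lam k).re (mu k).re).bddAbove
    refine ⟨B + 1, fun k => ?_⟩
    have := hB ⟨k, rfl⟩
    have h1 := (le_max_left _ _).trans this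
    have h2 := (le_max_right _ _).trans this
    constructor <;> linarith
  obtain ⟨κ, hκ⟩ := d.exists_mellin_eq_right (fun k => (hσ k).1) (fun k => (hσ k).2)
  have key : ∀ n : ℕ, ∀ s : ℂ, σ < s.re + n → NotCongr (lam i) s → (∀ j, NotCongr (mu j) s) →
      Y s * Complex.sin (Real.pi * (s - lam i)) * ∏ j, (Complex.Gamma (s - mu j))⁻¹
        = κ * ∏ k, (Complex.Gamma (s - lam k))⁻¹ := by
    intro n
    induction n with
    | zero =>
      intro s hs h1 h2
      rw [Nat.cast_zero, add_zero] at hs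
      have h3 := hκ s hs h1
      have h4 := sin_pi_mul_ne_zero h1
      have h5 : ∏ k, Complex.Gamma (s - lam k) ≠ 0 := Finset.prod_ne_zero_iff.2 fun k _ =>
        Complex.Gamma_ne_zero_of_re_pos (by rw [Complex.sub_re]; linarith [(hσ k).1])
      rw [Finset.prod_div_distrib] at h3
      rw [Finset.prod_inv_distrib, Finset.prod_inv_distrib]
      rw [← div_eq_mul_inv, eq_div_iff h4] at h3
      rw [← div_eq_mul_inv, ← div_eq_mul_inv, eq_div_iff h5, ← h3]
      ring
    | succ n ih =>
      intro s hs h1 h2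
      have h3 := ih (s + 1) (by
        rw [Complex.add_re, Complex.one_re]; push_cast at hs; linarith) h1.add_one
        (fun j => (h2 j).add_one)
      have h4 := d.mellin_add_one s (notPole h1 h2)
      have h5 : Complex.sin (Real.pi * (s + 1 - lam i))
          = -Complex.sin (Real.pi * (s - lam i)) := by
        rw [show (Real.pi : ℂ) * (s + 1 - lam i) = Real.pi * (s - lam i) + Real.pi by ring,
          Complex.sin_add_pi]
      have h6 : ∀ ν : Fin N → ℂ, ∏ k, (Complex.Gamma (s - ν k))⁻¹
          = (∏ k, (s - ν k)) * ∏ k, (Complex.Gamma (s + 1 - ν k))⁻¹ := by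
        intro ν
        rw [← Finset.prod_mul_distrib]
        refine Finset.prod_congr rfl fun k _ => ?_
        rw [Complex.one_div_Gamma_eq_self_mul_one_div_Gamma_add_one, add_sub_right_comm]
      rw [h6 mu, h6 lam]
      rw [h5] at h3
      linear_combination (∏ k, (s - lam k)) * h3 + (Complex.sin (Real.pi * (s - lam i)) *
        ∏ k, (Complex.Gamma (s + 1 - mu k))⁻¹) * h4
  refine ⟨κ, fun s h1 h2 => ?_⟩
  obtain ⟨n, hn⟩ := exists_nat_gt (σ - s.re)
  have h3 := key n s (by linarith) h1 h2
  have h4 := Complex.Gamma_mul_Gamma_one_sub (s - lam i)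
  have h5 := sin_pi_mul_ne_zero h1
  have h6 := inv_Gamma_ne_zero_of_notCongr h1
  have h7 : Complex.Gamma (s - lam i) ≠ 0 := fun h0 => h6 (by rw [h0, inv_zero])
  rw [show 1 - (s - lam i) = 1 - s + lam i by ring] at h4
  have h8 : Complex.Gamma (1 - s + lam i) ≠ 0 := by
    intro h0
    rw [h0, mul_zero, eq_comm, div_eq_zero_iff] at h4
    exact h4.elim hπ h5
  -- The reflection formula; its factor 1/Γ(s-λ_i) cancels the factor k = i on the right.
  have h9 : Complex.sin (Real.pi * (s - lam i))
      = Real.pi * ((Complex.Gamma (s - lam i))⁻¹ * (Complex.Gamma (1 - s + lam i))⁻¹) := by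
    rw [eq_div_iff h5] at h4
    field_simp
    linear_combination h4
  rw [h9, ← Finset.mul_prod_erase _ (fun k => (Complex.Gamma (s - lam k))⁻¹)
    (Finset.mem_univ i)] at h3
  refine mul_left_cancel₀ h6 ?_
  linear_combination h3

end ConnectionData

/-! ### Evaluation of the connection coefficients from residues. -/

theorem inv_Gamma_eq_zero_of_eq {s : ℂ} (m : ℕ) (h : s = -m) : (Complex.Gamma s)⁻¹ = 0 := by
  rw [h, Complex.Gamma_neg_nat_eq_zero, inv_zero]

theorem inv_Gamma_one_sub_ne_zero {e s : ℂ} (h : NotCongr e s) :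
    (Complex.Gamma (1 - s + e))⁻¹ ≠ 0 := by
  refine inv_ne_zero (Complex.Gamma_ne_zero fun m hm => h (m + 1) ?_)
  push_cast
  linear_combination -hm

namespace ConnectionData

variable {N : ℕ} {lam mu : Fin N → ℂ} {i : Fin N} {τ : ℂ} {c : Fin N → ℂ}
  {α : ℕ → ℂ} {β : Fin N → ℕ → ℂ} {g : ℂ → ℂ}

theorem eventually_generic (lam mu : Fin N → ℂ) (i : Fin N) (s₀ : ℂ) :
    ∀ᶠ s in 𝓝[≠] s₀, NotCongr (lam i) s ∧ ∀ j, NotCongr (mu j) s :=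
  (eventually_notCongr _ _).and (eventually_all.2 fun _ => eventually_notCongr _ _)

theorem lam_add_ne (d : ConnectionData lam mu i τ c α β g) (k : Fin N) (p m : ℕ) :
    lam i + 1 + p - lam k ≠ -m := by
  intro h
  refine d.nonresonant_lam k i (m + p + 1) (by omega) ?_
  push_cast
  linear_combination -h

theorem mu_sub_ne (d : ConnectionData lam mu i τ c α β g) {j l : Fin N} (hl : l ≠ j) (m : ℕ) :
    mu j - mu l ≠ -m := by
  intro h
  rcases Nat.eq_zero_or_pos m with rfl | hm
  · refine hl (d.injective_mu ?_)
    simp at h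
    linear_combination -h
  · exact d.nonresonant_mu l j m hm (by linear_combination -h)

theorem prod_inv_Gamma_lam_ne_zero (d : ConnectionData lam mu i τ c α β g) :
    ∏ k ∈ Finset.univ.erase i, (Complex.Gamma (lam i + 1 - lam k))⁻¹ ≠ 0 := by
  refine Finset.prod_ne_zero_iff.2 fun k _ => inv_ne_zero (Complex.Gamma_ne_zero fun m => ?_)
  simpa using d.lam_add_ne k 0 m

theorem prod_inv_Gamma_mu_ne_zero (d : ConnectionData lam mu i τ c α β g) (j : Fin N) :
    ∏ l ∈ Finset.univ.erase j, (Complex.Gamma (mu j - mu l))⁻¹ ≠ 0 :=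
  Finset.prod_ne_zero_iff.2 fun _ hl => inv_ne_zero (Complex.Gamma_ne_zero fun m =>
    d.mu_sub_ne (Finset.ne_of_mem_erase hl) m)

/-- The residues of the Mellin transform at the poles that come from infinity. -/
theorem exists_residues (d : ConnectionData lam mu i τ c α β g) (s₀ : ℂ) :
    ∃ B : Fin N → ℂ, (∀ j, Tendsto (fun s => (s - s₀) *
      polarSum (-mu j) (fun n => c j * β j n) (-s) (-(1 + (0 : ℝ) * Complex.I)))
        (𝓝[≠] s₀) (𝓝 (B j))) ∧
      (∀ j, (∀ m : ℕ, s₀ ≠ mu j - m) → B j = 0) ∧ ∀ j, s₀ = mu j → B j = c j * β j 0 := by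
  have : ∀ j, ∃ B : ℂ, Tendsto (fun s => (s - s₀) *
      polarSum (-mu j) (fun n => c j * β j n) (-s) (-(1 + (0 : ℝ) * Complex.I)))
        (𝓝[≠] s₀) (𝓝 B) ∧ ((∀ m : ℕ, s₀ ≠ mu j - m) → B = 0) ∧ (s₀ = mu j → B = c j * β j 0) := by
    intro j
    by_cases h : ∃ m : ℕ, s₀ = mu j - m
    · obtain ⟨m, rfl⟩ := h
      refine ⟨_, tendsto_polarSum_right (d.expansions.summable_infty j) m (re_right 0),
        fun h => absurd rfl (h m), fun h => ?_⟩
      have hm : (m : ℂ) = 0 := by linear_combination -h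
      rw [Nat.cast_eq_zero.1 hm]
    · push Not at h
      refine ⟨0, tendsto_polarSum_right_of_ne (d.expansions.summable_infty j)
        (fun n hn => h n (by linear_combination -hn)) (re_right 0), fun _ => rfl, fun h' => ?_⟩
      exact absurd h' (by simpa using h 0)
  choose B h1 h2 h3 using this
  exact ⟨B, h1, h2, h3⟩

/-- The limit of the identity at s = λ_i + 1, where the simple zero of 1/Γ(1-s+λ_i) meets the simple
pole with contribution -α_1. -/
theorem mellin_factor_eq (d : ConnectionData lam mu i τ c α β g) {κ : ℂ}
    (hκ : ∀ s : ℂ, NotCongr (lam i) s → (∀ j, NotCongr (mu j) s) →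
      (Real.pi : ℂ) * regMellin (lam i) mu α (fun j n => c j * β j n) g 0 s *
        (Complex.Gamma (1 - s + lam i))⁻¹ * ∏ j, (Complex.Gamma (s - mu j))⁻¹
        = κ * ∏ k ∈ Finset.univ.erase i, (Complex.Gamma (s - lam k))⁻¹) :
    κ * ∏ k ∈ Finset.univ.erase i, (Complex.Gamma (lam i + 1 - lam k))⁻¹
      = Real.pi * α 1 * ∏ l, (Complex.Gamma (lam i + 1 - mu l))⁻¹ := by
  obtain ⟨B, hB, hB0, -⟩ := d.exists_residues (lam i + 1)
  have h1 := tendsto_sub_mul_polarSum d.expansions.summable_zero (lam i) (re_left 0) 1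
  rw [Nat.cast_one] at h1
  have h2 := d.expansions.tendsto_sub_mul_regMellin _ _ _ h1 hB
  have h3 : Continuous fun s : ℂ => -Real.pi * (Complex.Gamma (1 - s + lam i + 1))⁻¹ *
      ∏ j, (Complex.Gamma (s - mu j))⁻¹ := by
    refine (continuous_const.mul (continuous_inv_Gamma.comp (by fun_prop))).mul ?_
    exact continuous_finsetProd _ fun j _ => continuous_inv_Gamma.comp (by fun_prop)
  have h4 : Continuous fun s : ℂ =>
      κ * ∏ k ∈ Finset.univ.erase i, (Complex.Gamma (s - lam k))⁻¹ :=
    continuous_const.mul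
      (continuous_finsetProd _ fun j _ => continuous_inv_Gamma.comp (by fun_prop))
  have h5 := h2.mul ((h3.tendsto (lam i + 1)).mono_left nhdsWithin_le_nhds)
  have h6 := (h4.tendsto (lam i + 1)).mono_left (nhdsWithin_le_nhds (s := {lam i + 1}ᶜ))
  have h7 := tendsto_nhds_unique (h6.congr' (by
    filter_upwards [eventually_generic lam mu i (lam i + 1)] with s hs
    rw [← hκ s hs.1 hs.2, Complex.one_div_Gamma_eq_self_mul_one_div_Gamma_add_one (1 - s + lam i)]
    ring)) h5
  -- A pole μ_j - m from infinity may also lie at λ_i + 1, but then 1/Γ(λ_i+1-μ_j) = 1/Γ(-m) = 0.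
  have h8 : (∑ j, B j) * ∏ l, (Complex.Gamma (lam i + 1 - mu l))⁻¹ = 0 := by
    rw [Finset.sum_mul]
    refine Finset.sum_eq_zero fun j _ => ?_
    by_cases h : ∃ m : ℕ, lam i + 1 = mu j - m
    · obtain ⟨m, hm⟩ := h
      rw [Finset.prod_eq_zero (Finset.mem_univ j)
        (inv_Gamma_eq_zero_of_eq m (by linear_combination hm)), mul_zero]
    · push Not at h
      rw [hB0 j h, zero_mul]
  rw [h7, show 1 - (lam i + 1) + lam i + 1 = 1 by ring, Complex.Gamma_one, inv_one]
  linear_combination (-Real.pi : ℂ) * h8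

theorem tendsto_residue_mu (d : ConnectionData lam mu i τ c α β g) (j : Fin N) {A : ℂ}
    (hA : Tendsto (fun s => (s - mu j) * polarSum (lam i) α s (-1 + (0 : ℝ) * Complex.I))
      (𝓝[≠] mu j) (𝓝 A)) :
    Tendsto (fun s => (s - mu j) * regMellin (lam i) mu α (fun j n => c j * β j n) g 0 s)
      (𝓝[≠] mu j) (𝓝 (A + c j * β j 0)) := by
  obtain ⟨B, hB, hB0, hB1⟩ := d.exists_residues (mu j)
  have h1 := d.expansions.tendsto_sub_mul_regMellin _ _ _ hA hB
  rwa [Finset.sum_eq_single j (fun l _ hl => hB0 l fun m hm =>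
    d.mu_sub_ne hl m (by linear_combination hm)) (fun h => absurd (Finset.mem_univ j) h),
    hB1 j rfl] at h1

/-- The recursion for α, solved up to the resonance. At n = p+1 the factors k = i and l = j are p+1
and -(q-p), and their successive quotients build the binomial coefficient; the remaining factors
telescope into Gamma functions. Only p = q is used, where the binomial is 1. -/
theorem coeff_eq_choose (d : ConnectionData lam mu i τ c α β g) {j : Fin N} {q : ℕ}
    (hq : mu j = lam i + 1 + q) {p : ℕ} (hp : p ≤ q) :
    α (p + 1) * (∏ k ∈ Finset.univ.erase i, (Complex.Gamma (lam i + 1 - lam k))⁻¹) *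
        ∏ l ∈ Finset.univ.erase j, (Complex.Gamma (lam i + 1 + p - mu l))⁻¹
      = α 1 * q.choose p *
        (∏ k ∈ Finset.univ.erase i, (Complex.Gamma (lam i + 1 + p - lam k))⁻¹) *
        ∏ l ∈ Finset.univ.erase j, (Complex.Gamma (lam i + 1 - mu l))⁻¹ := by
  induction p with
  | zero => simp
  | succ p ih =>
    have ih := ih (by omega)
    have h1 := d.coeff_succ (p + 1)
    rw [if_neg (by omega), ← Finset.mul_prod_erase _ _ (Finset.mem_univ i),
      ← Finset.mul_prod_erase _ _ (Finset.mem_univ j), hq] at h1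
    have shift : ∀ (S : Finset (Fin N)) (ν : Fin N → ℂ),
        ∏ k ∈ S, (Complex.Gamma (lam i + 1 + p - ν k))⁻¹
          = (∏ k ∈ S, (lam i + ((p + 1 : ℕ) : ℂ) - ν k)) *
            ∏ k ∈ S, (Complex.Gamma (lam i + 1 + ((p + 1 : ℕ) : ℂ) - ν k))⁻¹ := by
      intro S ν
      rw [← Finset.prod_mul_distrib]
      refine Finset.prod_congr rfl fun k _ => ?_
      rw [Complex.one_div_Gamma_eq_self_mul_one_div_Gamma_add_one]
      push_cast
      congr 2 <;> ring_nf
    rw [shift, shift] at ih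
    have hX : ∏ k ∈ Finset.univ.erase i, (lam i + ((p + 1 : ℕ) : ℂ) - lam k) ≠ 0 :=
      Finset.prod_ne_zero_iff.2 fun k _ h =>
        d.lam_add_ne k p 0 (by
          push_cast at h ⊢
          linear_combination h)
    have hY : ∏ l ∈ Finset.univ.erase j, (lam i + ((p + 1 : ℕ) : ℂ) - mu l) ≠ 0 :=
      Finset.prod_ne_zero_iff.2 fun l _ h =>
        d.nonresonant_mu j l (q - p) (by omega) (by
          rw [Nat.cast_sub (by omega)]
          push_cast at h
          linear_combination hq + h)
    have hc : (q.choose (p + 1) : ℂ) * (p + 1) = q.choose p * (q - p) := by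
      have := Nat.choose_succ_right_eq q p
      rw [← Nat.cast_sub (by omega)]
      exact_mod_cast this
    have hp0 : (p + 1 : ℂ) ≠ 0 := by exact_mod_cast p.succ_ne_zero
    refine mul_right_cancel₀ hX (mul_right_cancel₀ hY (mul_right_cancel₀ hp0 ?_))
    generalize (∏ k ∈ Finset.univ.erase i, (lam i + ((p + 1 : ℕ) : ℂ) - lam k)) = X at *
    generalize (∏ l ∈ Finset.univ.erase j, (lam i + ((p + 1 : ℕ) : ℂ) - mu l)) = Y at *
    generalize (∏ k ∈ Finset.univ.erase i,
      (Complex.Gamma (lam i + 1 + ((p + 1 : ℕ) : ℂ) - lam k))⁻¹) = G at *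
    generalize (∏ l ∈ Finset.univ.erase j,
      (Complex.Gamma (lam i + 1 + ((p + 1 : ℕ) : ℂ) - mu l))⁻¹) = M at *
    generalize (∏ k ∈ Finset.univ.erase i, (Complex.Gamma (lam i + 1 - lam k))⁻¹) = G0 at *
    generalize (∏ l ∈ Finset.univ.erase j, (Complex.Gamma (lam i + 1 - mu l))⁻¹) = M0 at *
    push_cast at h1
    linear_combination (G0 * M * Y) * h1 + (Y * (q - p)) * ih - (α 1 * G * M0 * X * Y) * hc

/-- Away from resonance, the limits of the identity at λ_i + 1 and at μ_j share the factor
1/Γ(λ_i+1-μ_j), which is then non-zero and cancels together with κ. At resonance that factor is 0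
and the recursion for α takes over. -/
theorem mul_residue_eq (d : ConnectionData lam mu i τ c α β g) (j : Fin N) :
    c j * β j 0 * ((∏ k ∈ Finset.univ.erase i, (Complex.Gamma (lam i + 1 - lam k))⁻¹) *
        ∏ l ∈ Finset.univ.erase j, (Complex.Gamma (mu j - mu l))⁻¹)
      = α 1 * ((∏ l ∈ Finset.univ.erase j, (Complex.Gamma (lam i + 1 - mu l))⁻¹) *
        ∏ k ∈ Finset.univ.erase i, (Complex.Gamma (mu j - lam k))⁻¹) := by
  have hπ : (Real.pi : ℂ) ≠ 0 := by exact_mod_cast Real.pi_ne_zero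
  obtain ⟨κ, hκ⟩ := d.exists_mellin_eq
  have h0 := d.mellin_factor_eq hκ
  rw [← Finset.mul_prod_erase _ _ (Finset.mem_univ j)] at h0
  by_cases hj : ∃ n : ℕ, mu j = lam i + n
  · obtain ⟨n, hn⟩ := hj
    obtain ⟨q, rfl⟩ : ∃ q, n = q + 1 := Nat.exists_eq_succ_of_ne_zero (by
      rintro rfl
      exact d.lam_ne_mu i j (by simpa using hn.symm))
    have hq : mu j = lam i + 1 + q := by rw [hn]; push_cast; ring
    rw [inv_Gamma_eq_zero_of_eq q (by linear_combination -hq), zero_mul, mul_zero] at h0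
    have hκ0 : κ = 0 := (mul_eq_zero.1 h0).resolve_right d.prod_inv_Gamma_lam_ne_zero
    have h1 := tendsto_sub_mul_polarSum d.expansions.summable_zero (lam i) (re_left 0) (q + 1)
    rw [← hn] at h1
    -- With κ = 0 the transform vanishes at generic points, so its residue -α_{q+1} + c_j β_{j,0} at
    -- μ_j is 0.
    have h2 := tendsto_nhds_unique (d.tendsto_residue_mu j h1) (tendsto_const_nhds.congr' (by
      filter_upwards [eventually_generic lam mu i (mu j)] with s hs
      have h3 := hκ s hs.1 hs.2
      rw [hκ0, zero_mul] at h3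
      have h4 := (mul_eq_zero.1 ((mul_eq_zero.1 ((mul_eq_zero.1 h3).resolve_right
        (Finset.prod_ne_zero_iff.2 fun l _ => inv_Gamma_ne_zero_of_notCongr (hs.2 l)))).resolve_right
        (inv_Gamma_one_sub_ne_zero hs.1))).resolve_left hπ
      rw [h4, mul_zero]))
    have h5 := d.coeff_eq_choose hq le_rfl
    rw [Nat.choose_self, ← hq] at h5
    push_cast at h5
    linear_combination h5 + ((∏ k ∈ Finset.univ.erase i, (Complex.Gamma (lam i + 1 - lam k))⁻¹) *
        ∏ l ∈ Finset.univ.erase j, (Complex.Gamma (mu j - mu l))⁻¹) * h2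
  · push Not at hj
    have h1 := tendsto_polarSum_left_of_ne d.expansions.summable_zero hj (re_left 0)
    have h2 := d.tendsto_residue_mu j h1
    rw [zero_add] at h2
    have h3 : Continuous fun s : ℂ => Real.pi * (Complex.Gamma (1 - s + lam i))⁻¹ *
        (Complex.Gamma (s - mu j + 1))⁻¹ *
        ∏ l ∈ Finset.univ.erase j, (Complex.Gamma (s - mu l))⁻¹ := by
      refine ((continuous_const.mul (continuous_inv_Gamma.comp (by fun_prop))).mul
        (continuous_inv_Gamma.comp (by fun_prop))).mul ?_
      exact continuous_finsetProd _ fun j _ => continuous_inv_Gamma.comp (by fun_prop)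
    have h4 : Continuous fun s : ℂ =>
        κ * ∏ k ∈ Finset.univ.erase i, (Complex.Gamma (s - lam k))⁻¹ :=
      continuous_const.mul
        (continuous_finsetProd _ fun j _ => continuous_inv_Gamma.comp (by fun_prop))
    have h5 := h2.mul ((h3.tendsto (mu j)).mono_left nhdsWithin_le_nhds)
    have h6 := (h4.tendsto (mu j)).mono_left (nhdsWithin_le_nhds (s := {mu j}ᶜ))
    have h7 := tendsto_nhds_unique (h6.congr' (by
      filter_upwards [eventually_generic lam mu i (mu j)] with s hs
      rw [← hκ s hs.1 hs.2, ← Finset.mul_prod_erase _ _ (Finset.mem_univ j),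
        Complex.one_div_Gamma_eq_self_mul_one_div_Gamma_add_one (s - mu j)]
      ring)) h5
    rw [sub_self, zero_add, Complex.Gamma_one, inv_one] at h7
    have h8 : (Complex.Gamma (1 - mu j + lam i))⁻¹ ≠ 0 :=
      inv_ne_zero (Complex.Gamma_ne_zero fun m hm => hj (m + 1) (by
        push_cast
        linear_combination -hm))
    rw [show lam i + 1 - mu j = 1 - mu j + lam i by ring] at h0
    refine mul_left_cancel₀ (mul_ne_zero hπ h8) ?_
    linear_combination (-∏ k ∈ Finset.univ.erase i, (Complex.Gamma (lam i + 1 - lam k))⁻¹) * h7 +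
      (∏ k ∈ Finset.univ.erase i, (Complex.Gamma (mu j - lam k))⁻¹) * h0

/-- Γ takes the value 0 at its poles and 0⁻¹ = 0, so the division implements 1/Γ = 0 there. The
Gamma factors of the numerator are never at a pole, by nonresonance, and may be cancelled. -/
theorem connection_formula (d : ConnectionData lam mu i τ c α β g) (j : Fin N) :
    c j = τ * (Complex.exp (Complex.I * Real.pi * (lam i - mu j)) *
              ((∏ k ∈ Finset.univ.erase i, Complex.Gamma (lam i - lam k + 1)) *
                (∏ l ∈ Finset.univ.erase j, Complex.Gamma (mu j - mu l))) /
              ((∏ l ∈ Finset.univ.erase j, Complex.Gamma (lam i - mu l + 1)) *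
                (∏ k ∈ Finset.univ.erase i, Complex.Gamma (mu j - lam k)))) := by
  have h1 := d.mul_residue_eq j
  have h2 := d.prod_inv_Gamma_lam_ne_zero
  have h3 := d.prod_inv_Gamma_mu_ne_zero j
  rw [d.coeff_infty, d.coeff_one] at h1
  simp only [Finset.prod_inv_distrib] at h1 h2 h3
  simp only [show ∀ k, lam i - lam k + 1 = lam i + 1 - lam k from fun k => by ring,
    show ∀ l, lam i - mu l + 1 = lam i + 1 - mu l from fun l => by ring]
  have h4 : Complex.exp (Complex.I * Real.pi * (lam i - mu j)) *
        Complex.exp (mu j * (Real.pi * Complex.I))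
      = Complex.exp (lam i * (Real.pi * Complex.I)) := by
    rw [← Complex.exp_add]
    ring_nf
  rw [← h4] at h1
  have h5 := Complex.exp_ne_zero (mu j * (Real.pi * Complex.I))
  rw [div_eq_mul_inv, mul_inv]
  refine mul_right_cancel₀ h5 (mul_right_cancel₀ (mul_ne_zero h2 h3) ?_)
  rw [h1]
  have cancel : ∀ x : ℂ, x⁻¹ ≠ 0 → x * x⁻¹ = 1 := fun x hx =>
    mul_inv_cancel₀ fun h => hx (by rw [h, inv_zero])
  have h6 := cancel _ h2
  have h7 := cancel _ h3
  generalize (∏ k ∈ Finset.univ.erase i, Complex.Gamma (lam i + 1 - lam k)) = X at *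
  generalize (∏ l ∈ Finset.univ.erase j, Complex.Gamma (mu j - mu l)) = Y at *
  generalize Complex.exp (Complex.I * Real.pi * (lam i - mu j)) = E at *
  generalize Complex.exp (mu j * (Real.pi * Complex.I)) = F at *
  generalize (∏ k ∈ Finset.univ.erase i, Complex.Gamma (mu j - lam k))⁻¹ = Z at *
  generalize (∏ l ∈ Finset.univ.erase j, Complex.Gamma (lam i + 1 - mu l))⁻¹ = W at *
  linear_combination (-τ * E * F * W * Z * Y * Y⁻¹) * h6 - (τ * E * F * W * Z) * h7

end ConnectionData

/-! ### From connection coefficients to the transport matrix. -/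

section

variable {N : ℕ} {P Q : Module.End ℂ (V N)} {φ : V N →ₗ[ℂ] ℂ} {v : V N} {lam mu : Fin N → ℂ}
  {ξ ζ : Fin N → V N}

/-- The coefficients of a solution with the expansion of `τ • f i` in terms of the solutions at
infinity. -/
theorem transport_coefficient_eq (hφv : ∀ x, Q x = φ x • v)
    (hP : IsNormalizedEigensystem φ v P lam ξ)
    (hR : IsNormalizedEigensystem φ v (Q - P) (fun j => -mu j) ζ) (i : Fin N) {f : ℂ → V N}
    (hf : IsSolution P Q f) {a : ℕ → V N} {τ : ℂ} (ha0 : a 0 = τ • ξ i)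
    (ha : ∀ z ∈ cutPlane, ‖z‖ < 1 → HasSum (fun n : ℕ => cutPow z (lam i + n) • a n) (f z))
    {h : Fin N → ℂ → V N} (hh : ∀ j, IsSolutionAtInfty P Q (mu j) (ζ j) (h j)) {c : Fin N → ℂ}
    (hc : ∀ z ∈ cutPlane, f z = ∑ j, c j • h j z) (j : Fin N) :
    c j = τ * (Complex.exp (Complex.I * Real.pi * (lam i - mu j)) *
              ((∏ k ∈ Finset.univ.erase i, Complex.Gamma (lam i - lam k + 1)) *
                (∏ l ∈ Finset.univ.erase j, Complex.Gamma (mu j - mu l))) /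
              ((∏ l ∈ Finset.univ.erase j, Complex.Gamma (lam i - mu l + 1)) *
                (∏ k ∈ Finset.univ.erase i, Complex.Gamma (mu j - lam k)))) := by
  obtain ⟨α, β, g, h1, -, h3, h4, h5, h6⟩ := exists_mellin_data hφv hP hR i hf ha0 ha hh hc
  have d : ConnectionData lam mu i τ c α β g :=
    { nonresonant_lam := hP.nonresonant
      nonresonant_mu := fun k l n hn h => hR.nonresonant l k n hn (by linear_combination h)
      injective_mu := fun k l h => hR.distinct (congrArg Neg.neg h)
      lam_ne_mu := (prod_sub_eq hφv hP hR).1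
      expansions := h1
      coeff_one := h3
      coeff_succ := h4
      coeff_infty := h5
      mellin_add_one := h6 }
  exact d.connection_formula j

/-- A linear relation expresses the zero solution through the h_j. Its expansion at zero has leading
coefficient 0 • ξ_j, so the connection formula with τ = 0 gives c_j = 0; the choice of the index at
zero is immaterial. -/
theorem linearIndependent_solutions_infty (hφv : ∀ x, Q x = φ x • v)
    (hP : IsNormalizedEigensystem φ v P lam ξ)
    (hR : IsNormalizedEigensystem φ v (Q - P) (fun j => -mu j) ζ)
    {h : Fin N → ℂ → V N} (hh : ∀ j, IsSolutionAtInfty P Q (mu j) (ζ j) (h j)) (c : Fin N → ℂ)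
    (hc : ∀ z ∈ cutPlane, ∑ j, c j • h j z = 0) (j : Fin N) : c j = 0 := by
  have h1 := transport_coefficient_eq (f := fun _ => 0) (a := fun _ => 0) (τ := 0) hφv hP hR j
    (fun z _ => by simpa using hasDerivAt_const z (0 : V N)) (by simp)
    (fun z _ _ => by simp) hh (fun z hz => (hc z hz).symm) j
  rwa [zero_mul] at h1

end

end BasicODE

theorem mainTheorem11 (N : ℕ) (P Q : Module.End ℂ (BasicODE.V N))
    (hQ : BasicODE.IsMultipleOfRankOneIdempotent Q)
    (φ : BasicODE.V N →ₗ[ℂ] ℂ) (v : BasicODE.V N) (hφv : ∀ x, Q x = φ x • v)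
    (lam mu : Fin N → ℂ) (ξ ζ : Fin N → BasicODE.V N)
    (hP : BasicODE.IsNormalizedEigensystem φ v P lam ξ)
    (hR : BasicODE.IsNormalizedEigensystem φ v (Q - P) (fun j => -mu j) ζ) :
    (∃ f h : Fin N → ℂ → BasicODE.V N,
      (∀ i, BasicODE.IsSolutionAtZero P Q (lam i) (ξ i) (f i)) ∧
      (∀ j, BasicODE.IsSolutionAtInfty P Q (mu j) (ζ j) (h j))) ∧
    ∀ f h : Fin N → ℂ → BasicODE.V N,
      (∀ i, BasicODE.IsSolutionAtZero P Q (lam i) (ξ i) (f i)) →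
      (∀ j, BasicODE.IsSolutionAtInfty P Q (mu j) (ζ j) (h j)) →
      ∀ c : Fin N → Fin N → ℂ,
        BasicODE.IsTransportMatrix f h c ↔
          ∀ i j, c i j =
            Complex.exp (Complex.I * Real.pi * (lam i - mu j)) *
              ((∏ k ∈ Finset.univ.erase i, Complex.Gamma (lam i - lam k + 1)) *
                (∏ l ∈ Finset.univ.erase j, Complex.Gamma (mu j - mu l))) /
              ((∏ l ∈ Finset.univ.erase j, Complex.Gamma (lam i - mu l + 1)) *
                (∏ k ∈ Finset.univ.erase i, Complex.Gamma (mu j - lam k))) := by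
  refine ⟨?_, fun f h hf hh c => ?_⟩
  · have h1 := fun i => BasicODE.exists_isSolutionAtZero P Q (lam i) (ξ i) (hP.apply_eq i)
      fun n hn x hx => hP.eq_zero hn hx
    have h2 := fun j => BasicODE.exists_isSolutionAtZero (Q - P) Q (-mu j) (ζ j) (hR.apply_eq j)
      fun n hn x hx => hR.eq_zero (i := j) hn hx
    choose f hf using h1
    choose h hh using h2
    exact ⟨f, fun j z => Complex.exp (2 * Real.pi * Complex.I * mu j) • h j z⁻¹, hf,
      fun j => (hh j).comp_inv⟩
  · have key : ∀ (i : Fin N) (c : Fin N → ℂ),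
        (∀ z ∈ BasicODE.cutPlane, f i z = ∑ j, c j • h j z) → ∀ j, c j =
            Complex.exp (Complex.I * Real.pi * (lam i - mu j)) *
              ((∏ k ∈ Finset.univ.erase i, Complex.Gamma (lam i - lam k + 1)) *
                (∏ l ∈ Finset.univ.erase j, Complex.Gamma (mu j - mu l))) /
              ((∏ l ∈ Finset.univ.erase j, Complex.Gamma (lam i - mu l + 1)) *
                (∏ k ∈ Finset.univ.erase i, Complex.Gamma (mu j - lam k))) := by
      intro i c hc j
      obtain ⟨h1, a, ha0, ha⟩ := hf i
      have h2 := BasicODE.transport_coefficient_eq (τ := 1) hφv hP hR i h1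
        (by rw [ha0, one_smul]) ha hh hc j
      rwa [one_mul] at h2
    refine ⟨fun hc i => key i (c i) (hc i), fun hc i => ?_⟩
    -- Some row of coefficients exists by independence, and `key` identifies it with the row given
    -- by the formula.
    obtain ⟨c', hc'⟩ := BasicODE.exists_transport (hf i).1 (fun j => (hh j).1)
      (BasicODE.linearIndependent_solutions_infty hφv hP hR hh)
    have h1 : c i = c' := funext fun j => (hc i j).trans (key i c' hc' j).symm
    rw [h1]
    exact hc'
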